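/- Let $\mathcal G$ be a finite set of quantum gates (for instance a universal gate set), each a unitary acting on a constant number of qubits, whose matrix entries are polynomial-time computable complex numbers (a polynomial-time Turing machine on input $1^k$ approximates the real and imaginary part with error at most $2^{-k}$). For $n\ge 1$ let $1/2<\beta(n)<\alpha(n)<1$ with $\alpha(n)-\beta(n)\ge 1/\mathrm{poly}(2^n)$, and assume that fractions approximating $\alpha(n)$ and $\beta(n)$ with error at most $(\alpha(n)-\beta(n))/4$ can be computed in time $\mathrm{poly}(2^n)$, with numerators and denominators written in unary (this is automatic if $\alpha,\beta$ are constants). $\mathsf{MQCSP}_{\alpha,\beta}$ is the following promise problem. The input consists of the truth table of a Boolean function $f:\{0,1\}^n\to\{0,1\}$, $n\ge 1$, a size parameter $s$ in unary, and an ancilla parameter $t\le s$. - Yes instance: there is a quantum circuit $\mathcal C$ with at most $s$ gates from $\mathcal G$ on $n+t$ qubits such that for all $x\in\{0,1\}^n$, $\|(\langle f(x)|\otimes I_{n+t-1})\,\mathcal C|x,0^t\rangle\|^2\ge\alpha(n)$, that is, measuring the first qubit of $\mathcal C|x,0^t\rangle$ gives $f(x)$ with probability at least $\alpha(n)$. -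 No instance: for every quantum circuit $\mathcal C$ with at most $s$ gates from $\mathcal G$ on $n+t$ qubits there is $x\in\{0,1\}^n$ such that $\|(\langle f(x)|\otimes I_{n+t-1})\,\mathcal C|x,0^t\rangle\|^2\le\beta(n)$. A promise problem $(P_Y,P_N)$ over binary strings is in $\mathsf{QCMA}$ if there are a polynomial $p$ and a quantum polynomial-time verifier $V$ such that for $x\in P_Y$ some $w\in\{0,1\}^{p(|x|)}$ satisfies $\Pr[V(x,w)=1]\ge 2/3$, and for $x\in P_N$ every $w\in\{0,1\}^{p(|x|)}$ satisfies $\Pr[V(x,w)=1]\le 1/3$. Here a quantum polynomial-time verifier is a polynomial-time Turing machine that on input $(x,w)$ writes down a quantum circuit over a fixed finite gate set with polynomial-time computable entries; this circuit is run on $|0\cdots0\rangle$, and $V(x,w)$ is the result of measuring its first qubit. **Theorem.** $\mathsf{MQCSP}_{\alpha,\beta}\in\mathsf{QCMA}$. -/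

import Mathlib

open Turing

noncomputable section

namespace MinQCircuit

/-! ### Quantum circuits over a finite gate set -/

/-- A finite quantum gate set: each gate `g` acts on a constant number `arity g` of qubits, by a
unitary matrix indexed by the computational basis states of these qubits. -/
structure GateSet where
  ι : Type
  [fintype : Fintype ι]
  arity : ι → ℕ
  mat : ∀ g, Matrix.unitaryGroup (Fin (arity g) → Bool) ℂ

/-- Vectors of `m` qubits, written in the computational basis. -/
abbrev QState (m : ℕ) : Type := (Fin m → Bool) → ℂ

/-- The computational basis vector `|x⟩`. -/
def basisState {m : ℕ} (x : Fin m → Bool) : QState m := fun y => if y = x then 1 else 0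

/-- The `k`-qubit operator `U` applied to the qubits `e 0, …, e (k - 1)` of an `m`-qubit vector
(`Function.extend e z y` is `y` with the bits at these positions replaced by `z`). -/
def applyOn {k m : ℕ} (U : Matrix (Fin k → Bool) (Fin k → Bool) ℂ) (e : Fin k ↪ Fin m)
    (ψ : QState m) : QState m :=
  fun y => ∑ z : Fin k → Bool, U (y ∘ e) z * ψ (Function.extend e z y)

/-- The probability that measuring the first qubit of `ψ` in the computational basis gives `b`,
that is `‖(⟨b| ⊗ I) ψ‖²`. -/
def firstQubitProb {m : ℕ} (ψ : QState m) (b : Bool) : ℝ :=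
  ∑ y : Fin m → Bool, if ∃ h : 0 < m, y ⟨0, h⟩ = b then ‖ψ y‖ ^ 2 else 0

namespace GateSet

attribute [instance] GateSet.fintype

/-- A gate of `G` together with the distinct qubits, among `m`, that it is applied to. -/
abbrev Op (G : GateSet) (m : ℕ) : Type := Σ g : G.ι, Fin (G.arity g) ↪ Fin m

/-- Circuits on `m` qubits: finite sequences of gates (the first of the list is applied first).
The size of a circuit is the length of the list. -/
abbrev Circuit (G : GateSet) (m : ℕ) : Type := List (G.Op m)

/-- The vector produced by a circuit from the initial vector `ψ`. -/
def run {G : GateSet} {m : ℕ} (C : G.Circuit m) (ψ : QState m) : QState m :=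
  C.foldl (fun φ o => applyOn (G.mat o.1).1 o.2 φ) ψ

/-- The description of a gate application: the name of the gate, then the indices of its qubits,
in unary. -/
def encodeOp (G : GateSet) {m : ℕ} (o : G.Op m) : List (G.ι ⊕ Bool) :=
  Sum.inl o.1 :: (List.ofFn o.2).flatMap fun i =>
    List.replicate (i : ℕ) (Sum.inr true) ++ [Sum.inr false]

/-- The description of a circuit: the number of its qubits, in unary, then its gates. -/
def encodeCircuit (G : GateSet) (C : Σ m, G.Circuit m) : List (G.ι ⊕ Bool) :=
  List.replicate C.1 (Sum.inr true) ++ Sum.inr false :: C.2.flatMap G.encodeOp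

end GateSet

/-! ### Polynomial-time computable numbers -/

/-- Natural numbers in unary. -/
def encodeUnary (k : ℕ) : List Bool := List.replicate k true

/-- Integers in binary, preceded by a sign bit. -/
def encodeInt (z : ℤ) : List Bool := decide (z < 0) :: z.natAbs.bits

/-- Pairs of natural numbers in unary. -/
def encodeUnaryPair (q : ℕ × ℕ) : List Bool :=
  List.replicate q.1 true ++ false :: List.replicate q.2 true

/-- `r` is a polynomial-time computable real number: on input `1ᵏ`, a polynomial-time Turing
machine finds a dyadic approximation of `r` with error at most `2⁻ᵏ`. -/
def PolyTimeReal (r : ℝ) : Prop :=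
  ∃ a : ℕ → ℤ, Nonempty (TM2ComputableInPolyTime encodeUnary encodeInt a) ∧
    ∀ k, |(a k : ℝ) / 2 ^ k - r| ≤ 1 / 2 ^ k

/-- All matrix entries of the gates are polynomial-time computable complex numbers. -/
def GateSet.PolyTimeEntries (G : GateSet) : Prop :=
  ∀ g i j, PolyTimeReal ((G.mat g).1 i j).re ∧
    PolyTimeReal ((G.mat g).1 i j).im

/-- In time polynomial in `2ⁿ` one can compute a fraction that differs from `γ n` by at most
`ε n`, for all `n ≥ 1`. -/
def ApproxInPolyTwoPow (γ ε : ℕ → ℝ) : Prop :=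
  ∃ a : ℕ → ℕ × ℕ,
    Nonempty (TM2ComputableInPolyTime (fun n => encodeUnary (2 ^ n)) encodeUnaryPair a) ∧
    ∀ n, 1 ≤ n → 0 < (a n).2 ∧ |((a n).1 : ℝ) / ((a n).2 : ℝ) - γ n| ≤ ε n

/-! ### Promise problems and QCMA -/

/-- Promise problems over binary strings. -/
structure PromiseProblem where
  yes : Set (List Bool)
  no : Set (List Bool)
  disjoint : Disjoint yes no

/-- Pairs of binary strings, with a separator. -/
def encodePair (q : List Bool × List Bool) : List (Option Bool) :=
  q.1.map some ++ none :: q.2.map some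

/-- The probability that the circuit `C`, started on `|0…0⟩`, outputs `1` on its first qubit. -/
def acceptProb {V : GateSet} (C : Σ m, V.Circuit m) : ℝ :=
  firstQubitProb (GateSet.run C.2 (basisState fun _ => false)) true

/-- The class QCMA (of promise problems). A quantum polynomial-time verifier is a polynomial-time
Turing machine that maps the input `x` and the classical witness `w` to the description of a
quantum circuit over a fixed finite gate set with polynomial-time computable entries; the verifier
accepts when the measurement of the first output qubit of this circuit gives `1`. -/
def PromiseProblem.InQCMA (P : PromiseProblem) : Prop :=
  ∃ (V : GateSet) (verifier : List Bool × List Bool → Σ m, V.Circuit m) (p : Polynomial ℕ),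
    V.PolyTimeEntries ∧
    Nonempty (TM2ComputableInPolyTime encodePair V.encodeCircuit verifier) ∧
    (∀ x ∈ P.yes, ∃ w : List Bool,
      w.length = p.eval x.length ∧ 2 / 3 ≤ acceptProb (verifier (x, w))) ∧
    (∀ x ∈ P.no, ∀ w : List Bool,
      w.length = p.eval x.length → acceptProb (verifier (x, w)) ≤ 1 / 3)

/-! ### The minimum quantum circuit size problem -/

/-- The truth table of `f`: its `i`-th entry is the value of `f` at the binary digits of `i`. -/
def truthTable {n : ℕ} (f : (Fin n → Bool) → Bool) : List Bool :=
  List.ofFn fun i : Fin (2 ^ n) => f fun j => (i : ℕ).testBit j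

/-- The binary string that presents the truth table of `f`, the size parameter `s` (in unary) and
the ancilla parameter `t` (in binary). -/
def encodeInstance {n : ℕ} (f : (Fin n → Bool) → Bool) (s t : ℕ) : List Bool :=
  List.replicate s true ++ false :: (List.replicate n true ++ false :: (truthTable f ++ t.bits))

/-- The initial vector `|x, 0ᵗ⟩`. -/
def inputState {n : ℕ} (t : ℕ) (x : Fin n → Bool) : QState (n + t) :=
  basisState (Fin.append x fun _ => false)

/-- Yes instances, with threshold `a`: some circuit with at most `s` gates on `n + t` qubits
outputs `f x` with probability at least `a`, for all `x`. -/
def IsYes (G : GateSet) (a : ℝ) {n : ℕ} (f : (Fin n → Bool) → Bool) (s t : ℕ) : Prop :=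
  ∃ C : G.Circuit (n + t), C.length ≤ s ∧
    ∀ x, a ≤ firstQubitProb (GateSet.run C (inputState t x)) (f x)

/-- No instances, with threshold `b`: every circuit with at most `s` gates on `n + t` qubits
outputs `f x` with probability at most `b`, for some `x`. -/
def IsNo (G : GateSet) (b : ℝ) {n : ℕ} (f : (Fin n → Bool) → Bool) (s t : ℕ) : Prop :=
  ∀ C : G.Circuit (n + t), C.length ≤ s →
    ∃ x, firstQubitProb (GateSet.run C (inputState t x)) (f x) ≤ b

theorem replicate_true_append_inj {s s' : ℕ} {l l' : List Bool}
    (h : List.replicate s true ++ false :: l = List.replicate s' true ++ false :: l') :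
    s = s' ∧ l = l' := by
  induction s generalizing s' with
  | zero => cases s' with
    | zero => simpa using h
    | succ k => simp [List.replicate_succ] at h
  | succ k ih => cases s' with
    | zero => simp [List.replicate_succ] at h
    | succ k' =>
      simp only [List.replicate_succ, List.cons_append, List.cons.injEq, true_and] at h
      obtain ⟨h1, h2⟩ := ih h
      exact ⟨by rw [h1], h2⟩

theorem truthTable_injective {n : ℕ} {f f' : (Fin n → Bool) → Bool}
    (h : truthTable f = truthTable f') : f = f' := by
  have h1 := List.ofFn_injective h
  funext x
  have h2 := congrFun h1 ⟨Nat.ofBits x, Nat.ofBits_lt_two_pow x⟩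
  simpa [Nat.testBit_ofBits_lt] using h2

theorem bits_injective {t t' : ℕ} (h : t.bits = t'.bits) : t = t' := by
  apply Nat.eq_of_testBit_eq
  intro i
  rw [Nat.testBit_eq_inth, Nat.testBit_eq_inth, h]

/-- Different instances are presented by different strings. -/
theorem encodeInstance_injective {n n' s s' t t' : ℕ} {f : (Fin n → Bool) → Bool}
    {f' : (Fin n' → Bool) → Bool} (h : encodeInstance f s t = encodeInstance f' s' t') :
    n = n' ∧ HEq f f' ∧ s = s' ∧ t = t' := by
  obtain ⟨hs, h1⟩ := replicate_true_append_inj h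
  obtain ⟨hn, h2⟩ := replicate_true_append_inj h1
  subst hn
  obtain ⟨h3, h4⟩ := List.append_inj h2 (by simp [truthTable])
  exact ⟨rfl, heq_of_eq (truthTable_injective h3), hs, bits_injective h4⟩

/-- The promise problem `MQCSP_{α,β}` for the gate set `G`. The thresholds may depend on the number
`n` of input bits of the Boolean function. -/
def MQCSP (G : GateSet) (α β : ℕ → ℝ) (h : ∀ n, 1 ≤ n → β n < α n) : PromiseProblem where
  yes := {u | ∃ (n s t : ℕ) (f : (Fin n → Bool) → Bool), 1 ≤ n ∧ t ≤ s ∧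
    u = encodeInstance f s t ∧ IsYes G (α n) f s t}
  no := {u | ∃ (n s t : ℕ) (f : (Fin n → Bool) → Bool), 1 ≤ n ∧ t ≤ s ∧
    u = encodeInstance f s t ∧ IsNo G (β n) f s t}
  disjoint := by
    rw [Set.disjoint_left]
    rintro u ⟨n, s, t, f, hn, -, rfl, C, hC, hyes⟩ ⟨n', s', t', f', -, -, he, hno⟩
    obtain ⟨rfl, hf, rfl, rfl⟩ := encodeInstance_injective he
    obtain rfl := eq_of_heq hf
    obtain ⟨x, hx⟩ := hno C hC
    exact absurd ((hyes x).trans hx) (not_le.mpr (h n hn))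

end MinQCircuit

end

/-! The witness is the circuit itself. A truth table has `2 ^ n` entries, so a verifier that runs in
polynomial time can afford to test the proposed circuit on every input. For each of the `K = 2 ^ n`
inputs `x` it runs `N` copies of the circuit in parallel, each on its own qubits, and inverts the
first qubit where `f x = 0`, so that a one means agreement with `f`. A reversible classical circuit
then counts the agreements and writes a one to the first qubit exactly when every `x` has at least
`T` of them. Before the counting, the state is a product state, and counting only permutes basis
states. The acceptance probability is therefore that of a classical event about independent trials
(`acceptProb_repetition`, `exec_countAll`).

The ratio `T / N` is the midpoint of the computed approximations of `α n` and `β n`. In a yes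
instance every trial succeeds with probability at least `α n`; Chebyshev's inequality and a union
bound over the inputs bound the rejection probability. In a no instance one input has success
probability at most `β n`, and Chebyshev's inequality for that input alone bounds the acceptance
probability. If `D` is the product of the two denominators, the gap is at least `2 / (3 * D)`,
because the approximations differ by a positive multiple of `1 / D`; hence `32 * K * D ^ 2` trials
per input are enough (`exists_deviation`). This number is polynomial since the fractions come in
unary. Every string decodes to a circuit of size at most `s` (`length_decode_le`), and every such
circuit has a string (`exists_decode`).

The other half of the proof is that a Turing machine writes down this verification circuit in
polynomial time. A small language of register programs with branches, loops and subroutine calls is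
compiled to multi-stack machines with an exact count of steps (`Runs.stepN`, `Prog.computable`). The
predicate `PC`, polynomial-time computability from given registers, is closed under concatenation,
local definitions, case distinctions, loops, bounded iteration and calls, so running times follow
from the shape of the function. `encodeCircuit_verification` turns the description of the circuit
into nested loops over numbers, to which these rules apply (`Desc.description`,
`computable_verifier`). -/

noncomputable section

/-! ### Register programs and their compilation to multi-stack machines. -/

namespace StackProg

/-- A Turing machine used as a subroutine, with translations from the register alphabet `A` to its
input alphabet and from its output alphabet to `A`. -/
structure Oracle (A : Type) where
  tm : FinTM2
  dec : A → tm.Γ tm.k₀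
  enc : tm.Γ tm.k₁ → A

/-- Programs that operate on registers `ℕ → List A`; `call j r r'` runs the `j`-th subroutine on the
reversed contents of `r` and puts its reversed output on top of `r'`. -/
inductive Prog (A J : Type) : Type
  | skip : Prog A J
  | push (r : ℕ) (a : A) : Prog A J
  | pop (r : ℕ) : Prog A J
  | seq (p q : Prog A J) : Prog A J
  | case (r : ℕ) (p : Option A → Prog A J) : Prog A J
  | loop (r : ℕ) (p : Prog A J) : Prog A J
  | call (j : J) (r r' : ℕ) : Prog A J

/-- `StepN f t x y`: the transition function `f` leads from `x` to `y` in exactly `t` steps. -/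
def StepN {C : Type*} (f : C → Option C) (t : ℕ) (x y : C) : Prop :=
  (flip bind f)^[t] (some x) = some y

theorem StepN.refl {C : Type*} (f : C → Option C) (x : C) : StepN f 0 x x := rfl

theorem StepN.one {C : Type*} {f : C → Option C} {x y : C} (h : f x = some y) : StepN f 1 x y := h

theorem StepN.trans {C : Type*} {f : C → Option C} {t t' : ℕ} {x y z : C} (h : StepN f t x y)
    (h' : StepN f t' y z) : StepN f (t + t') x z := by
  unfold StepN at *
  rw [add_comm, Function.iterate_add_apply, h, h']

theorem StepN.head {C : Type*} {f : C → Option C} {t : ℕ} {x y z : C} (h : f x = some y)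
    (h' : StepN f t y z) : StepN f (t + 1) x z := by
  rw [add_comm]; exact (StepN.one h).trans h'

theorem iterate_bind_none {C : Type*} (f : C → Option C) (t : ℕ) :
    (flip bind f)^[t] none = none := by
  induction t with
  | zero => rfl
  | succ t ih => rw [Function.iterate_succ_apply]; exact ih

theorem StepN.exists_head {C : Type*} {f : C → Option C} {t : ℕ} {x z : C}
    (h : StepN f (t + 1) x z) : ∃ y, f x = some y ∧ StepN f t y z := by
  unfold StepN at *
  rw [Function.iterate_succ_apply] at h
  change (flip bind f)^[t] (f x) = some z at h
  cases hx : f x with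
  | none => rw [hx, iterate_bind_none] at h; cases h
  | some y => exact ⟨y, rfl, by rw [hx] at h; exact h⟩

variable {A J : Type}

/-- The execution relation: `Runs O p s s' t` says that `p` leads from the register contents `s` to
`s'` in time `t`. -/
inductive Runs (O : J → Oracle A) : Prog A J → (ℕ → List A) → (ℕ → List A) → ℕ → Prop
  | skip (s) : Runs O .skip s s 1
  | push (s r a) : Runs O (.push r a) s (Function.update s r (a :: s r)) 1
  | pop (s r) : Runs O (.pop r) s (Function.update s r (s r).tail) 1
  | seq {p q s s' s'' t t'} : Runs O p s s' t → Runs O q s' s'' t' →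
      Runs O (.seq p q) s s'' (t + t')
  | case {r p s s' t} : Runs O (p (s r).head?) s s' t → Runs O (.case r p) s s' (t + 1)
  | loop_nil {r p s} : s r = [] → Runs O (.loop r p) s s 1
  | loop_cons {r p s s' s'' t t'} : s r ≠ [] → Runs O p s s' t → Runs O (.loop r p) s' s'' t' →
      Runs O (.loop r p) s s'' (t' + t + 1)
  | call {j r r' s l k} :
      StepN (O j).tm.step k (initList (O j).tm ((s r).reverse.map (O j).dec))
        (haltList (O j).tm l) →
      Runs O (.call j r r') s
        (Function.update (Function.update s r []) r'
          ((l.map (O j).enc).reverse ++ Function.update s r [] r'))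
        ((s r).length + 1 + k + (l.length + 1))

namespace Prog

/-- The labels of the machine code of a program. -/
@[reducible] def Lbl (O : J → Oracle A) : Prog A J → Type
  | skip => Unit
  | push _ _ => Unit
  | pop _ => Unit
  | seq p q => p.Lbl O ⊕ q.Lbl O
  | case _ p => Option (Σ o, (p o).Lbl O)
  | loop _ p => Option (p.Lbl O)
  | call j _ _ => Bool ⊕ (O j).tm.Λ

/-- A machine must have finitely many labels. A `case` has one branch for each element of `Option
A`, which is where the finiteness of the alphabet enters. -/
instance finiteLbl [Finite A] (O : J → Oracle A) : ∀ p : Prog A J, Finite (p.Lbl O)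
  | skip => inferInstanceAs (Finite Unit)
  | push _ _ => inferInstanceAs (Finite Unit)
  | pop _ => inferInstanceAs (Finite Unit)
  | seq p q =>
    have := finiteLbl O p
    have := finiteLbl O q
    inferInstanceAs (Finite (p.Lbl O ⊕ q.Lbl O))
  | case _ p =>
    have := fun o => finiteLbl O (p o)
    inferInstanceAs (Finite (Option (Σ o, (p o).Lbl O)))
  | loop _ p =>
    have := finiteLbl O p
    inferInstanceAs (Finite (Option (p.Lbl O)))
  | call j _ _ =>
    have := @Finite.of_fintype _ (O j).tm.ΛFin
    inferInstanceAs (Finite (Bool ⊕ (O j).tm.Λ))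

/-- The label at which the execution of a program starts. -/
def entry (O : J → Oracle A) : ∀ p : Prog A J, p.Lbl O
  | skip => ()
  | push _ _ => ()
  | pop _ => ()
  | seq p _ => Sum.inl (p.entry O)
  | case _ _ => none
  | loop _ _ => none
  | call _ _ _ => Sum.inl false

/-- All registers of the program are below `b`. -/
def Below (b : ℕ) : Prog A J → Prop
  | skip => True
  | push r _ => r < b
  | pop r => r < b
  | seq p q => p.Below b ∧ q.Below b
  | case r p => r < b ∧ ∀ o, (p o).Below b
  | loop r p => r < b ∧ p.Below b
  | call _ r r' => r < b ∧ r' < b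

theorem Below.mono {b b' : ℕ} (h : b ≤ b') : ∀ {p : Prog A J}, p.Below b → p.Below b'
  | skip, _ => trivial
  | push _ _, hp => lt_of_lt_of_le hp h
  | pop _, hp => lt_of_lt_of_le hp h
  | seq _ _, hp => ⟨hp.1.mono h, hp.2.mono h⟩
  | case _ _, hp => ⟨lt_of_lt_of_le hp.1 h, fun o => (hp.2 o).mono h⟩
  | loop _ _, hp => ⟨lt_of_lt_of_le hp.1 h, hp.2.mono h⟩
  | call _ _ _, hp => ⟨lt_of_lt_of_le hp.1 h, lt_of_lt_of_le hp.2 h⟩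

/-- The compiled machine has one stack for each register below a bound. The branches of a `case`
have a common bound because there are finitely many. -/
theorem exists_below [Finite A] : ∀ p : Prog A J, ∃ b, p.Below b
  | skip => ⟨0, trivial⟩
  | push r _ => ⟨r + 1, Nat.lt_succ_self r⟩
  | pop r => ⟨r + 1, Nat.lt_succ_self r⟩
  | seq p q => by
    obtain ⟨b, hb⟩ := exists_below p
    obtain ⟨b', hb'⟩ := exists_below q
    exact ⟨max b b', hb.mono (le_max_left _ _), hb'.mono (le_max_right _ _)⟩
  | case r p => by
    choose b hb using fun o => exists_below (p o)
    obtain ⟨m, hm⟩ := (Set.finite_range b).bddAbove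
    refine ⟨max (r + 1) m, by simp, fun o => (hb o).mono ?_⟩
    exact (hm ⟨o, rfl⟩).trans (le_max_right _ _)
  | loop r p => by
    obtain ⟨b, hb⟩ := exists_below p
    exact ⟨max (r + 1) b, by simp, hb.mono (le_max_right _ _)⟩
  | call j r r' => ⟨max (r + 1) (r' + 1), by simp, by simp⟩

end Prog

/-- The stacks of the compiled machine: input, output, registers, and the stacks of the
subroutines. -/
inductive Stk (O : J → Oracle A) (B : ℕ) : Type
  | inp : Stk O B
  | out : Stk O B
  | reg (i : Fin B) : Stk O B
  | orc (j : J) (k : (O j).tm.K) : Stk O B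

variable {O : J → Oracle A} {B : ℕ}

instance finiteStk [Finite J] : Finite (Stk O B) := by
  have := fun j => @Finite.of_fintype _ (O j).tm.kFin
  let f : Stk O B → Bool ⊕ Fin B ⊕ (Σ j, (O j).tm.K) := fun x => match x with
    | .inp => .inl false
    | .out => .inl true
    | .reg i => .inr (.inl i)
    | .orc j k => .inr (.inr ⟨j, k⟩)
  refine Finite.of_injective f ?_
  intro x y h
  cases x <;> cases y <;> simp_all [f]

instance : DecidableEq (Stk O B) := Classical.decEq _

/-- The alphabets of the stacks. -/
abbrev Alph (O : J → Oracle A) (B : ℕ) (αΓ βΓ : Type) : Stk O B → Type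
  | .inp => αΓ
  | .out => βΓ
  | .reg _ => A
  | .orc j k => (O j).tm.Γ k

/-- The internal states: the last symbol read, and the states of the subroutines. -/
abbrev St (O : J → Oracle A) : Type := Option A × ∀ j, (O j).tm.σ

variable {αΓ βΓ : Type}

/-- The stack contents with input `i`, output `o`, registers `s` and subroutine stacks `T`. -/
def stks (B : ℕ) (i : List αΓ) (o : List βΓ) (s : ℕ → List A)
    (T : ∀ j k, List ((O j).tm.Γ k)) : ∀ k : Stk O B, List (Alph O B αΓ βΓ k)
  | .inp => i
  | .out => o
  | .reg r => s r
  | .orc j k => T j k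

/-- Empty subroutine stacks. -/
def noStks (O : J → Oracle A) : ∀ j k, List ((O j).tm.Γ k) := fun _ _ => []

/-- The initial states of the subroutines. -/
def initSt (O : J → Oracle A) : ∀ j, (O j).tm.σ := fun j => (O j).tm.initialState

theorem update_stks_inp (i i' : List αΓ) (o : List βΓ) (s : ℕ → List A)
    (T : ∀ j k, List ((O j).tm.Γ k)) :
    Function.update (stks B i o s T) .inp i' = stks B i' o s T := by
  funext k
  cases k <;> simp [Function.update, stks]

theorem update_stks_out (i : List αΓ) (o o' : List βΓ) (s : ℕ → List A)
    (T : ∀ j k, List ((O j).tm.Γ k)) :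
    Function.update (stks B i o s T) .out o' = stks B i o' s T := by
  funext k
  cases k <;> simp [Function.update, stks]

theorem update_stks_reg (i : List αΓ) (o : List βΓ) (s : ℕ → List A)
    (T : ∀ j k, List ((O j).tm.Γ k)) (r : Fin B) (l : List A) :
    Function.update (stks B i o s T) (.reg r) l = stks B i o (Function.update s r l) T := by
  funext k
  cases k with
  | reg r' =>
    by_cases h : r' = r
    · subst h; simp [stks]
    · have h' : (r' : ℕ) ≠ r := fun e => h (Fin.ext e)
      rw [Function.update_of_ne (by simpa using h)]
      simp [stks, h']
  | _ => simp [Function.update, stks]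

theorem update_stks_orc [DecidableEq J] (i : List αΓ) (o : List βΓ) (s : ℕ → List A)
    (T : ∀ j k, List ((O j).tm.Γ k)) (j : J) (k : (O j).tm.K) (l : List ((O j).tm.Γ k)) :
    Function.update (stks B i o s T) (.orc j k) l =
      stks B i o s (Function.update T j (Function.update (T j) k l)) := by
  funext x
  cases x with
  | orc j' k' =>
    by_cases h : j' = j
    · subst h
      by_cases h' : k' = k
      · subst h'; simp [stks]
      · rw [Function.update_of_ne (by simpa using h')]
        simp [stks, h']
    · rw [Function.update_of_ne (by intro e; injection e with e1 _; exact h e1)]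
      simp [stks, h]
  | _ => simp [Function.update, stks]

/-- The statement of a subroutine, as a statement of the compiled machine. -/
def liftStmt [DecidableEq J] {L : Type} (B : ℕ) (αΓ βΓ : Type) (j : J) (inj : (O j).tm.Λ → L)
    (done : L) :
    TM2.Stmt (O j).tm.Γ (O j).tm.Λ (O j).tm.σ → TM2.Stmt (Alph O B αΓ βΓ) L (St O)
  | .push k f q => .push (.orc j k) (fun v => f (v.2 j)) (liftStmt B αΓ βΓ j inj done q)
  | .peek k f q => .peek (.orc j k) (fun v o => (v.1, Function.update v.2 j (f (v.2 j) o)))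
      (liftStmt B αΓ βΓ j inj done q)
  | .pop k f q => .pop (.orc j k) (fun v o => (v.1, Function.update v.2 j (f (v.2 j) o)))
      (liftStmt B αΓ βΓ j inj done q)
  | .load f q => .load (fun v => (v.1, Function.update v.2 j (f (v.2 j))))
      (liftStmt B αΓ βΓ j inj done q)
  | .branch f q q' => .branch (fun v => f (v.2 j)) (liftStmt B αΓ βΓ j inj done q)
      (liftStmt B αΓ βΓ j inj done q')
  | .goto f => .goto (fun v => inj (f (v.2 j)))
  | .halt => .goto (fun _ => done)

variable [DecidableEq J]

/-- A configuration of a subroutine, as a configuration of the compiled machine. -/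
def liftCfg {L : Type} (B : ℕ) (j : J) (inj : (O j).tm.Λ → L) (done : L) (c : Option A)
    (i : List αΓ) (o : List βΓ) (s : ℕ → List A)
    (x : TM2.Cfg (O j).tm.Γ (O j).tm.Λ (O j).tm.σ) : TM2.Cfg (Alph O B αΓ βΓ) L (St O) :=
  ⟨some (x.l.elim done inj), (c, Function.update (initSt O) j x.var),
    stks B i o s (Function.update (noStks O) j x.stk)⟩

/-- A lifted statement touches only the stacks and the state component of subroutine `j`, and `halt`
becomes a jump to `done`. One step therefore corresponds to exactly one step, and running times
carry over unchanged. -/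
theorem stepAux_liftStmt {L : Type} (j : J) (inj : (O j).tm.Λ → L) (done : L) (c : Option A)
    (i : List αΓ) (o : List βΓ) (s : ℕ → List A)
    (q : TM2.Stmt (O j).tm.Γ (O j).tm.Λ (O j).tm.σ) (v : (O j).tm.σ)
    (S : ∀ k, List ((O j).tm.Γ k)) :
    TM2.stepAux (liftStmt B αΓ βΓ j inj done q) (c, Function.update (initSt O) j v)
        (stks B i o s (Function.update (noStks O) j S)) =
      liftCfg B j inj done c i o s (TM2.stepAux q v S) := by
  induction q generalizing v S with
  | push k f q ih =>
    simp only [liftStmt, TM2.stepAux, update_stks_orc]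
    rw [← ih]
    simp [stks]
  | peek k f q ih =>
    simp only [liftStmt, TM2.stepAux]
    rw [← ih]
    simp [stks]
  | pop k f q ih =>
    simp only [liftStmt, TM2.stepAux, update_stks_orc]
    rw [← ih]
    simp [stks]
  | load f q ih =>
    simp only [liftStmt, TM2.stepAux]
    rw [← ih]
    simp
  | branch f q q' ih ih' =>
    simp only [liftStmt, TM2.stepAux, Function.update_self]
    cases f v <;> simp [ih, ih']
  | goto f => simp [liftStmt, TM2.stepAux, liftCfg]
  | halt => simp [liftStmt, TM2.stepAux, liftCfg]

/-- The machine code of a program; `inj` places its labels among those of the machine, and `next`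
is the label at which the execution continues. -/
def Prog.code [Inhabited A] (O : J → Oracle A) (B : ℕ) [NeZero B] (αΓ βΓ : Type) {L : Type} :
    ∀ p : Prog A J, (p.Lbl O → L) → L → p.Lbl O → TM2.Stmt (Alph O B αΓ βΓ) L (St O)
  | .skip, _, next, _ => .goto fun _ => next
  | .push r a, _, next, _ => .push (.reg (Fin.ofNat B r)) (fun _ => a) (.goto fun _ => next)
  | .pop r, _, next, _ => .pop (.reg (Fin.ofNat B r)) (fun v _ => v) (.goto fun _ => next)
  | .seq p q, inj, _, .inl l => p.code O B αΓ βΓ (fun x => inj (.inl x)) (inj (.inr (q.entry O))) l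
  | .seq _ q, inj, next, .inr l => q.code O B αΓ βΓ (fun x => inj (.inr x)) next l
  | .case r p, inj, _, none => .peek (.reg (Fin.ofNat B r)) (fun v o => (o, v.2))
      (.goto fun v => inj (some ⟨v.1, (p v.1).entry O⟩))
  | .case _ p, inj, next, some ⟨o, l⟩ =>
      (p o).code O B αΓ βΓ (fun x => inj (some ⟨o, x⟩)) next l
  | .loop r p, inj, next, none => .peek (.reg (Fin.ofNat B r)) (fun v o => (o, v.2))
      (.branch (fun v => v.1.isSome) (.goto fun _ => inj (some (p.entry O))) (.goto fun _ => next))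
  | .loop _ p, inj, _, some l => p.code O B αΓ βΓ (fun x => inj (some x)) (inj none) l
  | .call j r _, inj, _, .inl false => .pop (.reg (Fin.ofNat B r)) (fun v o => (o, v.2))
      (.branch (fun v => v.1.isSome)
        (.push (.orc j (O j).tm.k₀) (fun v => (O j).dec (v.1.getD default))
          (.goto fun _ => inj (.inl false)))
        (.goto fun _ => inj (.inr (O j).tm.main)))
  | .call j _ r', inj, next, .inl true =>
      .pop (.orc j (O j).tm.k₁) (fun v o => (o.map (O j).enc, v.2))
        (.branch (fun v => v.1.isSome)
          (.push (.reg (Fin.ofNat B r')) (fun v => v.1.getD default)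
            (.goto fun _ => inj (.inl true)))
          (.goto fun _ => next))
  | .call j _ _, inj, _, .inr l =>
      liftStmt B αΓ βΓ j (fun x => inj (.inr x)) (inj (.inl true)) ((O j).tm.m l)

/-- As updates of empty stacks, initial and halting configurations have the form that the loading
and unloading loops of a call produce and consume. -/
theorem initList_eq (tm : FinTM2) (l : List (tm.Γ tm.k₀)) :
    initList tm l = ⟨some tm.main, tm.initialState, Function.update (fun _ => []) tm.k₀ l⟩ := by
  unfold initList
  congr 1
  funext k
  by_cases h : k = tm.k₀
  · subst h; simp
  · simp [h]

theorem haltList_eq (tm : FinTM2) (l : List (tm.Γ tm.k₁)) :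
    haltList tm l = ⟨none, tm.initialState, Function.update (fun _ => []) tm.k₁ l⟩ := by
  unfold haltList
  congr 1
  funext k
  by_cases h : k = tm.k₁
  · subst h; simp
  · simp [h]

section Simulation

variable {L : Type} (M : L → TM2.Stmt (Alph O B αΓ βΓ) L (St O)) {inj' : L}

theorem stepN_liftCfg {j : J} {inj : (O j).tm.Λ → L} {done : L}
    (hM : ∀ l, M (inj l) = liftStmt B αΓ βΓ j inj done ((O j).tm.m l)) (c : Option A)
    (i : List αΓ) (o : List βΓ) (s : ℕ → List A) (k : ℕ)
    (x y : TM2.Cfg (O j).tm.Γ (O j).tm.Λ (O j).tm.σ) (h : StepN (TM2.step (O j).tm.m) k x y) :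
    StepN (TM2.step M) k (liftCfg B j inj done c i o s x) (liftCfg B j inj done c i o s y) := by
  induction k generalizing x with
  | zero => cases h; exact StepN.refl _ _
  | succ k ih =>
    obtain ⟨z, hz, h⟩ := h.exists_head
    refine StepN.head ?_ (ih z h)
    obtain ⟨l, v, S⟩ := x
    cases l with
    | none => cases hz
    | some l =>
      simp only [TM2.step, Option.some.injEq] at hz
      subst hz
      simp only [liftCfg, Option.elim, TM2.step, hM, Option.some.injEq]
      exact stepAux_liftStmt j inj done c i o s _ v S

variable [Inhabited A] [NeZero B]

theorem stks_ofNat {r : ℕ} (h : r < B) (i : List αΓ) (o : List βΓ) (s : ℕ → List A)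
    (T : ∀ j k, List ((O j).tm.Γ k)) : stks B i o s T (.reg (Fin.ofNat B r)) = s r := by
  simp [stks, Fin.ofNat, Nat.mod_eq_of_lt h]

theorem update_stks_ofNat {r : ℕ} (h : r < B) (i : List αΓ) (o : List βΓ) (s : ℕ → List A)
    (T : ∀ j k, List ((O j).tm.Γ k)) (l : List A) :
    Function.update (stks B i o s T) (.reg (Fin.ofNat B r)) l =
      stks B i o (Function.update s r l) T := by
  rw [update_stks_reg]
  simp [Fin.ofNat, Nat.mod_eq_of_lt h]

/-- The configuration of the compiled machine between two commands. -/
def cfgAt (O : J → Oracle A) (B : ℕ) {L : Type} (l : L) (c : Option A) (i : List αΓ) (o : List βΓ)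
    (s : ℕ → List A) : TM2.Cfg (Alph O B αΓ βΓ) L (St O) :=
  ⟨some l, (c, initSt O), stks B i o s (noStks O)⟩

/-- Transferring symbols one at a time from stack to stack reverses them; this explains the
reversals in the `call` rule of `Runs`. The state holds the symbol between the pop and the push. -/
theorem stepN_load {j : J} {r r' : ℕ} (hr : r < B) {inj : (Prog.call j r r').Lbl O → L} {next : L}
    (hM : ∀ l, M (inj l) = Prog.code O B αΓ βΓ (.call j r r') inj next l)
    (i : List αΓ) (o : List βΓ) (l : List A) (s : ℕ → List A) (hs : s r = l) (c : Option A)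
    (S : List ((O j).tm.Γ (O j).tm.k₀)) :
    StepN (TM2.step M) (l.length + 1)
      ⟨some (inj (.inl false)), (c, initSt O), stks B i o s (Function.update (noStks O) j
        (Function.update (fun _ => []) (O j).tm.k₀ S))⟩
      ⟨some (inj (.inr (O j).tm.main)), (none, initSt O), stks B i o (Function.update s r [])
        (Function.update (noStks O) j (Function.update (fun _ => []) (O j).tm.k₀
          (l.reverse.map (O j).dec ++ S)))⟩ := by
  induction l generalizing s c S with
  | nil =>
    refine StepN.one ?_
    simp only [TM2.step, hM, Prog.code, TM2.stepAux, stks_ofNat hr, update_stks_ofNat hr, hs]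
    simp
  | cons a l ih =>
    have := ih (Function.update s r l) (by simp) (some a) ((O j).dec a :: S)
    refine StepN.head ?_ (by simpa using this)
    simp only [TM2.step, hM, Prog.code, TM2.stepAux, stks_ofNat hr, update_stks_ofNat hr, hs,
      update_stks_orc]
    simp [stks]

theorem stepN_unload {j : J} {r r' : ℕ} (hr : r' < B) {inj : (Prog.call j r r').Lbl O → L}
    {next : L} (hM : ∀ l, M (inj l) = Prog.code O B αΓ βΓ (.call j r r') inj next l)
    (i : List αΓ) (o : List βΓ) (l : List ((O j).tm.Γ (O j).tm.k₁)) (s : ℕ → List A)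
    (c : Option A) :
    StepN (TM2.step M) (l.length + 1)
      ⟨some (inj (.inl true)), (c, initSt O), stks B i o s (Function.update (noStks O) j
        (Function.update (fun _ => []) (O j).tm.k₁ l))⟩
      (cfgAt O B next none i o (Function.update s r' ((l.map (O j).enc).reverse ++ s r'))) := by
  induction l generalizing s c with
  | nil =>
    refine StepN.one ?_
    simp only [TM2.step, hM, Prog.code, TM2.stepAux, update_stks_orc]
    have e : Function.update (noStks O) j (fun _ => []) = noStks O :=
      Function.update_eq_self_iff.2 rfl
    simp [stks, cfgAt, e]
  | cons a l ih =>
    have := ih (Function.update s r' ((O j).enc a :: s r')) (some ((O j).enc a))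
    refine StepN.head ?_ (by simpa using this)
    simp only [TM2.step, hM, Prog.code, TM2.stepAux, update_stks_orc, update_stks_ofNat hr,
      stks_ofNat hr]
    simp [stks]

/-- The compiled machine executes programs, step by step. -/
theorem Runs.stepN {p : Prog A J} {s s' : ℕ → List A} {t : ℕ} (h : Runs O p s s' t)
    (hB : p.Below B) {inj : p.Lbl O → L} {next : L}
    (hM : ∀ l, M (inj l) = p.code O B αΓ βΓ inj next l) (i : List αΓ) (o : List βΓ)
    (c : Option A) :
    ∃ c', StepN (TM2.step M) t (cfgAt O B (inj (p.entry O)) c i o s) (cfgAt O B next c' i o s') := by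
  induction h generalizing next c with
  | skip s => exact ⟨c, StepN.one (by simp [cfgAt, hM, Prog.code])⟩
  | push s r a =>
    have hr : r < B := hB
    exact ⟨c, StepN.one (by
      simp only [cfgAt, TM2.step, hM, Prog.code, TM2.stepAux, update_stks_ofNat hr, stks_ofNat hr])⟩
  | pop s r =>
    have hr : r < B := hB
    exact ⟨c, StepN.one (by
      simp only [cfgAt, TM2.step, hM, Prog.code, TM2.stepAux, update_stks_ofNat hr, stks_ofNat hr])⟩
  | @seq p q s s' s'' t t' h h' ih ih' =>
    obtain ⟨c₁, h₁⟩ := ih hB.1 (inj := fun x => inj (.inl x)) (next := inj (.inr (q.entry O)))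
      (fun l => hM (.inl l)) c
    obtain ⟨c₂, h₂⟩ := ih' hB.2 (inj := fun x => inj (.inr x)) (next := next)
      (fun l => hM (.inr l)) c₁
    exact ⟨c₂, h₁.trans h₂⟩
  | @case r p s s' t h ih =>
    have hr : r < B := hB.1
    obtain ⟨c₁, h₁⟩ := ih (hB.2 _) (inj := fun x => inj (some ⟨_, x⟩)) (next := next)
      (fun l => hM (some ⟨_, l⟩)) (s r).head?
    refine ⟨c₁, StepN.head ?_ h₁⟩
    simp only [cfgAt, TM2.step, hM, Prog.code, Prog.entry, TM2.stepAux]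
    rw [stks_ofNat hr]
  | @loop_nil r p s hs =>
    have hr : r < B := hB.1
    refine ⟨none, StepN.one ?_⟩
    simp only [cfgAt, TM2.step, hM, Prog.code, Prog.entry, TM2.stepAux, stks_ofNat hr, hs]
    rfl
  | @loop_cons r p s s' s'' t t' hs h h' ih ih' =>
    have hr : r < B := hB.1
    obtain ⟨c₁, h₁⟩ := ih hB.2 (inj := fun x => inj (some x)) (next := inj none)
      (fun l => hM (some l)) (s r).head?
    obtain ⟨c₂, h₂⟩ := ih' hB (inj := inj) (next := next) hM c₁
    refine ⟨c₂, ?_⟩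
    rw [add_comm t' t]
    refine StepN.head ?_ (h₁.trans h₂)
    obtain ⟨a, l, hl⟩ := List.exists_cons_of_ne_nil hs
    simp only [cfgAt, TM2.step, hM, Prog.code, Prog.entry, TM2.stepAux, stks_ofNat hr, hl]
    rfl
  | @call j r r' s l k h =>
    have e₁ := stepN_load M hB.1 hM i o (s r) s rfl c []
    have e₂ := stepN_liftCfg M (fun l => hM (.inr l)) none i o (Function.update s r []) k _ _ h
    have e₃ := stepN_unload M hB.2 hM i o l (Function.update s r []) none
    refine ⟨none, ?_⟩
    rw [initList_eq, haltList_eq] at e₂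
    simp only [liftCfg, Option.elim] at e₂
    -- A halting configuration is again in the initial internal state, so the same subroutine can be
    -- called any number of times.
    have e0 : Function.update (initSt O) j (O j).tm.initialState = initSt O := by
      simp [initSt]
    have e0' : Function.update (noStks O) j (Function.update (fun _ => []) (O j).tm.k₀ []) =
        noStks O := by
      funext j' k
      by_cases h : j' = j
      · subst h; simp [noStks]
      · simp [noStks, h]
    rw [e0] at e₂
    rw [e0', List.append_nil] at e₁
    exact (e₁.trans e₂).trans e₃

end Simulation

end StackProg

end

noncomputable section

/-! ### Programs as machines with input and output. -/

namespace StackProg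

variable {A J : Type} {O : J → Oracle A}

section Machine

variable [DecidableEq J] [Inhabited A]

/-- The code of the machine that reads its input into register `0`, runs `p`, and outputs the
contents of register `1`. -/
def machineCode {αΓ βΓ : Type} (O : J → Oracle A) (p : Prog A J) (B : ℕ) [NeZero B] (cod : αΓ → A)
    (dcd : A → βΓ) : Bool ⊕ p.Lbl O → TM2.Stmt (Alph O B αΓ βΓ) (Bool ⊕ p.Lbl O) (St O)
  | .inl false => .pop .inp (fun v o => (o.map cod, v.2))
      (.branch (fun v => v.1.isSome)
        (.push (.reg (Fin.ofNat B 0)) (fun v => v.1.getD default) (.goto fun _ => .inl false))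
        (.goto fun _ => .inr (p.entry O)))
  | .inl true => .pop (.reg (Fin.ofNat B 1)) (fun v o => (o, v.2))
      (.branch (fun v => v.1.isSome)
        (.push .out (fun v => dcd (v.1.getD default)) (.goto fun _ => .inl true))
        .halt)
  | .inr l => p.code O B αΓ βΓ .inr (.inl true) l

variable {αΓ βΓ : Type} {p : Prog A J} {B : ℕ} [NeZero B] {cod : αΓ → A} {dcd : A → βΓ}

theorem stepN_input (hB : 0 < B) (l : List αΓ) (s : ℕ → List A) (c : Option A) :
    StepN (TM2.step (machineCode O p B cod dcd)) (l.length + 1)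
      (cfgAt O B (.inl false) c l [] s)
      (cfgAt O B (.inr (p.entry O)) none [] []
        (Function.update s 0 ((l.map cod).reverse ++ s 0))) := by
  induction l generalizing s c with
  | nil =>
    refine StepN.one ?_
    simp only [cfgAt, TM2.step, machineCode, TM2.stepAux, update_stks_inp]
    simp [stks]
  | cons a l ih =>
    have := ih (Function.update s 0 (cod a :: s 0)) (some (cod a))
    refine StepN.head ?_ (by simpa using this)
    simp only [cfgAt, TM2.step, machineCode, TM2.stepAux, update_stks_inp, update_stks_ofNat hB,
      stks_ofNat hB]
    simp [stks]

theorem stepN_output (hB : 1 < B) (l : List A) (o : List βΓ) (s : ℕ → List A) (hs : s 1 = l)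
    (c : Option A) :
    StepN (TM2.step (machineCode O p B cod dcd)) (l.length + 1)
      (cfgAt O B (.inl true) c ([] : List αΓ) o s)
      ⟨none, (none, initSt O), stks B [] ((l.map dcd).reverse ++ o) (Function.update s 1 [])
        (noStks O)⟩ := by
  induction l generalizing s c o with
  | nil =>
    refine StepN.one ?_
    simp only [cfgAt, TM2.step, machineCode, TM2.stepAux, update_stks_ofNat hB, stks_ofNat hB, hs]
    simp
  | cons a l ih =>
    have := ih (dcd a :: o) (Function.update s 1 l) (by simp) (some a)
    refine StepN.head ?_ (by simpa using this)
    simp only [cfgAt, TM2.step, machineCode, TM2.stepAux, update_stks_out, update_stks_ofNat hB,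
      stks_ofNat hB, hs]
    simp [stks]

/-- A program that runs in polynomial time yields a polynomial-time Turing machine. -/
theorem Prog.computable [Finite A] [Finite J] {α β : Type} [Fintype αΓ] {ea : α → List αΓ}
    {eb : β → List βΓ} {f : α → β} (p : Prog A J) (cod : αΓ → A) (dcd : A → βΓ)
    (l : α → List A) (hl : ∀ a, (l a).map dcd = eb (f a)) (q : Polynomial ℕ)
    (hlen : ∀ a, (l a).length ≤ q.eval (ea a).length)
    (h : ∀ a, ∃ t ≤ q.eval (ea a).length, Runs O p
      (Function.update (fun _ => []) 0 ((ea a).map cod).reverse)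
      (Function.update (fun _ => []) 1 (l a).reverse) t) :
    Nonempty (TM2ComputableInPolyTime ea eb f) := by
  obtain ⟨b, hb⟩ := p.exists_below
  -- Registers `0` and `1` carry the input and the output, even if the program does not mention
  -- them.
  let B := b + 2
  have hB : p.Below B := hb.mono (by omega)
  have : ∀ j, Fintype (O j).tm.σ := fun j => (O j).tm.σFin
  have : Fintype J := Fintype.ofFinite J
  have : Fintype A := Fintype.ofFinite A
  let tm : FinTM2 :=
    { K := Stk O B
      kFin := Fintype.ofFinite _
      k₀ := .inp
      k₁ := .out
      Γ := Alph O B αΓ βΓ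
      Λ := Bool ⊕ p.Lbl O
      main := .inl false
      ΛFin := Fintype.ofFinite _
      σ := St O
      initialState := (none, initSt O)
      σFin := Fintype.ofFinite _
      Γk₀Fin := inferInstanceAs (Fintype αΓ)
      m := machineCode O p B cod dcd }
  refine ⟨{ tm := tm
            inputAlphabet := Equiv.refl _
            outputAlphabet := Equiv.refl _
            -- Reading takes one step per input symbol and one more, the program at most `q` steps,
            -- and writing at most `q` steps and one more.
            time := Polynomial.X + 2 + q + q
            outputsFun := fun a => ?_ }⟩
  have key : ∃ k ≤ (Polynomial.X + 2 + q + q : Polynomial ℕ).eval (ea a).length,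
      StepN (TM2.step (machineCode O p B cod dcd)) k
        (cfgAt O B (.inl false) none (ea a) [] fun _ => [])
        ⟨none, (none, initSt O), stks B [] (eb (f a)) (fun _ => []) (noStks O)⟩ := by
    obtain ⟨t, ht, hr⟩ := h a
    have e₁ := stepN_input (O := O) (p := p) (cod := cod) (dcd := dcd) (B := B) (by omega) (ea a)
      (fun _ => []) none
    obtain ⟨c, e₂⟩ := hr.stepN (machineCode O p B cod dcd) hB (inj := .inr) (next := .inl true)
      (fun _ => rfl) [] [] none
    have e₃ := stepN_output (O := O) (p := p) (cod := cod) (dcd := dcd) (B := B) (by omega)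
      (l a).reverse [] (Function.update (fun _ => []) 1 (l a).reverse) (by simp) c
    rw [List.append_nil] at e₁ e₃
    have e₄ := (e₁.trans e₂).trans e₃
    refine ⟨_, ?_, by simpa [hl] using e₄⟩
    have := hlen a
    simp
    omega
  have e1 : initList tm ((ea a).map (Equiv.refl αΓ).invFun) =
      cfgAt O B (.inl false) none (ea a) [] fun _ => [] := by
    rw [initList_eq]
    simp only [cfgAt, tm]
    congr 1
    rw [show (fun _ => [] : ∀ k : Stk O B, List (Alph O B αΓ βΓ k)) =
      stks B [] [] (fun _ => []) (noStks O) from by funext k; cases k <;> rfl]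
    simpa using update_stks_inp _ _ _ _ _
  have e2 : haltList tm ((eb (f a)).map (Equiv.refl βΓ).invFun) =
      ⟨none, (none, initSt O), stks B [] (eb (f a)) (fun _ => []) (noStks O)⟩ := by
    rw [haltList_eq]
    simp only [tm]
    congr 1
    rw [show (fun _ => [] : ∀ k : Stk O B, List (Alph O B αΓ βΓ k)) =
      stks B [] [] (fun _ => []) (noStks O) from by funext k; cases k <;> rfl]
    simpa using update_stks_out _ _ _ _ _
  exact
    { steps := key.choose
      evals_in_steps :=
        (congrArg (fun x => (flip bind tm.step)^[key.choose] (some x)) e1).trans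
          (Eq.trans key.choose_spec.2 (congrArg some e2.symm))
      steps_le_m := key.choose_spec.1 }

end Machine

/-! ### Polynomial bounds -/

/-- The coefficients are natural numbers, so evaluation is monotone. -/
theorem eval_le_eval (q : Polynomial ℕ) {m n : ℕ} (h : m ≤ n) : q.eval m ≤ q.eval n := by
  rw [Polynomial.eval_eq_sum, Polynomial.eval_eq_sum]
  exact Finset.sum_le_sum fun i _ => Nat.mul_le_mul_left _ (Nat.pow_le_pow_left h i)

variable {α α' : Type}

/-- The total length of the values of `vs`. -/
def sz (vs : List (α → List A)) (a : α) : ℕ := (vs.map fun v => (v a).length).sum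

@[simp] theorem sz_nil (a : α) : sz ([] : List (α → List A)) a = 0 := rfl

@[simp] theorem sz_cons (v : α → List A) (vs : List (α → List A)) (a : α) :
    sz (v :: vs) a = (v a).length + sz vs a := by simp [sz]

theorem length_le_sz {v : α → List A} {vs : List (α → List A)} (h : v ∈ vs) (a : α) :
    (v a).length ≤ sz vs a :=
  List.single_le_sum (fun _ _ => Nat.zero_le _) _ (List.mem_map_of_mem h)

/-- On `D`, the function `t` is bounded by a polynomial in the lengths of the values of `vs`. -/
def PB (D : α → Prop) (vs : List (α → List A)) (t : α → ℕ) : Prop :=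
  ∃ q : Polynomial ℕ, ∀ a, D a → t a ≤ q.eval (sz vs a)

namespace PB

variable {D : α → Prop} {vs : List (α → List A)} {t t' : α → ℕ}

theorem const (c : ℕ) : PB D vs fun _ => c := ⟨Polynomial.C c, by simp⟩

theorem mono (h : PB D vs t) (h' : ∀ a, D a → t' a ≤ t a) : PB D vs t' := by
  obtain ⟨q, hq⟩ := h
  exact ⟨q, fun a ha => (h' a ha).trans (hq a ha)⟩

theorem add (h : PB D vs t) (h' : PB D vs t') : PB D vs fun a => t a + t' a := by
  obtain ⟨q, hq⟩ := h
  obtain ⟨q', hq'⟩ := h'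
  exact ⟨q + q', fun a ha => by simpa using Nat.add_le_add (hq a ha) (hq' a ha)⟩

theorem mul (h : PB D vs t) (h' : PB D vs t') : PB D vs fun a => t a * t' a := by
  obtain ⟨q, hq⟩ := h
  obtain ⟨q', hq'⟩ := h'
  exact ⟨q * q', fun a ha => by simpa using Nat.mul_le_mul (hq a ha) (hq' a ha)⟩

theorem size : PB D vs fun a => sz vs a := ⟨Polynomial.X, by simp⟩

theorem view {v : α → List A} (h : v ∈ vs) : PB D vs fun a => (v a).length :=
  size.mono fun a _ => length_le_sz h a

theorem eval (q : Polynomial ℕ) (h : PB D vs t) : PB D vs fun a => q.eval (t a) := by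
  obtain ⟨r, hr⟩ := h
  exact ⟨q.comp r, fun a ha => by
    rw [Polynomial.eval_comp]; exact eval_le_eval q (hr a ha)⟩

/-- Polynomials compose: a bound in the old parameters stays polynomial once the total size of these
is polynomial in the new ones. -/
theorem comap {D' : α' → Prop} {vs' : List (α' → List A)} (h : PB D vs t) (π : α' → α)
    (hD : ∀ z, D' z → D (π z)) (hs : PB D' vs' fun z => sz vs (π z)) :
    PB D' vs' fun z => t (π z) := by
  obtain ⟨q, hq⟩ := h
  exact (hs.eval q).mono fun z hz => hq _ (hD z hz)

theorem sz_comap {D' : α' → Prop} {vs' : List (α' → List A)} (π : α' → α)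
    (h : ∀ v ∈ vs, (fun z => v (π z)) ∈ vs') : PB D' vs' fun z => sz vs (π z) := by
  induction vs with
  | nil => exact const 0
  | cons v vs ih =>
    refine ((view (h v List.mem_cons_self)).add
      (ih fun w hw => h w (List.mem_cons_of_mem _ hw))).mono fun z _ => ?_
    rw [sz_cons]

/-- A parameter whose length is itself bounded by the others can be dropped from the bound. This
accounts for intermediate results kept in registers. -/
theorem letv {f : α → List A} (h : PB D (f :: vs) t) (hf : PB D vs fun a => (f a).length) :
    PB D vs t :=
  h.comap id (fun _ h => h) ((hf.add size).mono fun a _ => by rw [id, sz_cons])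

end PB

end StackProg

end

noncomputable section

/-! ### Closure properties of polynomial-time computability from registers. -/

namespace StackProg

variable {A J : Type} {O : J → Oracle A} {α α' : Type}

theorem Runs.congr {p : Prog A J} {s s' s'' : ℕ → List A} {t : ℕ} (h : Runs O p s s' t)
    (e : s' = s'') : Runs O p s s'' t := e ▸ h

namespace Prog

/-- Moves the contents of register `r` to register `r'`, symbol by symbol. -/
def move (r r' : ℕ) : Prog A J :=
  loop r (seq (case r fun o => o.elim skip (push r')) (pop r))

/-- Moves the contents of register `r` to the registers `r'` and `r''`, symbol by symbol. -/
def moveTwo (r r' r'' : ℕ) : Prog A J :=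
  loop r (seq (case r fun o => o.elim skip fun a => seq (push r' a) (push r'' a)) (pop r))

/-- Empties a register. -/
def clear (r : ℕ) : Prog A J := loop r (pop r)

end Prog

/-- Each symbol costs four steps: loop test, case, push and pop. The order of the symbols is
reversed. -/
theorem runs_move {r r' : ℕ} (h : r' ≠ r) (l : List A) (s : ℕ → List A) (hs : s r = l) :
    Runs O (.move r r') s (Function.update (Function.update s r []) r' (l.reverse ++ s r'))
      (4 * l.length + 1) := by
  induction l generalizing s with
  | nil =>
    refine (Runs.loop_nil hs).congr ?_
    funext x; simp only [Function.update_apply]; split_ifs <;> simp_all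
  | cons a l ih =>
    have e := Runs.push (O := O) s r' a
    have e' := Runs.pop (O := O) (Function.update s r' (a :: s r')) r
    have e₂ := ih (Function.update (Function.update s r' (a :: s r')) r l) (by simp)
    rw [Function.update_of_ne h.symm, hs] at e'
    have e₁ : Runs O (.seq (.case r fun o => o.elim .skip (.push r')) (.pop r)) s _ _ :=
      .seq (.case (by rw [hs]; exact e)) e'
    refine (congrArg _ ?_).mp ((Runs.loop_cons (by simp [hs]) e₁ e₂).congr ?_)
    · simp; omega
    · funext x; simp only [Function.update_apply]; split_ifs <;> simp_all

theorem runs_moveTwo {r r' r'' : ℕ} (h : r' ≠ r) (h' : r'' ≠ r) (h'' : r'' ≠ r') (l : List A)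
    (s : ℕ → List A) (hs : s r = l) :
    Runs O (.moveTwo r r' r'') s (Function.update (Function.update (Function.update s r []) r'
      (l.reverse ++ s r')) r'' (l.reverse ++ s r'')) (5 * l.length + 1) := by
  induction l generalizing s with
  | nil =>
    refine (Runs.loop_nil hs).congr ?_
    funext x; simp only [Function.update_apply]; split_ifs <;> simp_all
  | cons a l ih =>
    have e := Runs.push (O := O) s r' a
    have e' := Runs.push (O := O) (Function.update s r' (a :: s r')) r'' a
    have e'' := Runs.pop (O := O) (Function.update (Function.update s r' (a :: s r')) r''
      (a :: s r'')) r
    have e₂ := ih (Function.update (Function.update (Function.update s r' (a :: s r')) r''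
      (a :: s r'')) r l) (by simp)
    rw [Function.update_of_ne h'.symm, Function.update_of_ne h.symm, hs] at e''
    rw [Function.update_of_ne h''] at e'
    have e₁ : Runs O (.seq (.case r fun o => o.elim .skip fun a =>
        .seq (.push r' a) (.push r'' a)) (.pop r)) s _ _ :=
      .seq (.case (by rw [hs]; exact .seq e e')) e''
    refine (congrArg _ ?_).mp ((Runs.loop_cons (by simp [hs]) e₁ e₂).congr ?_)
    · simp; omega
    · funext x; simp only [Function.update_apply]; split_ifs <;> simp_all

theorem runs_clear {r : ℕ} (l : List A) (s : ℕ → List A) (hs : s r = l) :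
    Runs O (.clear r) s (Function.update s r []) (2 * l.length + 1) := by
  induction l generalizing s with
  | nil => exact (Runs.loop_nil hs).congr (by rw [← hs, Function.update_eq_self])
  | cons a l ih =>
    have e := Runs.pop (O := O) s r
    rw [hs] at e
    have e₂ := ih (Function.update s r l) (by simp)
    refine (congrArg _ ?_).mp ((Runs.loop_cons (by simp [hs]) e e₂).congr ?_)
    · simp; omega
    · simp

/-- `PC O D vs f`: for `a` in the domain `D`, with the values `v a`, `v ∈ vs`, given in registers, a
program writes `f a` in polynomial time to the end of an output register (whose top is its end).
It may use all registers from `base` on as work registers. -/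
def PC (O : J → Oracle A) (D : α → Prop) (vs : List (α → List A)) (f : α → List A) : Prop :=
  PB D vs (fun a => (f a).length) ∧
  ∀ (R : List (ℕ × (α → List A))) (out base : ℕ), (∀ v ∈ vs, ∃ r, (r, v) ∈ R) →
    (∀ x ∈ R, x.1 < base ∧ x.1 ≠ out) → out < base →
    ∃ (p : Prog A J) (t : α → ℕ), PB D vs t ∧ ∀ a s, D a → (∀ x ∈ R, s x.1 = x.2 a) →
      (∀ r, base ≤ r → s r = []) →
      ∃ t' ≤ t a, Runs O p s (Function.update s out ((f a).reverse ++ s out)) t'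

namespace PC

variable {D : α → Prop} {vs : List (α → List A)} {f g : α → List A}

theorem length (h : PC O D vs f) : PB D vs fun a => (f a).length := h.1

theorem congr (h : PC O D vs f) (e : ∀ a, D a → f a = g a) : PC O D vs g := by
  refine ⟨h.1.mono fun a ha => by rw [e a ha], fun R out base h₁ h₂ h₃ => ?_⟩
  obtain ⟨p, t, ht, hp⟩ := h.2 R out base h₁ h₂ h₃
  exact ⟨p, t, ht, fun a s ha => by rw [← e a ha]; exact hp a s ha⟩

/-- The program is instantiated with just those registers that hold the required values. A
computation established in isolation thus remains available inside loops, where parameters depend on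
larger tuples. -/
theorem comap {D' : α' → Prop} {vs' : List (α' → List A)} (h : PC O D vs f) (π : α' → α)
    (hv : ∀ v ∈ vs, (fun z => v (π z)) ∈ vs') (hD : ∀ z, D' z → D (π z)) :
    PC O D' vs' fun z => f (π z) := by
  refine ⟨h.1.comap π hD (PB.sz_comap π hv), fun R out base h₁ h₂ h₃ => ?_⟩
  have : ∀ v, ∃ r, v ∈ vs → (r, fun z => v (π z)) ∈ R := fun v => by
    by_cases hv' : v ∈ vs
    · obtain ⟨r, hr⟩ := h₁ _ (hv v hv')
      exact ⟨r, fun _ => hr⟩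
    · exact ⟨0, fun h => absurd h hv'⟩
  choose r hr using this
  obtain ⟨p, t, ht, hp⟩ := h.2 (vs.map fun v => (r v, v)) out base
    (fun v hv => ⟨r v, List.mem_map_of_mem hv⟩)
    (by
      intro x hx
      obtain ⟨v, hv, rfl⟩ := List.mem_map.1 hx
      exact h₂ _ (hr v hv)) h₃
  refine ⟨p, fun z => t (π z), ht.comap π hD (PB.sz_comap π hv), fun z s hz hs hb =>
    hp (π z) s (hD z hz) ?_ hb⟩
  intro x hx
  obtain ⟨v, hv, rfl⟩ := List.mem_map.1 hx
  exact hs _ (hr v hv)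

theorem weaken {vs' : List (α → List A)} (h : PC O D vs f) (hv : ∀ v ∈ vs, v ∈ vs') :
    PC O D vs' f := h.comap id hv fun _ h => h

theorem restrict {D' : α → Prop} (h : PC O D vs f) (hD : ∀ a, D' a → D a) : PC O D' vs f :=
  h.comap id (fun _ h => h) hD

theorem nil : PC O D vs fun _ => [] :=
  ⟨PB.const 0, fun _ _ _ _ _ _ => ⟨.skip, fun _ => 1, PB.const 1, fun _ s _ _ _ =>
    ⟨1, le_rfl, (Runs.skip s).congr (by simp)⟩⟩⟩

theorem symbol (c : A) : PC O D vs fun _ => [c] :=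
  ⟨PB.const 1, fun _ out _ _ _ _ => ⟨.push out c, fun _ => 1, PB.const 1, fun _ s _ _ _ =>
    ⟨1, le_rfl, Runs.push s out c⟩⟩⟩

theorem append (hf : PC O D vs f) (hg : PC O D vs g) : PC O D vs fun a => f a ++ g a := by
  refine ⟨(hf.1.add hg.1).mono fun a _ => by simp, fun R out base h₁ h₂ h₃ => ?_⟩
  obtain ⟨p, t, ht, hp⟩ := hf.2 R out base h₁ h₂ h₃
  obtain ⟨p', t', ht', hp'⟩ := hg.2 R out base h₁ h₂ h₃
  refine ⟨.seq p p', _, ht.add ht', fun a s ha hs hb => ?_⟩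
  obtain ⟨k, hk, e⟩ := hp a s ha hs hb
  obtain ⟨k', hk', e'⟩ := hp' a (Function.update s out ((f a).reverse ++ s out)) ha
    (fun x hx => by rw [Function.update_of_ne (h₂ x hx).2]; exact hs x hx)
    (fun r hr => by rw [Function.update_of_ne (by omega)]; exact hb r hr)
  exact ⟨k + k', Nat.add_le_add hk hk', (Runs.seq e e').congr (by simp)⟩

/-- Reading must not destroy the register. Its contents go, reversed, to `out` and to the scratch
register `base`, and a second move from `base` restores them; the cost is `5 * n + 1` plus `4 * n +
1` for length `n`. -/
theorem var {v : α → List A} (hv : v ∈ vs) : PC O D vs v := by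
  refine ⟨PB.view hv, fun R out base h₁ h₂ h₃ => ?_⟩
  obtain ⟨r, hr⟩ := h₁ v hv
  have hr' := h₂ _ hr
  refine ⟨.seq (.moveTwo r base out) (.move base r), fun a => 9 * (v a).length + 2,
    ((PB.const 9).mul (PB.view hv)).add (PB.const 2), fun a s ha hs hb => ?_⟩
  have hsr := hs _ hr
  simp only at hsr hr'
  have e := runs_moveTwo (O := O) (r := r) (r' := base) (r'' := out) (by omega) (by omega)
    (by omega) (v a) s hsr
  have e' := runs_move (O := O) (r := base) (r' := r) (by omega) _ _ rfl |> (Runs.seq e ·)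
  refine ⟨_, ?_, e'.congr ?_⟩
  · simp [h₃.ne', hb base le_rfl]; omega
  · have := hb base le_rfl
    have := h₃.ne'
    have := h₃.ne
    have := hr'.1.ne
    have := hr'.1.ne'
    have := hr'.2
    funext x
    simp only [Function.update_apply]
    split_ifs <;> simp_all

/-- The value `f a` appears reversed in `base`. Moving it to `base + 1` restores the reading order
and empties `base`; after use, `base + 1` is cleared, so the work registers are empty again. -/
theorem letv (hf : PC O D vs f) (hg : PC O D (f :: vs) g) : PC O D vs g := by
  refine ⟨hg.1.letv hf.1, fun R out base h₁ h₂ h₃ => ?_⟩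
  obtain ⟨p, t, ht, hp⟩ := hf.2 R base (base + 1) h₁
    (fun x hx => ⟨(h₂ x hx).1.trans (Nat.lt_succ_self _), (h₂ x hx).1.ne⟩) (Nat.lt_succ_self _)
  obtain ⟨p', t', ht', hp'⟩ := hg.2 ((base + 1, f) :: R) out (base + 2)
    (by
      intro v hv
      rcases List.mem_cons.1 hv with rfl | hv
      · exact ⟨base + 1, List.mem_cons_self⟩
      · obtain ⟨r, hr⟩ := h₁ v hv
        exact ⟨r, List.mem_cons_of_mem _ hr⟩)
    (by
      intro x hx
      rcases List.mem_cons.1 hx with rfl | hx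
      · simp; omega
      · have := h₂ x hx; omega)
    (by omega)
  refine ⟨.seq p (.seq (.move base (base + 1)) (.seq p' (.clear (base + 1)))),
    fun a => t a + ((4 * (f a).length + 1) + (t' a + (2 * (f a).length + 1))), ?_, ?_⟩
  · have hl := hf.1
    exact ht.add ((((PB.const 4).mul hl).add (PB.const 1)).add
      ((ht'.letv hl).add (((PB.const 2).mul hl).add (PB.const 1))))
  intro a s ha hs hb
  obtain ⟨k, hk, e⟩ := hp a s ha hs fun r hr => hb r (by omega)
  have e₁ := runs_move (O := O) (r := base) (r' := base + 1) (by omega) (f a).reverse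
    (Function.update s base (f a).reverse) (by simp)
  obtain ⟨k', hk', e₂⟩ := hp' a (Function.update s (base + 1) (f a)) ha
    (by
      intro x hx
      rcases List.mem_cons.1 hx with rfl | hx
      · simp
      · rw [Function.update_of_ne (by have := h₂ x hx; omega)]; exact hs x hx)
    (fun r hr => by rw [Function.update_of_ne (by omega)]; exact hb r (by omega))
  have e₃ := runs_clear (O := O) (r := base + 1) (f a)
    (Function.update s out ((g a).reverse ++ s out) |> (Function.update · (base + 1) (f a)))
    (by simp)
  have hb0 := hb base le_rfl
  have hb1 := hb (base + 1) (by omega)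
  refine ⟨_, ?_, (Runs.seq (e.congr ?_) (Runs.seq (e₁.congr ?_) (Runs.seq (e₂.congr ?_) e₃))).congr
    ?_⟩
  · simp; omega
  · simp [hb0]
  · funext x
    simp only [Function.update_apply]
    split_ifs <;> simp_all
  · rw [Function.update_comm (by omega), Function.update_of_ne (by omega)]
  · funext x
    simp only [Function.update_apply]
    split_ifs <;> simp_all

/-- There are finitely many possible heads, so the sum of the polynomials of all branches bounds
each of them. -/
theorem caseHead [Finite A] {v : α → List A} (hv : v ∈ vs) {g : Option A → α → List A}
    (hg : ∀ o, PC O (fun a => D a ∧ (v a).head? = o) vs (g o)) :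
    PC O D vs fun a => g (v a).head? a := by
  have := Fintype.ofFinite A
  have key : ∀ t : Option A → α → ℕ, (∀ o, PB (fun a => D a ∧ (v a).head? = o) vs (t o)) →
      PB D vs fun a => t (v a).head? a := by
    intro t ht
    choose q hq using ht
    refine ⟨∑ o, q o, fun a ha => (hq _ a ⟨ha, rfl⟩).trans ?_⟩
    rw [Polynomial.eval_finsetSum]
    exact Finset.single_le_sum (f := fun o => (q o).eval (sz vs a)) (fun _ _ => Nat.zero_le _)
      (Finset.mem_univ _)
  refine ⟨key (fun o a => (g o a).length) fun o => (hg o).1, fun R out base h₁ h₂ h₃ => ?_⟩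
  choose p t ht hp using fun o => (hg o).2 R out base h₁ h₂ h₃
  obtain ⟨r, hr⟩ := h₁ v hv
  refine ⟨.case r p, _, (key t ht).add (PB.const 1), fun a s ha hs hb => ?_⟩
  obtain ⟨k, hk, e⟩ := hp (v a).head? a s ⟨ha, rfl⟩ hs hb
  exact ⟨k + 1, by omega, Runs.case (by rw [hs _ hr]; exact e)⟩

end PC

end StackProg

end

noncomputable section

/-! ### Loops along a list and bounded iteration. -/

namespace StackProg

variable {A J : Type} {O : J → Oracle A} {α α' : Type}

namespace PC

variable {D : α → Prop} {vs : List (α → List A)} {f : α → List A}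

/-- Symbols wander from the remaining suffix in `base + 1` to the reversed prefix in `base`, and the
body may read both, so it knows its position. Prefix and suffix together are as long as `l`, which
gives one time bound for all rounds. -/
theorem foreach {l : α → List A} {g : α → ℕ → List A} (hl : PC O D vs l)
    (hg : PC O (fun z : α × ℕ => D z.1 ∧ z.2 < (l z.1).length)
      ((fun z => ((l z.1).take z.2).reverse) :: (fun z => (l z.1).drop z.2) ::
        vs.map fun v z => v z.1) fun z => g z.1 z.2) :
    PC O D vs fun a => (List.range (l a).length).flatMap (g a) := by
  have hsz : ∀ z : α × ℕ, sz ((fun z => ((l z.1).take z.2).reverse) ::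
      (fun z => (l z.1).drop z.2) :: vs.map fun v z => v z.1) z ≤ (l z.1).length + sz vs z.1 := by
    intro z
    simp only [sz_cons, List.length_reverse, List.length_take, List.length_drop]
    have : sz (vs.map fun v (z : α × ℕ) => v z.1) z = sz vs z.1 := by
      simp [sz, Function.comp_def]
    omega
  have key : ∀ {t : α × ℕ → ℕ}, PB (fun z : α × ℕ => D z.1 ∧ z.2 < (l z.1).length)
      ((fun z => ((l z.1).take z.2).reverse) :: (fun z => (l z.1).drop z.2) ::
        vs.map fun v z => v z.1) t →
      ∃ T : α → ℕ, PB D vs T ∧ ∀ a, D a → ∀ i < (l a).length, t (a, i) ≤ T a := by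
    rintro t ⟨q, hq⟩
    exact ⟨fun a => q.eval ((l a).length + sz vs a), (hl.1.add PB.size).eval q,
      fun a ha i hi => (hq _ ⟨ha, hi⟩).trans (eval_le_eval q (hsz _))⟩
  refine ⟨?_, fun R out base h₁ h₂ h₃ => ?_⟩
  · obtain ⟨T, hT, h⟩ := key hg.1
    refine (hl.1.mul hT).mono fun a ha => ?_
    rw [List.length_flatMap]
    refine (List.sum_le_card_nsmul _ (T a) ?_).trans (by simp)
    intro x hx
    obtain ⟨i, hi, rfl⟩ := List.mem_map.1 hx
    exact h a ha i (List.mem_range.1 hi)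
  obtain ⟨p, t, ht, hp⟩ := hl.2 R base (base + 1) h₁
    (fun x hx => ⟨(h₂ x hx).1.trans (Nat.lt_succ_self _), (h₂ x hx).1.ne⟩) (Nat.lt_succ_self _)
  obtain ⟨p', t', ht', hp'⟩ := hg.2 ((base, fun z => ((l z.1).take z.2).reverse) ::
      (base + 1, fun z => (l z.1).drop z.2) :: R.map fun x => (x.1, fun z => x.2 z.1))
      out (base + 2)
    (by
      intro v hv
      rcases List.mem_cons.1 hv with rfl | hv
      · exact ⟨base, List.mem_cons_self⟩
      rcases List.mem_cons.1 hv with rfl | hv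
      · exact ⟨base + 1, List.mem_cons_of_mem _ List.mem_cons_self⟩
      obtain ⟨w, hw, rfl⟩ := List.mem_map.1 hv
      obtain ⟨r, hr⟩ := h₁ w hw
      exact ⟨r, List.mem_cons_of_mem _ (List.mem_cons_of_mem _ (List.mem_map.2 ⟨_, hr, rfl⟩))⟩)
    (by
      intro x hx
      rcases List.mem_cons.1 hx with rfl | hx
      · simp; omega
      rcases List.mem_cons.1 hx with rfl | hx
      · simp; omega
      obtain ⟨y, hy, rfl⟩ := List.mem_map.1 hx
      have := h₂ y hy
      simp only
      omega)
    (by omega)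
  obtain ⟨T, hT, hTt⟩ := key ht'
  refine ⟨.seq p (.seq (.move base (base + 1)) (.seq (.loop (base + 1) (.seq p'
      (.seq (.case (base + 1) fun o => o.elim .skip (.push base)) (.pop (base + 1)))))
      (.clear base))),
    fun a => t a + ((4 * (l a).length + 1) + (((l a).length * (T a + 4) + 1) +
      (2 * (l a).length + 1))), ?_, ?_⟩
  · have hl := hl.1
    exact ht.add ((((PB.const 4).mul hl).add (PB.const 1)).add
      (((hl.mul (hT.add (PB.const 4))).add (PB.const 1)).add
        (((PB.const 2).mul hl).add (PB.const 1))))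
  intro a s ha hs hb
  have hb0 := hb base le_rfl
  have hb1 := hb (base + 1) (by omega)
  obtain ⟨k, hk, e⟩ := hp a s ha hs fun r hr => hb r (by omega)
  have e₁ := runs_move (O := O) (r := base) (r' := base + 1) (by omega) (l a).reverse
    (Function.update s base (l a).reverse) (by simp)
  -- The loop invariant after `i` rounds: `out` holds what these rounds have written, `base` the
  -- reversed prefix and `base + 1` the suffix.
  let S : ℕ → ℕ → List A := fun i => Function.update (Function.update (Function.update s out
    (((List.range i).flatMap (g a)).reverse ++ s out)) base ((l a).take i).reverse)
    (base + 1) ((l a).drop i)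
  -- Apart from the body, a round takes four steps: loop test, case, push and pop.
  have loop : ∀ d i, i + d = (l a).length → ∃ k ≤ d * (T a + 4) + 1,
      Runs O (.loop (base + 1) (.seq p' (.seq (.case (base + 1) fun o => o.elim .skip (.push base))
        (.pop (base + 1))))) (S i) (S (l a).length) k := by
    intro d
    induction d with
    | zero =>
      intro i hi
      obtain rfl : i = (l a).length := by omega
      exact ⟨1, by omega, Runs.loop_nil (by simp [S])⟩
    | succ d ih =>
      intro i hi
      obtain ⟨k, hk, e⟩ := ih (i + 1) (by omega)
      have hi' : i < (l a).length := by omega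
      obtain ⟨k', hk', e'⟩ := hp' (a, i) (S i) ⟨ha, hi'⟩
        (by
          intro x hx
          rcases List.mem_cons.1 hx with rfl | hx
          · simp [S]
          rcases List.mem_cons.1 hx with rfl | hx
          · simp [S]
          obtain ⟨y, hy, rfl⟩ := List.mem_map.1 hx
          have h := h₂ y hy
          simp only [S]
          rw [Function.update_of_ne (by omega), Function.update_of_ne (by omega),
            Function.update_of_ne (by omega)]
          exact hs y hy)
        (fun r hr => by
          simp only [S]
          rw [Function.update_of_ne (by omega), Function.update_of_ne (by omega),
            Function.update_of_ne (by omega)]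
          exact hb r (by omega))
      have hT' := hTt a ha i hi'
      have hd : (l a).drop i = (l a)[i] :: (l a).drop (i + 1) := List.drop_eq_getElem_cons hi'
      have e₂ := Runs.push (O := O) (Function.update (S i) out ((g a i).reverse ++ S i out))
        base (l a)[i]
      have hh : ((Function.update (S i) out ((g a i).reverse ++ S i out)) (base + 1)).head? =
          some (l a)[i] := by
        rw [Function.update_of_ne (by omega)]
        simp only [S, Function.update_self, hd, List.head?_cons]
      have e₃ : Runs O (.case (base + 1) fun o => o.elim .skip (.push base)) _ _ (1 + 1) :=
        Runs.case (s := Function.update (S i) out ((g a i).reverse ++ S i out))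
          (by rw [hh]; exact e₂)
      have e₄ := Runs.seq e' (Runs.seq e₃ (Runs.pop _ (base + 1)))
      refine ⟨_, ?_, Runs.loop_cons ?_ (e₄.congr ?_) e⟩
      · have : (d + 1) * (T a + 4) = d * (T a + 4) + (T a + 4) := by ring
        omega
      · simp only [S, Function.update_self, hd]
        exact List.cons_ne_nil _ _
      · have ht' : ((l a).take (i + 1)).reverse = (l a)[i] :: ((l a).take i).reverse := by
          rw [List.take_succ_eq_append_getElem hi']; simp
        have hr' : ((List.range (i + 1)).flatMap (g a)).reverse =
            (g a i).reverse ++ ((List.range i).flatMap (g a)).reverse := by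
          rw [List.range_succ]; simp
        have n1 : out ≠ base := by omega
        have n2 : out ≠ base + 1 := by omega
        have n3 : base ≠ out := n1.symm
        have n4 : base + 1 ≠ out := n2.symm
        funext x
        by_cases hx : x = base + 1
        · rw [hx]; simp [S, n4]
        by_cases hx' : x = base
        · rw [hx']; simp only [S, ht']; simp [n3]
        by_cases hx'' : x = out
        · rw [hx'']; simp only [S, hr']; simp [n1, n2]
        · simp [S, hx, hx', hx'']
  obtain ⟨k₂, hk₂, e₂⟩ := loop (l a).length 0 (by omega)
  have e₃ := runs_clear (O := O) (r := base) (l a).reverse (S (l a).length) (by simp [S])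
  refine ⟨_, ?_, (Runs.seq (e.congr ?_) (Runs.seq (e₁.congr ?_) (Runs.seq e₂ e₃))).congr ?_⟩
  · simp only [List.length_reverse]; omega
  · simp [hb0]
  · funext x
    by_cases hx : x = base + 1
    · rw [hx]; simp [S, hb1]
    by_cases hx' : x = base
    · rw [hx']; simp [S]
    · simp [S, hx, hx']
  · funext x
    by_cases hx : x = base + 1
    · rw [hx]; simp [S, hb1, show base + 1 ≠ out by omega]
    by_cases hx' : x = base
    · rw [hx']; simp [S, hb0, h₃.ne']
    · simp [S, hx, hx', Function.update_apply]

/-- Iterating a polynomial-time step can produce exponentially long values, so a polynomial bound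
`b` on all intermediate values is required. The step need only be computable on the values that
occur, which the domain in `hs` expresses. -/
theorem iterate {c init : α → List A} {step : α → List A → List A} (hc : PC O D vs c)
    (hi : PC O D vs init)
    (hs : PC O (fun z : α × List A => D z.1 ∧ ∃ k < (c z.1).length, z.2 = (step z.1)^[k] (init z.1))
      ((fun z => z.2) :: vs.map fun v z => v z.1) fun z => step z.1 z.2)
    {b : α → ℕ} (hb : PB D vs b)
    (hbd : ∀ a, D a → ∀ k ≤ (c a).length, ((step a)^[k] (init a)).length ≤ b a) :
    PC O D vs fun a => (step a)^[(c a).length] (init a) := by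
  refine ⟨hb.mono fun a ha => hbd a ha _ le_rfl, fun R out base h₁ h₂ h₃ => ?_⟩
  obtain ⟨p, t, ht, hp⟩ := hc.2 R (base + 2) (base + 3) h₁
    (fun x hx => by have := h₂ x hx; omega) (by omega)
  obtain ⟨p₁, t₁, ht₁, hp₁⟩ := hi.2 R base (base + 3) h₁
    (fun x hx => by have := h₂ x hx; omega) (by omega)
  obtain ⟨p', t', ⟨q, hq⟩, hp'⟩ := hs.2 ((base + 1, fun z => z.2) ::
      R.map fun x => (x.1, fun z => x.2 z.1)) base (base + 3)
    (by
      intro v hv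
      rcases List.mem_cons.1 hv with rfl | hv
      · exact ⟨base + 1, List.mem_cons_self⟩
      obtain ⟨w, hw, rfl⟩ := List.mem_map.1 hv
      obtain ⟨r, hr⟩ := h₁ w hw
      exact ⟨r, List.mem_cons_of_mem _ (List.mem_map.2 ⟨_, hr, rfl⟩)⟩)
    (by
      intro x hx
      rcases List.mem_cons.1 hx with rfl | hx
      · simp
      obtain ⟨y, hy, rfl⟩ := List.mem_map.1 hx
      have := h₂ y hy
      simp only
      omega)
    (by omega)
  let T : α → ℕ := fun a => q.eval (b a + sz vs a)
  have hT : PB D vs T := (hb.add PB.size).eval q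
  have hTt : ∀ a, D a → ∀ k < (c a).length, t' (a, (step a)^[k] (init a)) ≤ T a := by
    intro a ha k hk
    refine (hq _ ⟨ha, k, hk, rfl⟩).trans (eval_le_eval q ?_)
    have : sz (vs.map fun v (z : α × List A) => v z.1) (a, (step a)^[k] (init a)) = sz vs a := by
      simp [sz, Function.comp_def]
    rw [sz_cons, this]
    exact Nat.add_le_add_right (hbd a ha k hk.le) _
  refine ⟨.seq p (.seq p₁ (.seq (.move base (base + 1)) (.seq
      (.loop (base + 2) (.seq p' (.seq (.clear (base + 1)) (.seq (.move base (base + 1))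
        (.pop (base + 2)))))) (.move (base + 1) out)))),
    fun a => t a + (t₁ a + ((4 * b a + 1) + (((c a).length * (T a + 6 * b a + 4) + 1) +
      (4 * b a + 1)))), ?_, ?_⟩
  · have hb4 := ((PB.const 4).mul hb).add (PB.const 1)
    exact ht.add (ht₁.add (hb4.add (((hc.1.mul ((hT.add ((PB.const 6).mul hb)).add
      (PB.const 4))).add (PB.const 1)).add hb4)))
  intro a s ha hs' hb'
  have hb0 := hb' base le_rfl
  have hb1 := hb' (base + 1) (by omega)
  have hb2 := hb' (base + 2) (by omega)
  obtain ⟨k, hk, e⟩ := hp a s ha hs' fun r hr => hb' r (by omega)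
  obtain ⟨k₁, hk₁, e₁⟩ := hp₁ a (Function.update s (base + 2) (c a).reverse) ha
    (fun x hx => by rw [Function.update_of_ne (by have := h₂ x hx; omega)]; exact hs' x hx)
    (fun r hr => by rw [Function.update_of_ne (by omega)]; exact hb' r (by omega))
  have e₂ := runs_move (O := O) (r := base) (r' := base + 1) (by omega) (init a).reverse
    (Function.update (Function.update s (base + 2) (c a).reverse) base (init a).reverse) (by simp)
  -- The loop invariant: `base + 1` holds the current value and `base + 2` the rest of the counter.
  -- The counter is reversed, but only its length matters.
  let S : ℕ → ℕ → List A := fun i => Function.update (Function.update s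
    (base + 1) ((step a)^[i] (init a))) (base + 2) ((c a).reverse.drop i)
  -- A round costs at most `T` for the step, `2 * b + 1` for clearing the old value, `4 * b + 1` for
  -- moving the new one, and two steps for the loop test and the pop.
  have loop : ∀ d i, i + d = (c a).length → ∃ k ≤ d * (T a + 6 * b a + 4) + 1,
      Runs O (.loop (base + 2) (.seq p' (.seq (.clear (base + 1)) (.seq (.move base (base + 1))
        (.pop (base + 2)))))) (S i) (S (c a).length) k := by
    intro d
    induction d with
    | zero =>
      intro i hi
      obtain rfl : i = (c a).length := by omega
      exact ⟨1, by omega, Runs.loop_nil (by simp [S])⟩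
    | succ d ih =>
      intro i hi
      obtain ⟨k, hk, e⟩ := ih (i + 1) (by omega)
      have hi' : i < (c a).length := by omega
      obtain ⟨k', hk', e'⟩ := hp' (a, (step a)^[i] (init a)) (S i) ⟨ha, i, hi', rfl⟩
        (by
          intro x hx
          rcases List.mem_cons.1 hx with rfl | hx
          · simp [S]
          obtain ⟨y, hy, rfl⟩ := List.mem_map.1 hx
          have h := h₂ y hy
          simp only [S]
          rw [Function.update_of_ne (by omega), Function.update_of_ne (by omega)]
          exact hs' y hy)
        (fun r hr => by
          simp only [S]
          rw [Function.update_of_ne (by omega), Function.update_of_ne (by omega)]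
          exact hb' r (by omega))
      have hT' := hTt a ha i hi'
      have hB' := hbd a ha i hi'.le
      have hB'' := hbd a ha (i + 1) hi'
      have hstep : (step a)^[i + 1] (init a) = step a ((step a)^[i] (init a)) :=
        Function.iterate_succ_apply' _ _ _
      have e₃ := runs_clear (O := O) (r := base + 1) ((step a)^[i] (init a))
        (Function.update (S i) base (step a ((step a)^[i] (init a))).reverse)
        (by rw [Function.update_of_ne (by omega)]; simp [S])
      have e₄ := runs_move (O := O) (r := base) (r' := base + 1) (by omega)
        (step a ((step a)^[i] (init a))).reverse
        (Function.update (Function.update (S i) base (step a ((step a)^[i] (init a))).reverse)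
          (base + 1) []) (by rw [Function.update_of_ne (by omega)]; simp)
      refine ⟨_, ?_, Runs.loop_cons ?_ ((Runs.seq (e'.congr ?_) (Runs.seq e₃ (Runs.seq e₄
        (Runs.pop _ (base + 2))))).congr ?_) e⟩
      · have : (d + 1) * (T a + 6 * b a + 4) =
          d * (T a + 6 * b a + 4) + (T a + 6 * b a + 4) := by ring
        rw [hstep] at hB''
        simp only [List.length_reverse] at hk' ⊢
        omega
      · simp only [S, Function.update_self]
        intro h
        have := congrArg List.length h
        simp at this
        omega
      · have : S i base = [] := by
          simp only [S]
          rw [Function.update_of_ne (by omega), Function.update_of_ne (by omega)]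
          exact hb0
        rw [this, List.append_nil]
      · funext x
        by_cases hx : x = base + 1
        · rw [hx]; simp only [S, hstep]; simp
        by_cases hx' : x = base
        · rw [hx']; simp [S, hb0]
        by_cases hx'' : x = base + 2
        · rw [hx'']; simp [S]
        · simp [S, hx, hx', hx'']
  obtain ⟨k₂, hk₂, e₃⟩ := loop (c a).length 0 (by omega)
  have e₄ := runs_move (O := O) (r := base + 1) (r' := out) (by omega)
    ((step a)^[(c a).length] (init a)) (S (c a).length) (by simp [S])
  refine ⟨_, ?_, (Runs.seq (e.congr ?_) (Runs.seq (e₁.congr ?_) (Runs.seq (e₂.congr ?_)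
    (Runs.seq e₃ e₄)))).congr ?_⟩
  · have h0 := hbd a ha 0 (Nat.zero_le _)
    have h1 := hbd a ha _ le_rfl
    simp only [Function.iterate_zero, id] at h0
    simp only [List.length_reverse]
    omega
  · simp [hb2]
  · rw [Function.update_of_ne (by omega), hb0, List.append_nil]
  · funext x
    by_cases hx : x = base + 1
    · rw [hx]; simp [S, hb1]
    by_cases hx' : x = base
    · rw [hx']; simp [S, hb0]
    by_cases hx'' : x = base + 2
    · rw [hx'']; simp [S]
    · simp [S, hx, hx', hx'']
  · have n1 : out ≠ base + 1 := by omega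
    have n2 : out ≠ base + 2 := by omega
    funext x
    by_cases hx : x = base + 1
    · rw [hx]; simp [S, hb1, n1.symm]
    by_cases hx'' : x = base + 2
    · rw [hx'']; simp [S, hb2, n2.symm]
    · simp [S, hx, hx'', Function.update_apply, n1, n2]

end PC

end StackProg

end

noncomputable section

/-! ### Output length of machines and subroutine calls. -/

namespace StackProg

variable {A J : Type} {O : J → Oracle A} {α α' : Type}

section Growth

variable {K : Type} [DecidableEq K] {Γ : K → Type} {Λ σ : Type}

/-- An upper bound for the number of symbols pushed by a statement. -/
def pushes : TM2.Stmt Γ Λ σ → ℕ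
  | .push _ _ q => pushes q + 1
  | .peek _ _ q => pushes q
  | .pop _ _ q => pushes q
  | .load _ q => pushes q
  | .branch _ q q' => pushes q + pushes q'
  | .goto _ => 0
  | .halt => 0

theorem length_stepAux_le (q : TM2.Stmt Γ Λ σ) (v : σ) (S : ∀ k, List (Γ k)) (k : K) :
    ((TM2.stepAux q v S).stk k).length ≤ (S k).length + pushes q := by
  induction q generalizing v S with
  | push k' f q ih =>
    refine (ih v _).trans ?_
    by_cases h : k = k'
    · subst h; simp [pushes]; omega
    · simp [pushes, h]
  | peek k' f q ih => exact ih _ _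
  | pop k' f q ih =>
    refine (ih _ _).trans ?_
    by_cases h : k = k'
    · subst h; simp [pushes]
    · simp [pushes, h]
  | load f q ih => exact ih _ _
  | branch f q q' ih ih' =>
    simp only [TM2.stepAux, pushes]
    cases f v
    · have := ih' v S; simp only [cond_false]; omega
    · have := ih v S; simp only [cond_true]; omega
  | goto f => simp [pushes]
  | halt => simp [pushes]

/-- A statement pushes a number of symbols that is bounded by its code alone, so stacks grow at most
linearly with time. -/
theorem StepN.length_le (M : Λ → TM2.Stmt Γ Λ σ) (c : ℕ) (hc : ∀ l, pushes (M l) ≤ c) (t : ℕ)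
    (x y : TM2.Cfg Γ Λ σ) (h : StepN (TM2.step M) t x y) (k : K) :
    (y.stk k).length ≤ (x.stk k).length + t * c := by
  induction t generalizing x with
  | zero => cases h; simp
  | succ t ih =>
    obtain ⟨z, hz, h⟩ := h.exists_head
    refine (ih z h).trans ?_
    obtain ⟨l, v, S⟩ := x
    cases l with
    | none => cases hz
    | some l =>
      simp only [TM2.step, Option.some.injEq] at hz
      subst hz
      have := length_stepAux_le (M l) v S k
      have := hc l
      rw [Nat.succ_mul]
      simp only
      omega

end Growth

namespace PC

variable {D : α → Prop} {vs : List (α → List A)} {f : α → List A}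

/-- `PC` also demands a bound on the length of the result. It follows from the running time, since a
machine with finitely many labels pushes boundedly many symbols per step. -/
theorem call (hf : PC O D vs f) (j : J) {r : α → List ((O j).tm.Γ (O j).tm.k₁)}
    (q : Polynomial ℕ) (h : ∀ a, D a → ∃ k ≤ q.eval (f a).length, StepN (O j).tm.step k
      (initList (O j).tm ((f a).map (O j).dec)) (haltList (O j).tm (r a))) :
    PC O D vs fun a => (r a).map (O j).enc := by
  have := (O j).tm.ΛFin
  have hlen : PB D vs fun a => (r a).length := by
    let c := ∑ l, pushes ((O j).tm.m l)
    refine (hf.1.add ((hf.1.eval q).mul (PB.const c))).mono fun a ha => ?_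
    obtain ⟨k, hk, e⟩ := h a ha
    have := StepN.length_le (O j).tm.m c
      (fun l => Finset.single_le_sum (f := fun l => pushes ((O j).tm.m l))
        (fun _ _ => Nat.zero_le _) (Finset.mem_univ l)) k _ _ e (O j).tm.k₁
    rw [initList_eq, haltList_eq] at this
    simp only [Function.update_self] at this
    refine this.trans (Nat.add_le_add ?_ (Nat.mul_le_mul_right _ hk))
    -- The output stack of a subroutine may also be its input stack, in which case it does not start
    -- empty.
    by_cases hk : (O j).tm.k₁ = (O j).tm.k₀
    · have : ∀ (k : (O j).tm.K) (hk : k = (O j).tm.k₀) (L : List ((O j).tm.Γ (O j).tm.k₀)),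
          (Function.update (fun _ => []) (O j).tm.k₀ L k).length = L.length := by
        rintro k rfl L; simp
      rw [this _ hk, List.length_map]
    · rw [Function.update_of_ne hk]; exact Nat.zero_le _
  refine ⟨by simpa using hlen, fun R out base h₁ h₂ h₃ => ?_⟩
  obtain ⟨p, t, ht, hp⟩ := hf.2 R base (base + 1) h₁
    (fun x hx => ⟨(h₂ x hx).1.trans (Nat.lt_succ_self _), (h₂ x hx).1.ne⟩) (Nat.lt_succ_self _)
  refine ⟨.seq p (.call j base out),
    fun a => t a + ((f a).length + 1 + q.eval (f a).length + ((r a).length + 1)),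
    ht.add (((hf.1.add (PB.const 1)).add (hf.1.eval q)).add (hlen.add (PB.const 1))),
    fun a s ha hs hb => ?_⟩
  obtain ⟨k, hk, e⟩ := hp a s ha hs fun r hr => hb r (by omega)
  obtain ⟨k', hk', e'⟩ := h a ha
  have hb0 := hb base le_rfl
  have e₂ : Runs O (.call j base out) (Function.update s base (f a).reverse) _ _ :=
    Runs.call (l := r a) (k := k') (by simpa using e')
  refine ⟨_, ?_, (Runs.seq (e.congr ?_) e₂).congr ?_⟩
  · simp only [Function.update_self, List.length_reverse]; omega
  · rw [hb0, List.append_nil]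
  · funext x
    by_cases hx : x = base
    · rw [hx]; simp [h₃.ne', hb0]
    · simp [Function.update_apply, hx, h₃.ne]

/-- The machine loads its input reversed into register `0`; the move to register `2` restores the
order. Register `2` is cleared at the end because `Prog.computable` expects all registers except `1`
to be empty. -/
theorem computable [DecidableEq J] [Inhabited A] [Finite A] [Finite J] {β αΓ βΓ : Type}
    [Fintype αΓ] {ea : α → List αΓ} {eb : β → List βΓ} {F : α → β} (cod : αΓ → A) (dcd : A → βΓ)
    (h : PC O (fun _ => True) [fun a => (ea a).map cod] f)
    (hf : ∀ a, (f a).map dcd = eb (F a)) :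
    Nonempty (TM2ComputableInPolyTime ea eb F) := by
  obtain ⟨⟨q, hq⟩, h⟩ := h
  obtain ⟨p, t, ⟨q', hq'⟩, hp⟩ := h [(2, fun a => (ea a).map cod)] 1 3 (by simp) (by simp)
    (by omega)
  refine Prog.computable (O := O) (.seq (.move 0 2) (.seq p (.clear 2))) cod dcd f hf
    (q + q' + 6 * Polynomial.X + 2)
    (fun a => ?_) fun a => ?_
  · have := hq a trivial
    simp at this ⊢
    omega
  · have e₁ := runs_move (O := O) (r := 0) (r' := 2) (by omega) ((ea a).map cod).reverse
      (Function.update (fun _ => []) 0 ((ea a).map cod).reverse) (by simp)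
    obtain ⟨k, hk, e₂⟩ := hp a (Function.update (fun _ => []) 2 ((ea a).map cod)) trivial
      (by simp) (fun r hr => by rw [Function.update_of_ne (by omega)])
    have e₃ := runs_clear (O := O) (r := 2) ((ea a).map cod)
      (Function.update (Function.update (fun _ => []) 2 ((ea a).map cod)) 1 (f a).reverse)
      (by rw [Function.update_of_ne (by omega)]; simp)
    refine ⟨_, ?_, (Runs.seq (e₁.congr ?_) (Runs.seq (e₂.congr ?_) e₃)).congr ?_⟩
    · have := hq' a trivial
      simp at this ⊢
      omega
    · simp
    · rw [Function.update_of_ne (by omega), List.append_nil]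
    · rw [Function.update_comm (by omega), Function.update_idem]
      congr 1
      exact Function.update_eq_self_iff.2 rfl

end PC

end StackProg

end

noncomputable section

/-! ### Unary arithmetic, tests and operations on lists. -/

namespace StackProg

theorem flatMap_range_ite {B : Type} (d : B) (k c : ℕ) :
    ((List.range c).flatMap fun i => if i < k then [d] else []) = List.replicate (min k c) d := by
  induction c with
  | zero => simp
  | succ c ih =>
    rw [List.range_succ, List.flatMap_append, ih]
    by_cases h : c < k
    · have e : min k (c + 1) = min k c + 1 := by omega
      rw [e, List.replicate_succ']
      simp [h]
    · have e : min k (c + 1) = min k c := by omega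
      simp [e, h]

theorem flatMap_range_const {B : Type} (l : List B) (c : ℕ) (x : B) (h : l = [x]) :
    ((List.range c).flatMap fun _ => l) = List.replicate c x := by
  subst h
  induction c with
  | zero => rfl
  | succ c ih => rw [List.range_succ, List.flatMap_append, ih, List.replicate_succ']; rfl

theorem flatMap_range_replicate {B : Type} (d : B) (n c : ℕ) :
    ((List.range c).flatMap fun _ => List.replicate n d) = List.replicate (c * n) d := by
  induction c with
  | zero => simp
  | succ c ih =>
    rw [List.range_succ, List.flatMap_append, ih]
    simp only [List.flatMap_singleton, List.replicate_append_replicate, Nat.succ_mul]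

theorem flatMap_range_getElem {B C : Type} (l : List B) (g : B → List C) :
    ((List.range l.length).flatMap fun i => (l[i]?).elim [] g) = l.flatMap g := by
  induction l using List.reverseRecOn with
  | nil => rfl
  | append_singleton l a ih =>
    simp only [List.length_append, List.length_singleton, List.range_succ, List.flatMap_append]
    rw [← ih]
    congr 1
    · refine List.flatMap_congr fun i hi => ?_
      rw [List.getElem?_append_left (List.mem_range.1 hi)]
    · simp

variable {A J : Type} {O : J → Oracle A} {α : Type} [Inhabited A] [Finite A]

/-- The number `c a` can be computed in unary. -/
def PCN (O : J → Oracle A) (D : α → Prop) (vs : List (α → List A)) (c : α → ℕ) : Prop :=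
  PC O D vs fun a => List.replicate (c a) default

open scoped Classical in
/-- The truth value of `P a` can be computed. -/
def PT (O : J → Oracle A) (D : α → Prop) (vs : List (α → List A)) (P : α → Prop) : Prop :=
  PC O D vs fun a => if P a then [default] else []

variable {D : α → Prop} {vs : List (α → List A)} {f g : α → List A} {c d : α → ℕ}
  {P Q : α → Prop}

theorem PCN.bound (h : PCN O D vs c) : PB D vs c := by simpa using h.length

theorem PCN.congr (h : PCN O D vs c) (e : ∀ a, D a → c a = d a) : PCN O D vs d :=
  PC.congr h fun a ha => by rw [e a ha]

theorem PCN.restrict {D' : α → Prop} (h : PCN O D vs c) (hD : ∀ a, D' a → D a) : PCN O D' vs c :=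
  PC.restrict h hD

theorem PT.congr (h : PT O D vs P) (e : ∀ a, D a → (P a ↔ Q a)) : PT O D vs Q :=
  PC.congr h fun a ha => by
    have := e a ha
    by_cases hP : P a <;> simp_all

/-- The values computed outside a loop are available inside. -/
theorem PC.lift (h : PC O D vs f) {β : Type} {E : α × β → Prop} {ws : List (α × β → List A)} :
    PC O (fun z => D z.1 ∧ E z) (ws ++ vs.map fun v z => v z.1) fun z => f z.1 :=
  h.comap Prod.fst (fun v hv => List.mem_append_right _ (List.mem_map.2 ⟨v, hv, rfl⟩))
    fun _ h => h.1

theorem PCN.lift (h : PCN O D vs c) {β : Type} {E : α × β → Prop} {ws : List (α × β → List A)} :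
    PCN O (fun z => D z.1 ∧ E z) (ws ++ vs.map fun v z => v z.1) fun z => c z.1 :=
  PC.lift h

theorem PC.len (h : PC O D vs f) : PCN O D vs fun a => (f a).length :=
  (h.foreach (PC.symbol default)).congr fun _ _ => flatMap_range_const _ _ _ rfl

/-- A loop over the numbers below `c a`. -/
theorem PC.range {g : α → ℕ → List A} (hc : PCN O D vs c)
    (hg : PC O (fun z : α × ℕ => D z.1 ∧ z.2 < c z.1)
      ((fun z => List.replicate z.2 default) :: vs.map fun v z => v z.1) fun z => g z.1 z.2) :
    PC O D vs fun a => (List.range (c a)).flatMap (g a) := by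
  refine (PC.foreach hc (g := g) (PC.letv ?_ (f := fun z => List.replicate z.2 default) ?_)).congr
    fun a _ => by rw [List.length_replicate]
  -- The loop index is recovered as the length of the prefix already passed.
  · refine PC.congr (PC.len (PC.var List.mem_cons_self)) fun z hz => ?_
    simp only [List.length_replicate] at hz
    simp [hz.2.le]
  · refine (hg.weaken ?_).restrict fun z hz => by simpa using hz
    intro v hv
    rcases List.mem_cons.1 hv with rfl | hv
    · exact List.mem_cons_self
    · exact List.mem_cons_of_mem _ (List.mem_cons_of_mem _ (List.mem_cons_of_mem _ hv))

theorem PCN.index {E : α × ℕ → Prop} {ws : List (α × ℕ → List A)} :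
    PCN O E ((fun z => List.replicate z.2 default) :: ws) fun z => z.2 :=
  PC.var List.mem_cons_self

theorem PC.replicate (hc : PCN O D vs c) (x : A) : PC O D vs fun a => List.replicate (c a) x :=
  (PC.range hc (PC.symbol x)).congr fun _ _ => flatMap_range_const _ _ _ rfl

theorem PCN.const (n : ℕ) : PCN O D vs fun _ => n := by
  induction n with
  | zero => exact PC.nil
  | succ n ih =>
    exact (PC.append ih (PC.symbol default)).congr fun _ _ => List.replicate_succ'.symm

theorem PCN.add (hc : PCN O D vs c) (hd : PCN O D vs d) : PCN O D vs fun a => c a + d a :=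
  (PC.append hc hd).congr fun _ _ => by rw [List.replicate_add]

theorem PCN.mul (hc : PCN O D vs c) (hd : PCN O D vs d) : PCN O D vs fun a => c a * d a :=
  (PC.range (g := fun a _ => List.replicate (d a) default) hc
    (hd.lift (ws := [_]))).congr fun _ _ => flatMap_range_replicate _ _ _

theorem PC.caseHead' (hf : PC O D vs f) {g : Option A → α → List A}
    (hg : ∀ o, PC O (fun a => D a ∧ (f a).head? = o) vs (g o)) :
    PC O D vs fun a => g (f a).head? a :=
  hf.letv (PC.caseHead List.mem_cons_self fun o =>
    (hg o).weaken fun _ hv => List.mem_cons_of_mem _ hv)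

theorem PC.head (hf : PC O D vs f) : PC O D vs fun a => (f a).head?.toList :=
  PC.caseHead' (g := fun o _ => o.toList) hf fun o => by
    cases o with
    | none => exact PC.nil
    | some x => exact PC.symbol x

open scoped Classical in
theorem PT.head (hf : PC O D vs f) (p : Option A → Prop) :
    PT O D vs fun a => p (f a).head? :=
  PC.caseHead' (g := fun o _ => if p o then [default] else []) hf fun o => by
    split_ifs
    · exact PC.symbol default
    · exact PC.nil

/-- A truth value is a list with one symbol or none, so branching is a case distinction on its head.
Each branch may assume the outcome of the test in its domain. -/
theorem PC.ite [∀ a, Decidable (P a)] (hP : PT O D vs P) (hf : PC O (fun a => D a ∧ P a) vs f)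
    (hg : PC O (fun a => D a ∧ ¬P a) vs g) : PC O D vs fun a => if P a then f a else g a := by
  classical
  refine (PC.caseHead' (g := fun o a => if o = none then g a else f a) hP fun o => ?_).congr ?_
  · by_cases ho : o = none
    · simp only [ho, if_true]
      refine hg.restrict fun a ha => ⟨ha.1, fun h => ?_⟩
      simp [h] at ha
    · simp only [ho, if_false]
      refine hf.restrict fun a ha => ⟨ha.1, ?_⟩
      by_contra h
      exact ho (by rw [← ha.2]; simp [h])
  · intro a _
    by_cases h : P a <;> simp [h]

theorem PT.true : PT O D vs fun _ => True :=
  (PC.symbol default).congr fun _ _ => by simp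

theorem PT.and (hP : PT O D vs P) (hQ : PT O D vs Q) : PT O D vs fun a => P a ∧ Q a := by
  classical
  refine (PC.ite (P := P) hP (PC.restrict hQ fun _ h => h.1) PC.nil).congr fun a _ => ?_
  by_cases h : P a <;> simp [h]

theorem PT.not (hP : PT O D vs P) : PT O D vs fun a => ¬P a := by
  classical
  refine (PC.ite (P := P) hP PC.nil (PC.symbol default)).congr fun a _ => ?_
  by_cases h : P a <;> simp [h]

theorem PT.forall_mem {ι : Type} (L : List ι) {P : ι → α → Prop}
    (h : ∀ i ∈ L, PT O D vs (P i)) : PT O D vs fun a => ∀ i ∈ L, P i a := by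
  induction L with
  | nil => exact PT.true.congr fun _ _ => by simp
  | cons i L ih =>
    exact ((h i List.mem_cons_self).and (ih fun j hj => h j (List.mem_cons_of_mem _ hj))).congr
      fun _ _ => by simp

theorem PT.forall_fin {n : ℕ} {P : Fin n → α → Prop} (h : ∀ i, PT O D vs (P i)) :
    PT O D vs fun a => ∀ i, P i a :=
  (PT.forall_mem (List.finRange n) fun i _ => h i).congr fun _ _ => by simp

theorem PC.flatMap_const {ι : Type} (L : List ι) {g : ι → α → List A}
    (h : ∀ i ∈ L, PC O D vs (g i)) : PC O D vs fun a => L.flatMap fun i => g i a := by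
  induction L with
  | nil => exact PC.nil
  | cons i L ih =>
    exact (h i List.mem_cons_self).append (ih fun j hj => h j (List.mem_cons_of_mem _ hj))

/-- Every position contributes the head of its suffix, except the first one, which is recognised by
its empty prefix. -/
theorem PC.tail (hf : PC O D vs f) : PC O D vs fun a => (f a).tail := by
  classical
  refine (hf.foreach (g := fun a i => if i = 0 then [] else ((f a).drop i).head?.toList)
    (PC.ite ((PT.head (PC.var List.mem_cons_self) (· = none)).congr fun z hz => ?_) PC.nil
      (PC.head (PC.var (by simp))))).congr fun a _ => ?_
  · simp only [List.head?_eq_none_iff, List.reverse_eq_nil_iff, List.take_eq_nil_iff]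
    have := hz.2
    constructor
    · rintro (h | h)
      · exact h
      · rw [h] at this; simp at this
    · exact Or.inl
  · cases h : f a with
    | nil => rfl
    | cons x l =>
      rw [List.length_cons, List.range_succ_eq_map, List.flatMap_cons, List.flatMap_map]
      have := flatMap_range_getElem l fun b => [b]
      rw [List.flatMap_singleton'] at this
      simp only [if_true, List.nil_append, List.tail_cons]
      conv_rhs => rw [← this]
      refine List.flatMap_congr fun i hi => ?_
      simp only [Nat.succ_ne_zero, if_false, Nat.succ_eq_add_one, List.drop_succ_cons,
        List.head?_drop]
      cases l[i]? <;> rfl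

theorem PC.drop (hc : PCN O D vs c) (hf : PC O D vs f) : PC O D vs fun a => (f a).drop (c a) := by
  have key : ∀ (n : ℕ) (l : List A), (List.tail)^[n] l = l.drop n := by
    intro n
    induction n with
    | zero => intro l; rfl
    | succ n ih => intro l; rw [Function.iterate_succ_apply, ih, ← List.drop_one, List.drop_drop,
        add_comm]
  refine (PC.iterate (step := fun _ l => l.tail) hc hf (PC.tail (PC.var List.mem_cons_self))
    hf.length fun a _ k _ => ?_).congr fun a _ => ?_
  · rw [key, List.length_drop]; omega
  · rw [key, List.length_replicate]

/-- Truncated subtraction of unary numbers is `drop`; all comparisons reduce to whether such a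
difference is positive. -/
theorem PCN.sub (hc : PCN O D vs c) (hd : PCN O D vs d) : PCN O D vs fun a => c a - d a :=
  (PC.drop hd hc).congr fun _ _ => List.drop_replicate

theorem PT.pos (hc : PCN O D vs c) : PT O D vs fun a => 0 < c a :=
  (PT.head hc (· ≠ none)).congr fun a _ => by simp [Nat.pos_iff_ne_zero]

theorem PT.lt (hc : PCN O D vs c) (hd : PCN O D vs d) : PT O D vs fun a => c a < d a :=
  (PT.pos (hd.sub hc)).congr fun a _ => by omega

theorem PT.le (hc : PCN O D vs c) (hd : PCN O D vs d) : PT O D vs fun a => c a ≤ d a :=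
  (PT.lt hd hc).not.congr fun a _ => by omega

theorem PT.eq (hc : PCN O D vs c) (hd : PCN O D vs d) : PT O D vs fun a => c a = d a :=
  ((PT.le hc hd).and (PT.le hd hc)).congr fun a _ => by omega

theorem PCN.inf (hc : PCN O D vs c) (hd : PCN O D vs d) : PCN O D vs fun a => min (c a) (d a) :=
  (hc.sub (hc.sub hd)).congr fun a _ => by omega

/-- The quotient is the number of `i` with `d * (i + 1) ≤ c`, and all such `i` are below `c`, so a
loop of length `c` finds them. -/
theorem PCN.div (hc : PCN O D vs c) (hd : PCN O D vs d) (h : ∀ a, D a → 0 < d a) :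
    PCN O D vs fun a => c a / d a := by
  classical
  refine (PC.range (g := fun a i => if d a * (i + 1) ≤ c a then [default] else []) hc
    (PC.ite (PT.le ((hd.lift (ws := [_])).mul (PCN.index.add (PCN.const 1)))
      (hc.lift (ws := [_]))) (PC.symbol _) PC.nil)).congr fun a ha => ?_
  have : ∀ i, d a * (i + 1) ≤ c a ↔ i < c a / d a := by
    intro i
    rw [Nat.lt_iff_add_one_le, Nat.le_div_iff_mul_le (h a ha), mul_comm]
  simp only [this]
  rw [flatMap_range_ite, min_eq_left (Nat.div_le_self _ _)]

theorem PC.take (hc : PCN O D vs c) (hf : PC O D vs f) : PC O D vs fun a => (f a).take (c a) := by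
  classical
  refine (hf.foreach (g := fun a i => if i < c a then ((f a).drop i).head?.toList else [])
    (PC.ite (PT.lt ((PC.len (PC.var List.mem_cons_self)).congr fun z hz => ?_)
      (hc.lift (ws := [_, _]))) (PC.head (PC.var (by simp))) PC.nil)).congr fun a _ => ?_
  · have := hz.2
    simp; omega
  · generalize f a = l
    induction l using List.reverseRecOn with
    | nil => simp
    | append_singleton l x ih =>
      simp only [List.length_append, List.length_singleton, List.range_succ, List.flatMap_append]
      have : (List.flatMap (fun i => if i < c a then (List.drop i (l ++ [x])).head?.toList else [])
          (List.range l.length)) = l.take (c a) := by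
        rw [← ih]
        refine List.flatMap_congr fun i hi => ?_
        rw [List.head?_drop, List.head?_drop, List.getElem?_append_left (List.mem_range.1 hi)]
      rw [this, List.take_append]
      congr 1
      by_cases h : l.length < c a
      · obtain ⟨k, hk⟩ : ∃ k, c a - l.length = k + 1 := ⟨c a - l.length - 1, by omega⟩
        simp [h, hk]
      · simp [h, show c a - l.length = 0 by omega]

theorem PC.dropWhile (p : A → Bool) (hf : PC O D vs f) :
    PC O D vs fun a => (f a).dropWhile p := by
  -- The step is stationary once the head fails `p` or the list is empty, so as many iterations as
  -- there are symbols suffice.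
  let step : List A → List A := fun l => if (l.head?.elim false p) = true then l.tail else l
  have hnil : ∀ n, step^[n] [] = [] := fun n => Function.iterate_fixed rfl n
  have key : ∀ (l : List A) (n : ℕ), l.length ≤ n → step^[n] l = l.dropWhile p := by
    intro l
    induction l with
    | nil => intro n _; simpa using hnil n
    | cons x l ih =>
      intro n hn
      by_cases h : p x = true
      · obtain ⟨n, rfl⟩ : ∃ m, n = m + 1 := ⟨n - 1, by simp at hn; omega⟩
        rw [Function.iterate_succ_apply, List.dropWhile_cons_of_pos h, ← ih n (by simpa using hn)]
        simp [step, h]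
      · rw [List.dropWhile_cons_of_neg h]
        exact Function.iterate_fixed (by simp [step, h]) n
  have hle : ∀ (l : List A) (n : ℕ), (step^[n] l).length ≤ l.length := by
    intro l n
    induction n generalizing l with
    | zero => simp
    | succ n ih =>
      rw [Function.iterate_succ_apply]
      refine (ih _).trans ?_
      simp only [step]
      split_ifs <;> simp
  refine (PC.iterate (step := fun _ => step) hf hf ?_ hf.length fun a _ k _ => hle _ k).congr
    fun a _ => key _ _ le_rfl
  exact PC.ite (PT.head (PC.var List.mem_cons_self) fun o => o.elim false p = true)
    (PC.tail (PC.var List.mem_cons_self)) (PC.var List.mem_cons_self)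

theorem PCN.leading (p : A → Bool) (hf : PC O D vs f) :
    PCN O D vs fun a => ((f a).takeWhile p).length :=
  (hf.len.sub (hf.dropWhile p).len).congr fun a _ => by
    have := congrArg List.length (List.takeWhile_append_dropWhile (p := p) (l := f a))
    rw [List.length_append] at this
    omega

/-- Iteration of a function on numbers. -/
theorem PCN.iterate {step : α → ℕ → ℕ} (hc : PCN O D vs c) (hd : PCN O D vs d)
    (hs : PCN O (fun z : α × ℕ => D z.1) ((fun z => List.replicate z.2 default) ::
      vs.map fun v z => v z.1) fun z => step z.1 z.2)
    {b : α → ℕ} (hb : PB D vs b) (hbd : ∀ a, D a → ∀ k ≤ c a, (step a)^[k] (d a) ≤ b a) :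
    PCN O D vs fun a => (step a)^[c a] (d a) := by
  have key : ∀ (a : α) (n m : ℕ), (fun l : List A => List.replicate (step a l.length) default)^[n]
      (List.replicate m default) = List.replicate ((step a)^[n] m) default := by
    intro a n
    induction n with
    | zero => intro m; rfl
    | succ n ih =>
      intro m
      rw [Function.iterate_succ_apply, List.length_replicate, ih, Function.iterate_succ_apply]
  refine (PC.iterate (step := fun a l => List.replicate (step a l.length) default) hc hd ?_ hb
    fun a ha k hk => ?_).congr fun a _ => ?_
  · refine PC.letv (PC.len (PC.var List.mem_cons_self)) ?_
    refine (PC.comap hs (fun z : α × List A => (z.1, z.2.length)) ?_ fun z hz => hz.1)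
    intro v hv
    rcases List.mem_cons.1 hv with rfl | hv
    · exact List.mem_cons_self
    · obtain ⟨w, hw, rfl⟩ := List.mem_map.1 hv
      exact List.mem_cons_of_mem _ (List.mem_cons_of_mem _ (List.mem_map.2 ⟨w, hw, rfl⟩))
  · rw [key, List.length_replicate]
    exact hbd a ha k (by simpa using hk)
  · rw [key, List.length_replicate]

/-- Powers of two, truncated. -/
theorem PCN.twoPow (hc : PCN O D vs c) (hd : PCN O D vs d) :
    PCN O D vs fun a => min (2 ^ c a) (d a) := by
  -- Truncating after every doubling has the same result as truncating once at the end, and keeps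
  -- the intermediate values small.
  have key : ∀ b k, (fun m => min (m + m) b)^[k] (min 1 b) = min (2 ^ k) b := by
    intro b k
    induction k with
    | zero => simp
    | succ k ih => rw [Function.iterate_succ_apply', ih, pow_succ]; omega
  refine (PCN.iterate (step := fun a m => min (m + m) (d a)) hc ((PCN.const 1).inf hd) ?_
    hd.bound fun a _ k _ => ?_).congr fun a _ => key _ _
  · have := hd.lift (β := ℕ) (E := fun _ => True)
      (ws := [fun z => List.replicate z.2 default])
    exact PCN.inf (PCN.index.add PCN.index) (this.restrict fun z hz => ⟨hz, trivial⟩)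
  · rw [key]; omega

end StackProg

end

noncomputable section

namespace MinQCircuit

/-! ### Applying gates -/

theorem extend_comp_self {k m : ℕ} (e : Fin k ↪ Fin m) (y : Fin m → Bool) :
    Function.extend e (y ∘ e) y = y := by
  funext q
  by_cases h : ∃ i, e i = q
  · obtain ⟨i, rfl⟩ := h
    simp [e.injective.extend_apply]
  · rw [Function.extend_apply' _ _ _ h]

theorem extend_extend {k m : ℕ} (e : Fin k ↪ Fin m) (y : Fin m → Bool) (z z' : Fin k → Bool) :
    Function.extend e z (Function.extend e z' y) = Function.extend e z y := by
  funext q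
  by_cases h : ∃ i, e i = q
  · obtain ⟨i, rfl⟩ := h
    simp [e.injective.extend_apply]
  · simp [Function.extend_apply' _ _ _ h]

theorem extend_comp {k m : ℕ} (e : Fin k ↪ Fin m) (y : Fin m → Bool) (z : Fin k → Bool) :
    Function.extend e z y ∘ e = z := by
  funext i
  simp [e.injective.extend_apply]

/-- The squared norm of a vector. -/
def normSq {m : ℕ} (ψ : QState m) : ℝ := ∑ y, ‖ψ y‖ ^ 2

/-- Averaging over the values at the positions `e`. -/
theorem sum_sum_extend {k m : ℕ} (e : Fin k ↪ Fin m) (F : (Fin m → Bool) → ℝ) :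
    ∑ y, ∑ z, F (Function.extend e z y) = 2 ^ k * ∑ y, F y := by
  -- `τ` exchanges `z` with the bits of `y` at the positions `e`. After reindexing by this
  -- involution the summand no longer depends on `z`, whence the factor `2 ^ k`.
  let τ : (Fin m → Bool) × (Fin k → Bool) → (Fin m → Bool) × (Fin k → Bool) :=
    fun x => (Function.extend e x.2 x.1, x.1 ∘ e)
  have hτ : Function.Involutive τ := by
    rintro ⟨y, z⟩
    simp only [τ, extend_extend, extend_comp, extend_comp_self]
  have := Equiv.sum_comp hτ.toPerm fun x => F x.1
  rw [Fintype.sum_prod_type, Fintype.sum_prod_type] at this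
  simp only [Function.Involutive.coe_toPerm, τ] at this
  rw [this]
  simp [Finset.mul_sum]

theorem sum_norm_sq_unitary {n : Type} [Fintype n] [DecidableEq n] {U : Matrix n n ℂ}
    (hU : U ∈ Matrix.unitaryGroup n ℂ) (v : n → ℂ) :
    ∑ i, ‖∑ j, U i j * v j‖ ^ 2 = ∑ i, ‖v i‖ ^ 2 := by
  have h1 : ∀ w : n → ℂ, ((∑ i, ‖w i‖ ^ 2 : ℝ) : ℂ) = star w ⬝ᵥ w := by
    intro w
    simp only [dotProduct, Pi.star_apply, RCLike.star_def]
    push_cast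
    exact Finset.sum_congr rfl fun i _ => (Complex.conj_mul' _).symm
  have h2 : star (U.mulVec v) ⬝ᵥ U.mulVec v = star v ⬝ᵥ v := by
    rw [Matrix.star_mulVec, Matrix.dotProduct_mulVec, Matrix.vecMul_vecMul,
      ← Matrix.star_eq_conjTranspose, Matrix.mem_unitaryGroup_iff'.1 hU, Matrix.vecMul_one]
  have h3 := (h1 (U.mulVec v)).trans (h2.trans (h1 v).symm)
  exact_mod_cast h3

/-- For fixed bits outside `e` the gate acts as the unitary `U` on the bits at `e`. Averaging over
the latter reduces the claim to the invariance of the norm under `U`. -/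
theorem normSq_applyOn {k m : ℕ} (U : Matrix.unitaryGroup (Fin k → Bool) ℂ) (e : Fin k ↪ Fin m)
    (ψ : QState m) : normSq (applyOn U.1 e ψ) = normSq ψ := by
  have h2 : (2 : ℝ) ^ k ≠ 0 := by positivity
  apply mul_left_cancel₀ h2
  unfold normSq
  rw [← sum_sum_extend e, ← sum_sum_extend e]
  refine Finset.sum_congr rfl fun y _ => ?_
  simp only [applyOn, extend_comp, extend_extend]
  exact sum_norm_sq_unitary U.2 fun z => ψ (Function.extend e z y)

theorem normSq_run {G : GateSet} {m : ℕ} (C : G.Circuit m) (ψ : QState m) :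
    normSq (GateSet.run C ψ) = normSq ψ := by
  induction C generalizing ψ with
  | nil => rfl
  | cons o C ih => exact (ih _).trans (normSq_applyOn _ _ _)

theorem normSq_basisState {m : ℕ} (x : Fin m → Bool) : normSq (basisState x) = 1 := by
  simp [normSq, basisState, apply_ite]

theorem run_append {G : GateSet} {m : ℕ} (C C' : G.Circuit m) (ψ : QState m) :
    GateSet.run (C ++ C') ψ = GateSet.run C' (GateSet.run C ψ) := List.foldl_append

/-! ### The gates of the verifier -/

/-- The classical gates of the verifier. -/
inductive Cl
  | not
  | copy
  | step

instance : Fintype Cl := 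
  ⟨⟨([Cl.not, Cl.copy, Cl.step] : List Cl), by simp⟩, fun x => by cases x <;> simp⟩

/-- The number of control bits of a classical gate. -/
def Cl.ctrls : Cl → ℕ
  | not => 0
  | copy => 1
  | step => 3

/-- The bit that a classical gate adds to its target. -/
def Cl.fn : ∀ c : Cl, (Fin c.ctrls → Bool) → Bool
  | not => fun _ => true
  | copy => fun v => v (0 : Fin 1)
  | step => fun v => v (0 : Fin 3) || (v (1 : Fin 3) && v (2 : Fin 3))

/-- Adds `f` of the other bits to the first bit. -/
def xorMap {k : ℕ} (f : (Fin k → Bool) → Bool) (y : Fin (k + 1) → Bool) : Fin (k + 1) → Bool :=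
  Fin.cons (xor (y 0) (f (Fin.tail y))) (Fin.tail y)

theorem xorMap_xorMap {k : ℕ} (f : (Fin k → Bool) → Bool) (y : Fin (k + 1) → Bool) :
    xorMap f (xorMap f y) = y := by
  simp [xorMap]

/-- The permutation matrix of `xorMap f`. -/
def xorMatrix {k : ℕ} (f : (Fin k → Bool) → Bool) :
    Matrix.unitaryGroup (Fin (k + 1) → Bool) ℂ :=
  ⟨Matrix.of fun y z => if z = xorMap f y then 1 else 0, by
    rw [Matrix.mem_unitaryGroup_iff]
    ext y y'
    have hinj : xorMap f y = xorMap f y' ↔ y = y' :=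
      ⟨fun h => by rw [← xorMap_xorMap f y, h, xorMap_xorMap], fun h => by rw [h]⟩
    simp [Matrix.mul_apply, Matrix.star_apply, apply_ite, Matrix.one_apply]
    by_cases h : y = y'
    · simp [h]
    · have h' : ¬xorMap f y' = xorMap f y := fun e => h (hinj.1 e.symm)
      simp [h, h']⟩

/-- The gates of the verifier: those of `G` and the classical gates. -/
def verifierGates (G : GateSet) : GateSet where
  ι := G.ι ⊕ Cl
  arity := fun g => match g with
    | .inl g => G.arity g
    | .inr c => c.ctrls + 1
  mat := fun g => match g with
    | .inl g => G.mat g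
    | .inr c => xorMatrix c.fn

/-- A classical gate with the positions of its target and its control bits. -/
abbrev ClOp (M : ℕ) : Type := Σ c : Cl, Fin (c.ctrls + 1) ↪ Fin M

namespace ClOp

variable {M : ℕ}

/-- A classical gate application as a gate application of the verifier. -/
def toOp (G : GateSet) (o : ClOp M) : (verifierGates G).Op M := ⟨.inr o.1, o.2⟩

/-- The effect of a classical gate on bits. -/
def act (o : ClOp M) (y : Fin M → Bool) : Fin M → Bool :=
  Function.update y (o.2 0) (xor (y (o.2 0)) (o.1.fn fun i => y (o.2 i.succ)))

/-- The effect of a sequence of classical gates on bits. -/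
def exec (L : List (ClOp M)) (y : Fin M → Bool) : Fin M → Bool := L.foldl (fun y o => o.act y) y

/-- The target is not among the controls, so the second application adds the same bit again. -/
theorem act_act (o : ClOp M) (y : Fin M → Bool) : o.act (o.act y) = y := by
  have h : ∀ i : Fin o.1.ctrls, o.2 i.succ ≠ o.2 0 := fun i h =>
    Fin.succ_ne_zero i (o.2.injective h)
  simp [act, h]

theorem extend_xorMap (o : ClOp M) (y : Fin M → Bool) :
    Function.extend o.2 (xorMap o.1.fn (y ∘ o.2)) y = o.act y := by
  funext q
  by_cases h : ∃ i, o.2 i = q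
  · obtain ⟨i, rfl⟩ := h
    rw [o.2.injective.extend_apply]
    refine Fin.cases ?_ (fun i => ?_) i
    · simp [act, xorMap]; rfl
    · have : o.2 i.succ ≠ o.2 0 := fun h => Fin.succ_ne_zero i (o.2.injective h)
      simp [act, xorMap, this, Fin.tail]
  · rw [Function.extend_apply' _ _ _ h, act, Function.update_of_ne]
    exact fun h' => h ⟨0, h'.symm⟩

theorem applyOn_toOp (G : GateSet) (o : ClOp M) (ψ : QState M) :
    applyOn ((verifierGates G).mat (o.toOp G).1).1 (o.toOp G).2 ψ = fun y => ψ (o.act y) := by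
  funext y
  rw [← extend_xorMap]
  change ∑ z, (if z = xorMap o.1.fn (y ∘ o.2) then (1 : ℂ) else 0) * _ = _
  simp only [ite_mul, one_mul, zero_mul, Finset.sum_ite_eq', Finset.mem_univ, if_true]
  rfl

/-- `applyOn_toOp` describes a gate as a pullback of amplitudes. As each gate is an involution, this
also pushes the amplitude at `y` forward to `o.act y`. -/
theorem run_exec (G : GateSet) (L : List (ClOp M)) (ψ : QState M) (y : Fin M → Bool) :
    GateSet.run (L.map (toOp G)) ψ (exec L y) = ψ y := by
  induction L generalizing ψ y with
  | nil => rfl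
  | cons o L ih =>
    have := ih (applyOn ((verifierGates G).mat (o.toOp G).1).1 (o.toOp G).2 ψ) (o.act y)
    refine Eq.trans this ?_
    rw [applyOn_toOp]
    exact congrArg ψ (act_act o y)

theorem exec_injective (L : List (ClOp M)) : Function.Injective (exec L) := by
  induction L with
  | nil => exact fun _ _ h => h
  | cons o L ih =>
    intro y y' h
    have : o.act y = o.act y' := ih h
    rw [← act_act o y, ← act_act o y', this]

theorem run_basisState (G : GateSet) (L : List (ClOp M)) (x : Fin M → Bool) :
    GateSet.run (L.map (toOp G)) (basisState x) = basisState (exec L x) := by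
  funext y
  obtain ⟨y, rfl⟩ := (Finite.injective_iff_surjective.1 (exec_injective L)) y
  rw [run_exec]
  simp [basisState, (exec_injective L).eq_iff]

/-- Classical gates permute the basis states. Measuring after them amounts to measuring before them
and computing the outcome classically. -/
theorem firstQubitProb_run (G : GateSet) (L : List (ClOp M)) (ψ : QState M) (b : Bool) :
    firstQubitProb (GateSet.run (L.map (toOp G)) ψ) b =
      ∑ y, if ∃ h : 0 < M, exec L y ⟨0, h⟩ = b then ‖ψ y‖ ^ 2 else 0 := by
  have := Equiv.sum_comp (Equiv.ofBijective _ (Finite.injective_iff_bijective.1 (exec_injective L)))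
    fun y => if ∃ h : 0 < M, y ⟨0, h⟩ = b then ‖GateSet.run (L.map (toOp G)) ψ y‖ ^ 2 else 0
  rw [firstQubitProb, ← this]
  simp only [Equiv.ofBijective_apply, run_exec]

end ClOp

/-! ### Independent copies -/

section Copies

variable {C : Type} [Fintype C] [DecidableEq C] {m M : ℕ} (Ψ : C × Fin m ↪ Fin M)

/-- The positions of the qubits of a copy. -/
def copyEmb (c : C) : Fin m ↪ Fin M :=
  ⟨fun i => Ψ (c, i), fun i j h => by simpa using Ψ.injective h⟩

open scoped Classical in
/-- The product of the states `φ c`, at the positions of the copies, and of zeros elsewhere. -/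
def prodState (φ : C → QState m) : QState M := fun y =>
  if ∀ q, q ∉ Set.range Ψ → y q = false then ∏ c, φ c fun i => y (Ψ (c, i)) else 0

theorem prodState_zero :
    prodState Ψ (fun _ => basisState fun _ => false) = basisState fun _ => false := by
  classical
  funext y
  unfold prodState basisState
  by_cases h : y = fun _ => false
  · subst h; simp
  rw [if_neg h]
  split_ifs with h'
  · obtain ⟨q, hq⟩ : ∃ q, y q ≠ false := by
      by_contra! h''
      exact h (funext h'')
    have hq' : q ∈ Set.range Ψ := by
      by_contra h''
      exact hq (h' q h'')
    obtain ⟨⟨c, i⟩, rfl⟩ := hq'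
    refine Finset.prod_eq_zero (Finset.mem_univ c) (if_neg fun h'' => hq ?_)
    exact congrFun h'' i
  · rfl

/-- The gate changes only bits of copy `c`, so the factors of all other copies come out of the sum,
and what remains is the gate applied to `φ c`. -/
theorem applyOn_prodState {k : ℕ} (U : Matrix (Fin k → Bool) (Fin k → Bool) ℂ) (e : Fin k ↪ Fin m)
    (c : C) (φ : C → QState m) :
    applyOn U (e.trans (copyEmb Ψ c)) (prodState Ψ φ) =
      prodState Ψ (Function.update φ c (applyOn U e (φ c))) := by
  classical
  funext y
  have hout : ∀ z q, q ∉ Set.range Ψ →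
      Function.extend (e.trans (copyEmb Ψ c)) z y q = y q := by
    intro z q hq
    refine Function.extend_apply' _ _ _ ?_
    rintro ⟨i, rfl⟩
    exact hq ⟨_, rfl⟩
  have hne : ∀ z c', c' ≠ c → ∀ i,
      Function.extend (e.trans (copyEmb Ψ c)) z y (Ψ (c', i)) = y (Ψ (c', i)) := by
    intro z c' hc i
    refine Function.extend_apply' _ _ _ ?_
    rintro ⟨j, hj⟩
    have := Ψ.injective hj
    simp only [Prod.mk.injEq] at this
    exact hc this.1.symm
  have hself : ∀ z, (fun i => Function.extend (e.trans (copyEmb Ψ c)) z y (Ψ (c, i))) =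
      Function.extend e z fun i => y (Ψ (c, i)) := by
    intro z
    funext i
    by_cases h : ∃ j, e j = i
    · obtain ⟨j, rfl⟩ := h
      rw [e.injective.extend_apply]
      exact (e.trans (copyEmb Ψ c)).injective.extend_apply _ _ j
    · rw [Function.extend_apply' _ _ _ h, Function.extend_apply']
      rintro ⟨j, hj⟩
      have := Ψ.injective hj
      simp only [Prod.mk.injEq, true_and] at this
      exact h ⟨j, this⟩
  simp only [applyOn, prodState]
  by_cases h : ∀ q, q ∉ Set.range Ψ → y q = false
  · rw [if_pos h, ← Finset.mul_prod_erase _ _ (Finset.mem_univ c), Function.update_self,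
      applyOn, Finset.sum_mul]
    refine Finset.sum_congr rfl fun z _ => ?_
    rw [if_pos fun q hq => by rw [hout z q hq]; exact h q hq,
      ← Finset.mul_prod_erase _ _ (Finset.mem_univ c), hself, ← mul_assoc]
    congr 1
    refine Finset.prod_congr rfl fun c' hc' => ?_
    have hc := Finset.ne_of_mem_erase hc'
    rw [Function.update_of_ne hc]
    congr 1
    funext i
    exact hne z c' hc i
  · rw [if_neg h]
    refine Finset.sum_eq_zero fun z _ => ?_
    rw [if_neg, mul_zero]
    intro h'
    exact h fun q hq => by rw [← hout z q hq]; exact h' q hq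

variable {V : GateSet}

/-- A gate application in a copy. -/
def liftOp (c : C) (o : V.Op m) : V.Op M := ⟨o.1, o.2.trans (copyEmb Ψ c)⟩

theorem run_liftOp (c : C) (D : V.Circuit m) (φ : C → QState m) :
    GateSet.run (D.map (liftOp Ψ c)) (prodState Ψ φ) =
      prodState Ψ (Function.update φ c (GateSet.run D (φ c))) := by
  induction D generalizing φ with
  | nil => simp [GateSet.run]
  | cons o D ih =>
    have := ih (Function.update φ c (applyOn (V.mat o.1).1 o.2 (φ c)))
    rw [Function.update_idem, Function.update_self] at this
    refine Eq.trans ?_ this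
    rw [← applyOn_prodState]
    rfl

/-- As `l` has no repetitions, each copy is still in its original state when its own circuit starts.
-/
theorem run_copies (D : C → V.Circuit m) (l : List C) (hl : l.Nodup) (φ : C → QState m) :
    GateSet.run (l.flatMap fun c => (D c).map (liftOp Ψ c)) (prodState Ψ φ) =
      prodState Ψ fun c => if c ∈ l then GateSet.run (D c) (φ c) else φ c := by
  induction l generalizing φ with
  | nil => simp [GateSet.run]
  | cons c l ih =>
    rw [List.flatMap_cons, run_append, run_liftOp, ih (List.nodup_cons.1 hl).2]
    congr 1
    funext c'
    by_cases h : c' = c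
    · subst h
      simp [(List.nodup_cons.1 hl).1]
    · simp [h]

/-- Only basis states that vanish outside the copies have nonzero amplitude, and on these the
squared amplitude factors. Measuring the copies thus gives independent outcomes. -/
theorem sum_prodState (φ : C → QState m) (H : (Fin M → Bool) → ℝ) :
    ∑ y, H y * ‖prodState Ψ φ y‖ ^ 2 = ∑ z : C → Fin m → Bool,
      H (Function.extend Ψ (fun x => z x.1 x.2) fun _ => false) * ∏ c, ‖φ c (z c)‖ ^ 2 := by
  classical
  let f : (C → Fin m → Bool) → Fin M → Bool := fun z =>
    Function.extend Ψ (fun x => z x.1 x.2) fun _ => false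
  have hΨ : ∀ z x, f z (Ψ x) = z x.1 x.2 := fun z x => Ψ.injective.extend_apply _ _ x
  have hf : Function.Injective f := by
    intro z z' h
    funext c i
    rw [← hΨ z (c, i), ← hΨ z' (c, i), h]
  rw [← Finset.sum_subset (Finset.subset_univ (Finset.univ.image f)), Finset.sum_image hf.injOn]
  · refine Finset.sum_congr rfl fun z _ => ?_
    rw [prodState, if_pos fun q hq => Function.extend_apply' _ _ _ fun ⟨x, hx⟩ => hq ⟨x, hx⟩,
      norm_prod, Finset.prod_pow]
    simp only [hΨ, f]
  · intro y _ hy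
    rw [prodState, if_neg, norm_zero]
    · simp
    intro h
    refine hy (Finset.mem_image.2 ⟨fun c i => y (Ψ (c, i)), Finset.mem_univ _, ?_⟩)
    funext q
    by_cases hq : q ∈ Set.range Ψ
    · obtain ⟨x, rfl⟩ := hq
      exact hΨ (fun c i => y (Ψ (c, i))) x
    · rw [h q hq]
      exact Function.extend_apply' _ _ _ fun ⟨x, hx⟩ => hq ⟨x, hx⟩

end Copies

end MinQCircuit

end

noncomputable section

namespace MinQCircuit

/-! ### Independent trials -/

section Trials

variable {C Y : Type} [Fintype C] [DecidableEq C] [Fintype Y] {w : C → Y → ℝ}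

theorem sum_prod_pi (g : C → Y → ℝ) : ∑ z : C → Y, ∏ c, g c (z c) = ∏ c, ∑ y, g c y := by
  classical
  rw [Finset.prod_univ_sum, Fintype.piFinset_univ]

theorem sum_weights (hw : ∀ c, ∑ y, w c y = 1) : ∑ z : C → Y, ∏ c, w c (z c) = 1 := by
  rw [sum_prod_pi]
  exact Finset.prod_eq_one fun c _ => hw c

/-- The variance of a sum of independent variables: in the expanded square every mixed term contains
a factor of mean zero. -/
theorem sum_sq_deviation (hw : ∀ c, ∑ y, w c y = 1) (X : C → Y → ℝ)
    (hX : ∀ c, ∑ y, X c y * w c y = 0) (S : Finset C) :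
    ∑ z : C → Y, (∑ c ∈ S, X c (z c)) ^ 2 * ∏ c, w c (z c) =
      ∑ c ∈ S, ∑ y, X c y ^ 2 * w c y := by
  have key : ∀ c d, ∑ z : C → Y, X c (z c) * X d (z d) * ∏ c, w c (z c) =
      if c = d then ∑ y, X c y ^ 2 * w c y else 0 := by
    intro c d
    have h1 : ∀ z : C → Y, X c (z c) * X d (z d) * ∏ c, w c (z c) =
        ∏ e, (if e = c then X e (z e) else 1) * (if e = d then X e (z e) else 1) * w e (z e) := by
      intro z
      rw [Finset.prod_mul_distrib, Finset.prod_mul_distrib, Finset.prod_ite_eq', Finset.prod_ite_eq']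
      simp
    simp only [h1]
    rw [sum_prod_pi fun e y => (if e = c then X e y else 1) * (if e = d then X e y else 1) * w e y]
    split_ifs with h
    · subst h
      rw [← Finset.mul_prod_erase _ _ (Finset.mem_univ c), Finset.prod_eq_one, mul_one]
      · simp [pow_two]
      · intro e he
        simp [Finset.ne_of_mem_erase he, hw]
    · refine Finset.prod_eq_zero (Finset.mem_univ c) ?_
      simp [h, hX]
  calc ∑ z : C → Y, (∑ c ∈ S, X c (z c)) ^ 2 * ∏ c, w c (z c)
      = ∑ z : C → Y, ∑ c ∈ S, ∑ d ∈ S, X c (z c) * X d (z d) * ∏ c, w c (z c) := by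
        refine Finset.sum_congr rfl fun z _ => ?_
        rw [pow_two, Finset.sum_mul_sum, Finset.sum_mul]
        exact Finset.sum_congr rfl fun c _ => Finset.sum_mul _ _ _
    _ = ∑ c ∈ S, ∑ d ∈ S, ∑ z : C → Y, X c (z c) * X d (z d) * ∏ c, w c (z c) := by
        rw [Finset.sum_comm]
        exact Finset.sum_congr rfl fun c _ => Finset.sum_comm
    _ = _ := by
        refine Finset.sum_congr rfl fun c hc => ?_
        simp [key, hc]

open scoped Classical in
/-- Chebyshev's inequality for the number of successes among the trials in `S`. -/
theorem chebyshev (h0 : ∀ c y, 0 ≤ w c y) (hw : ∀ c, ∑ y, w c y = 1) (B : Y → Prop)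
    (S : Finset C) (Q : (C → Y) → Prop) {δ : ℝ} (hδ : 0 < δ)
    (hQ : ∀ z, Q z → δ ≤ |∑ c ∈ S, ((if B (z c) then (1 : ℝ) else 0) -
      ∑ y, if B y then w c y else 0)|) :
    ∑ z : C → Y, (if Q z then (1 : ℝ) else 0) * ∏ c, w c (z c) ≤ S.card / (4 * δ ^ 2) := by
  set p : C → ℝ := fun c => ∑ y, if B y then w c y else 0 with hp
  have hp' : ∀ c, ∑ y, (if B y then (1 : ℝ) else 0) * w c y = p c := by
    intro c
    simp [hp]
  have e := sum_sq_deviation hw (fun c y => (if B y then (1 : ℝ) else 0) - p c)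
    (fun c => by simp only [sub_mul, Finset.sum_sub_distrib, hp', ← Finset.mul_sum, hw]; ring) S
  -- A trial with success probability `p` has variance `p - p ^ 2`, which is at most `1 / 4`.
  have hv : ∀ c, ∑ y, ((if B y then (1 : ℝ) else 0) - p c) ^ 2 * w c y ≤ 1 / 4 := by
    intro c
    have : ∀ y, ((if B y then (1 : ℝ) else 0) - p c) ^ 2 * w c y =
        (1 - 2 * p c) * ((if B y then (1 : ℝ) else 0) * w c y) + p c ^ 2 * w c y := by
      intro y
      split_ifs <;> ring
    simp only [this, Finset.sum_add_distrib, ← Finset.mul_sum, hw, hp']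
    nlinarith [sq_nonneg (p c - 1 / 2)]
  -- Markov's inequality for the squared deviation, which is at least `δ ^ 2` whenever `Q` holds.
  have h1 : ∑ z : C → Y, δ ^ 2 * ((if Q z then (1 : ℝ) else 0) * ∏ c, w c (z c)) ≤
      S.card * (1 / 4) := by
    refine le_trans (Finset.sum_le_sum fun z _ => ?_)
      (e.le.trans ((Finset.sum_le_sum fun c _ => hv c).trans (by simp)))
    have hz : 0 ≤ ∏ c, w c (z c) := Finset.prod_nonneg fun c _ => h0 c _
    rw [← mul_assoc]
    refine mul_le_mul_of_nonneg_right ?_ hz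
    split_ifs with h
    · rw [mul_one]
      exact sq_le_sq.2 ((abs_of_pos hδ).le.trans (hQ z h))
    · rw [mul_zero]; exact sq_nonneg _
  rw [← Finset.mul_sum] at h1
  rw [le_div_iff₀ (by positivity)]
  linarith

end Trials

/-! ### Classical circuits with unrestricted positions -/

/-- A classical gate with the indices of its target and its control bits. -/
abbrev RawCl : Type := Σ c : Cl, Fin (c.ctrls + 1) → ℕ

namespace RawCl

/-- The positions are distinct, and there are `M` positions. -/
def Valid (M : ℕ) (o : RawCl) : Prop := Function.Injective o.2 ∧ ∀ i, o.2 i < M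

/-- The effect on infinitely many bits. -/
def act (o : RawCl) (Y : ℕ → Bool) : ℕ → Bool :=
  Function.update Y (o.2 0) (xor (Y (o.2 0)) (o.1.fn fun i => Y (o.2 i.succ)))

/-- The effect of a sequence of gates. -/
def exec (L : List RawCl) (Y : ℕ → Bool) : ℕ → Bool := L.foldl (fun Y o => o.act Y) Y

/-- A valid gate as a gate on `M` bits. -/
def typed {M : ℕ} (o : RawCl) (h : o.Valid M) : ClOp M :=
  ⟨o.1, fun i => ⟨o.2 i, h.2 i⟩, fun _ _ e => h.1 (congrArg Fin.val e)⟩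

open scoped Classical in
/-- The valid gates of a list. -/
def toOps (M : ℕ) (L : List RawCl) : List (ClOp M) :=
  L.flatMap fun o => if h : o.Valid M then [o.typed h] else []

/-- Bits beyond the end are zero. -/
def ext {M : ℕ} (y : Fin M → Bool) (q : ℕ) : Bool := if h : q < M then y ⟨q, h⟩ else false

theorem ext_val {M : ℕ} (y : Fin M → Bool) (q : Fin M) : ext y q = y q := by simp [ext]

theorem ext_act {M : ℕ} (o : RawCl) (h : o.Valid M) (y : Fin M → Bool) :
    ext ((o.typed h).act y) = o.act (ext y) := by
  have e : ∀ i, ext y (o.2 i) = y ⟨o.2 i, h.2 i⟩ := fun i => by simp [ext, h.2 i]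
  funext q
  by_cases hq : q = o.2 0
  · subst hq
    have e0 : ext ((o.typed h).act y) (o.2 0) = (o.typed h).act y ⟨o.2 0, h.2 0⟩ := by
      simp [ext, h.2 0]
    rw [e0]
    simp only [act, Function.update_self, e]
    exact Function.update_self _ _ _
  · simp only [act, Function.update_of_ne hq]
    by_cases hM : q < M
    · have : (⟨q, hM⟩ : Fin M) ≠ ⟨o.2 0, h.2 0⟩ := fun e => hq (congrArg Fin.val e)
      simp only [ext, hM, dif_pos]
      exact Function.update_of_ne this _ _
    · simp [ext, hM]

/-- Positions as plain natural numbers keep bound proofs out of the construction of circuits; for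
valid gates nothing is lost. -/
theorem ext_exec {M : ℕ} (L : List RawCl) (h : ∀ o ∈ L, o.Valid M) (y : Fin M → Bool) :
    ext (ClOp.exec (toOps M L) y) = exec L (ext y) := by
  induction L generalizing y with
  | nil => rfl
  | cons o L ih =>
    have ho := h o List.mem_cons_self
    have := ih (fun o' ho' => h o' (List.mem_cons_of_mem _ ho')) ((o.typed ho).act y)
    rw [ext_act] at this
    refine Eq.trans ?_ this
    simp [toOps, ho, ClOp.exec]

/-- A sequence of gates with increasing targets, each larger than the control positions, solves the
equations of its gates. -/
theorem exec_spec (L : List RawCl) (hL : L.Pairwise fun o o' => o.2 0 < o'.2 0)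
    (hc : ∀ o ∈ L, ∀ i : Fin o.1.ctrls, o.2 i.succ < o.2 0) (Y : ℕ → Bool) :
    (∀ q, (∀ o ∈ L, o.2 0 ≠ q) → exec L Y q = Y q) ∧
    ∀ o ∈ L, exec L Y (o.2 0) = xor (Y (o.2 0)) (o.1.fn fun i => exec L Y (o.2 i.succ)) := by
  induction L generalizing Y with
  | nil => simp [exec]
  | cons o L ih =>
    obtain ⟨h1, h2⟩ := List.pairwise_cons.1 hL
    obtain ⟨h3, h4⟩ := ih h2 (fun o' ho' => hc o' (List.mem_cons_of_mem _ ho')) (o.act Y)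
    have e : exec (o :: L) Y = exec L (o.act Y) := rfl
    have hne : ∀ q, q ≠ o.2 0 → o.act Y q = Y q := fun q hq => Function.update_of_ne hq _ _
    rw [e]
    refine ⟨fun q hq => ?_, fun o' ho' => ?_⟩
    · rw [h3 q fun o' ho' => hq o' (List.mem_cons_of_mem _ ho')]
      exact hne q (hq o List.mem_cons_self).symm
    · rcases List.mem_cons.1 ho' with rfl | ho'
      -- Later gates have larger targets, so they alter neither the target nor the controls of this
      -- gate.
      · rw [h3 _ fun o'' ho'' => (h1 o'' ho'').ne']
        refine (Function.update_self _ _ _).trans ?_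
        congr 2
        funext i
        have := hc o' List.mem_cons_self i
        rw [h3 _ fun o'' ho'' => (this.trans (h1 o'' ho'')).ne']
        exact (hne _ this.ne).symm
      · rw [h4 o' ho', hne _ (h1 o' ho').ne']

end RawCl

/-! ### The threshold circuit -/

section Threshold

/-- Inversion of the target. -/
def notAt (t : ℕ) : RawCl := ⟨.not, fun _ => t⟩

/-- Adds a bit to the target. -/
def copyAt (t a : ℕ) : RawCl := ⟨.copy, Fin.cons t fun _ => a⟩

/-- Adds `a || (b && o)` to the target. -/
def stepAt (t a b o : ℕ) : RawCl := ⟨.step, (![t, a, b, o] : Fin 4 → ℕ)⟩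

variable (B N T : ℕ) (off : ℕ → ℕ → ℕ)

/-- The position of a cell of the counter. -/
def loc (x i j : ℕ) : ℕ := B + (x * (N + 1) + i) * (T + 2) + j

/-- The gates that count the number of ones among the bits `off x i`, `i < N`. -/
def countBlock (x : ℕ) : List RawCl :=
  ((List.range N).flatMap fun i => (List.range (T + 1)).map fun j =>
    stepAt (loc B N T x (i + 1) (j + 1)) (loc B N T x i (j + 1)) (loc B N T x i j) (off x i)) ++
  [copyAt (loc B N T (x + 1) 0 1) (loc B N T x N (T + 1))]

/-- The gates that check for all `x < K` whether there are at least `T` ones among the bits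
`off x i`, `i < N`. -/
def countAll (K : ℕ) : List RawCl :=
  notAt (loc B N T 0 0 1) :: (List.range K).flatMap (countBlock B N T off)

variable {B N T off}

/-- Cells are numbered lexicographically, with `N + 1` rows of `T + 2` cells for each `x`. An
earlier row lies entirely before a later one. -/
theorem loc_lt {x i j x' i' j' : ℕ} (h : x * (N + 1) + i < x' * (N + 1) + i') (hj : j < T + 2) :
    loc B N T x i j < loc B N T x' i' j' := by
  have := Nat.mul_le_mul_right (T + 2) (Nat.succ_le_of_lt h)
  rw [Nat.succ_mul] at this
  unfold loc
  omega

theorem row_lt {x i x' i' : ℕ} (h : x < x') (hi : i < N + 1) :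
    x * (N + 1) + i < x' * (N + 1) + i' := by
  have := Nat.mul_le_mul_right (N + 1) (Nat.succ_le_of_lt h)
  rw [Nat.succ_mul] at this
  omega

theorem loc_inj {x i j x' i' j' : ℕ} (h : loc B N T x i j = loc B N T x' i' j') (hj : j < T + 2)
    (hj' : j' < T + 2) (hi : i < N + 1) (hi' : i' < N + 1) : x = x' ∧ i = i' ∧ j = j' := by
  have h1 : x * (N + 1) + i = x' * (N + 1) + i' := by
    rcases lt_trichotomy (x * (N + 1) + i) (x' * (N + 1) + i') with h1 | h1 | h1
    · exact absurd h (loc_lt h1 hj).ne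
    · exact h1
    · exact absurd h (loc_lt h1 hj').ne'
  have h2 : x = x' := by
    rcases lt_trichotomy x x' with h2 | h2 | h2
    · exact absurd h1 (row_lt h2 hi).ne
    · exact h2
    · exact absurd h1 (row_lt h2 hi').ne'
  subst h2
  refine ⟨rfl, by omega, ?_⟩
  unfold loc at h
  rw [h1] at h
  omega

theorem le_loc (x i j : ℕ) : B ≤ loc B N T x i j := by unfold loc; omega

theorem mem_countAll {K : ℕ} {o : RawCl} : o ∈ countAll B N T off K ↔
    o = notAt (loc B N T 0 0 1) ∨ ∃ x < K,
      (∃ i < N, ∃ j < T + 1, o = stepAt (loc B N T x (i + 1) (j + 1)) (loc B N T x i (j + 1))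
        (loc B N T x i j) (off x i)) ∨
      o = copyAt (loc B N T (x + 1) 0 1) (loc B N T x N (T + 1)) := by
  simp only [countAll, countBlock, List.mem_cons, List.mem_flatMap, List.mem_append, List.mem_map,
    List.mem_range, List.not_mem_nil, or_false]
  simp only [eq_comm]

/-- Increasing targets are what `RawCl.exec_spec` needs to replace the run of the circuit by a
system of equations for its cells. -/
theorem pairwise_countAll (K : ℕ) :
    (countAll B N T off K).Pairwise fun o o' => o.2 0 < o'.2 0 := by
  rw [countAll, List.pairwise_cons]
  constructor
  · intro o ho
    have := (mem_countAll (K := K) (off := off)).1 (List.mem_cons_of_mem _ ho)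
    simp only [List.mem_flatMap, countBlock, List.mem_append, List.mem_map, List.mem_range,
      List.mem_singleton] at ho
    obtain ⟨x, -, ⟨i, -, j, -, rfl⟩ | rfl⟩ := ho
    · exact loc_lt (by omega) (by omega)
    · exact loc_lt (row_lt (Nat.succ_pos _) (Nat.succ_pos _)) (by omega)
  · rw [List.pairwise_flatMap]
    constructor
    · intro x _
      rw [countBlock, List.pairwise_append]
      refine ⟨?_, List.pairwise_singleton _ _, ?_⟩
      · rw [List.pairwise_flatMap]
        constructor
        · intro i _
          rw [List.pairwise_map]
          refine List.Pairwise.imp ?_ List.pairwise_lt_range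
          intro j j' h
          change loc B N T _ _ _ < loc B N T _ _ _
          unfold loc
          omega
        · refine List.Pairwise.imp ?_ List.pairwise_lt_range
          intro i i' h o ho o' ho'
          simp only [List.mem_map, List.mem_range] at ho ho'
          obtain ⟨j, hj, rfl⟩ := ho
          obtain ⟨j', hj', rfl⟩ := ho'
          exact loc_lt (by omega) (by omega)
      · intro o ho o' ho'
        simp only [List.mem_flatMap, List.mem_map, List.mem_range, List.mem_singleton] at ho ho'
        obtain ⟨i, hi, j, hj, rfl⟩ := ho
        subst ho'
        exact loc_lt (row_lt (Nat.lt_succ_self _) (by omega)) (by omega)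
    · refine List.Pairwise.imp ?_ List.pairwise_lt_range
      intro x x' h o ho o' ho'
      simp only [countBlock, List.mem_append, List.mem_flatMap, List.mem_map, List.mem_range,
        List.mem_singleton] at ho ho'
      have h1 : o.2 0 ≤ loc B N T (x + 1) 0 1 := by
        rcases ho with ⟨i, hi, j, hj, rfl⟩ | rfl
        · exact (loc_lt (row_lt (Nat.lt_succ_self _) (by omega)) (by omega)).le
        · exact le_rfl
      refine lt_of_le_of_lt h1 ?_
      have h2 : (x + 1) * (N + 1) ≤ x' * (N + 1) := Nat.mul_le_mul_right _ h
      rcases ho' with ⟨i, hi, j, hj, rfl⟩ | rfl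
      · exact loc_lt (by omega) (by omega)
      · exact loc_lt (row_lt (by omega) (by omega)) (by omega)


theorem ctrl_lt {K : ℕ} (hoff : ∀ x < K, ∀ i < N, off x i < B) {o : RawCl}
    (ho : o ∈ countAll B N T off K) : ∀ i : Fin o.1.ctrls, o.2 i.succ < o.2 0 := by
  rcases mem_countAll.1 ho with rfl | ⟨x, hx, ⟨i, hi, j, hj, rfl⟩ | rfl⟩
  · exact fun i => i.elim0
  · have h1 : loc B N T x i (j + 1) < loc B N T x (i + 1) (j + 1) := loc_lt (by omega) (by omega)
    have h2 : loc B N T x i j < loc B N T x (i + 1) (j + 1) := loc_lt (by omega) (by omega)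
    have h3 : off x i < loc B N T x (i + 1) (j + 1) := (hoff x hx i hi).trans_le (le_loc _ _ _)
    change ∀ i' : Fin 3, (![loc B N T x (i + 1) (j + 1), loc B N T x i (j + 1), loc B N T x i j,
      off x i] : Fin 4 → ℕ) i'.succ < loc B N T x (i + 1) (j + 1)
    simp [Fin.forall_fin_succ, h1, h2, h3]
  · intro i
    exact loc_lt (row_lt (Nat.lt_succ_self _) (by omega)) (by omega)

theorem exec_countAll_of_lt {K q : ℕ} (hoff : ∀ x < K, ∀ i < N, off x i < B) (hq : q < B)
    (Y : ℕ → Bool) : RawCl.exec (countAll B N T off K) Y q = Y q := by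
  refine (RawCl.exec_spec _ (pairwise_countAll K) (fun o ho => ctrl_lt hoff ho) Y).1 q ?_
  intro o ho h
  have : B ≤ o.2 0 := by
    rcases mem_countAll.1 ho with rfl | ⟨x, hx, ⟨i, hi, j, hj, rfl⟩ | rfl⟩ <;>
      exact le_loc _ _ _
  omega

/-- Cell `(x, i, j + 1)` becomes one exactly if all inputs before `x` have passed and there are at
least `j` ones among the first `i` copies for `x`. A count of at least `j` after one more copy means
that it was so before, or that it was at least `j - 1` and the new bit is one. The last cell of a
block is the start bit of the next block, so failure propagates to the end. -/
theorem exec_countAll {K : ℕ} (hoff : ∀ x < K, ∀ i < N, off x i < B) (Y : ℕ → Bool)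
    (hY : ∀ q, B ≤ q → Y q = false) :
    RawCl.exec (countAll B N T off K) Y (loc B N T K 0 1) = true ↔
      ∀ x < K, T ≤ ((Finset.range N).filter fun i => Y (off x i) = true).card := by
  obtain ⟨h1, h2⟩ := RawCl.exec_spec _ (pairwise_countAll (N := N) (T := T) K)
    (fun o ho => ctrl_lt hoff ho) Y
  have hlow := fun q (hq : q < B) => exec_countAll_of_lt (T := T) hoff hq Y
  set Y' := RawCl.exec (countAll B N T off K) Y with hY'
  have h0 : ∀ x i j, Y (loc B N T x i j) = false := fun x i j => hY _ (le_loc _ _ _)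
  -- Column `0` is never a target. Its zeros make column `1`, which belongs to `j = 0`, a mere
  -- repetition of the start bit.
  have hcol : ∀ x ≤ K, ∀ i < N + 1, Y' (loc B N T x i 0) = false := by
    intro x _ i hi
    rw [h1, h0]
    intro o ho h
    rcases mem_countAll.1 ho with rfl | ⟨x', hx', ⟨i', hi', j, hj, rfl⟩ | rfl⟩
    · have := (loc_inj h (by omega) (by omega) (by omega) hi).2.2; omega
    · have := (loc_inj h (by omega) (by omega) (by omega) hi).2.2; omega
    · have := (loc_inj h (by omega) (by omega) (by omega) hi).2.2; omega
  -- Before any copy has been read, no positive count is reached.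
  have hrow : ∀ x < K, ∀ j < T, Y' (loc B N T x 0 (j + 2)) = false := by
    intro x _ j hj
    rw [h1, h0]
    intro o ho h
    rcases mem_countAll.1 ho with rfl | ⟨x', hx', ⟨i', hi', j', hj', rfl⟩ | rfl⟩
    · have := (loc_inj h (by omega) (by omega) (by omega) (by omega)).2.2; omega
    · have := (loc_inj h (by omega) (by omega) (by omega) (by omega)).2.1; omega
    · have := (loc_inj h (by omega) (by omega) (by omega) (by omega)).2.2; omega
  have hstart : Y' (loc B N T 0 0 1) = true := by
    have := h2 _ (mem_countAll.2 (Or.inl rfl))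
    rw [show (notAt (loc B N T 0 0 1)).2 0 = loc B N T 0 0 1 from rfl, h0] at this
    rw [this]
    rfl
  have hcopy : ∀ x < K, Y' (loc B N T (x + 1) 0 1) = Y' (loc B N T x N (T + 1)) := by
    intro x hx
    have := h2 _ (mem_countAll.2 (Or.inr ⟨x, hx, Or.inr rfl⟩))
    rw [show (copyAt (loc B N T (x + 1) 0 1) (loc B N T x N (T + 1))).2 0 =
      loc B N T (x + 1) 0 1 from rfl, h0] at this
    rw [this, Bool.false_xor]
    rfl
  have hstep : ∀ x < K, ∀ i < N, ∀ j < T + 1, Y' (loc B N T x (i + 1) (j + 1)) =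
      (Y' (loc B N T x i (j + 1)) || (Y' (loc B N T x i j) && Y (off x i))) := by
    intro x hx i hi j hj
    have := h2 _ (mem_countAll.2 (Or.inr ⟨x, hx, Or.inl ⟨i, hi, j, hj, rfl⟩⟩))
    rw [show (stepAt (loc B N T x (i + 1) (j + 1)) (loc B N T x i (j + 1)) (loc B N T x i j)
      (off x i)).2 0 = loc B N T x (i + 1) (j + 1) from rfl, h0] at this
    rw [this, Bool.false_xor, ← hlow _ (hoff x hx i hi)]
    rfl
  have hcount : ∀ x < K, ∀ i ≤ N, ∀ j < T + 1, Y' (loc B N T x i (j + 1)) = true ↔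
      Y' (loc B N T x 0 1) = true ∧
        j ≤ ((Finset.range i).filter fun i => Y (off x i) = true).card := by
    intro x hx i
    induction i with
    | zero =>
      intro _ j hj
      cases j with
      | zero => simp
      | succ j => simp [hrow x hx j (by omega)]
    | succ i ih =>
      intro hi j hj
      rw [hstep x hx i (by omega) j hj, Bool.or_eq_true, Bool.and_eq_true, ih (by omega) j hj,
        Finset.range_add_one, Finset.filter_insert]
      -- For `j = 0` the cell to the left is a padding zero, whence the condition `j ≠ 0`.
      have hj' : Y' (loc B N T x i j) = true ∧ Y (off x i) = true ↔
          (Y' (loc B N T x 0 1) = true ∧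
            j ≤ ((Finset.range i).filter fun i => Y (off x i) = true).card + 1) ∧
          Y (off x i) = true ∧ j ≠ 0 := by
        cases j with
        | zero => simp [hcol x hx.le i (by omega)]
        | succ j => rw [ih (by omega) j (by omega)]; simp [and_assoc]
      rw [hj']
      by_cases ho : Y (off x i) = true
      · rw [if_pos ho, Finset.card_insert_of_notMem (by simp)]
        constructor
        · rintro (⟨h, h'⟩ | ⟨⟨h, h'⟩, -⟩)
          · exact ⟨h, by omega⟩
          · exact ⟨h, h'⟩
        · rintro ⟨h, h'⟩
          by_cases hj0 : j = 0
          · exact Or.inl ⟨h, by omega⟩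
          · exact Or.inr ⟨⟨h, h'⟩, ho, hj0⟩
      · rw [if_neg ho]
        simp [ho]
  have hpass : ∀ x ≤ K, Y' (loc B N T x 0 1) = true ↔
      ∀ x' < x, T ≤ ((Finset.range N).filter fun i => Y (off x' i) = true).card := by
    intro x
    induction x with
    | zero => simp [hstart]
    | succ x ih =>
      intro hx
      rw [hcopy x (by omega), hcount x (by omega) N le_rfl T (by omega), ih (by omega)]
      constructor
      · rintro ⟨h, h'⟩ x' hx'
        rcases Nat.lt_succ_iff_lt_or_eq.1 hx' with hx' | rfl
        · exact h x' hx'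
        · exact h'
      · exact fun h => ⟨fun x' hx' => h x' (by omega), h x (by omega)⟩
  exact hpass K le_rfl

end Threshold

end MinQCircuit

end

noncomputable section

namespace MinQCircuit

/-! ### Repeated trials in a circuit -/

section Repetition

variable (K N T m : ℕ)

/-- The first position of the `i`-th copy of the circuit for the input `x`. -/
def offset (x i : ℕ) : ℕ := 1 + (x * N + i) * m

/-- The number of qubits in front of the counters. -/
def base : ℕ := 1 + K * N * m

/-- The number of qubits of the verifier. -/
def width : ℕ := base K N m + (K + 1) * (N + 1) * (T + 2)

variable {K N m} in
theorem offset_add_lt {x i q : ℕ} (hx : x < K) (hi : i < N) (hq : q < m) :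
    offset N m x i + q < base K N m := by
  have h1 : x * N + i + 1 ≤ K * N := by
    have := Nat.mul_le_mul_right N (Nat.succ_le_of_lt hx)
    rw [Nat.succ_mul] at this
    omega
  have h2 := Nat.mul_le_mul_right m h1
  rw [Nat.succ_mul] at h2
  unfold offset base
  omega

/-- The positions of the qubits of the copies. -/
def copyPos : (Fin K × Fin N) × Fin m ↪ Fin (width K N T m) :=
  ⟨fun c => ⟨offset N m c.1.1 c.1.2 + c.2,
      (offset_add_lt c.1.1.2 c.1.2.2 c.2.2).trans_le (Nat.le_add_right _ _)⟩, by
    rintro ⟨⟨x, i⟩, q⟩ ⟨⟨x', i'⟩, q'⟩ h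
    have h := Fin.val_eq_of_eq h
    simp only [offset] at h
    have h1 : (x : ℕ) * N + i = x' * N + i' := by
      have e1 : (((x : ℕ) * N + i) * m + q) / m = x * N + i := by
        rw [mul_comm, Nat.mul_add_div (Nat.zero_lt_of_lt q.2), Nat.div_eq_of_lt q.2, add_zero]
      have e2 : (((x' : ℕ) * N + i') * m + q') / m = x' * N + i' := by
        rw [mul_comm, Nat.mul_add_div (Nat.zero_lt_of_lt q.2), Nat.div_eq_of_lt q'.2, add_zero]
      rw [← e1, ← e2]
      congr 1
      omega
    have h2 : (x : ℕ) = x' := by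
      have e1 : ((x : ℕ) * N + i) / N = x := by
        rw [mul_comm, Nat.mul_add_div (Nat.zero_lt_of_lt i.2), Nat.div_eq_of_lt i.2, add_zero]
      have e2 : ((x' : ℕ) * N + i') / N = x' := by
        rw [mul_comm, Nat.mul_add_div (Nat.zero_lt_of_lt i.2), Nat.div_eq_of_lt i'.2, add_zero]
      rw [← e1, ← e2, h1]
    have h3 : (i : ℕ) = i' := by rw [h2] at h1; omega
    have h4 : (q : ℕ) = q' := by rw [h1] at h; omega
    simp [Fin.ext_iff, h2, h3, h4]⟩

/-- The gates that write to the first bit whether for all `x < K` there are at least `T` copies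
with a one at their first position. -/
def threshold : List RawCl :=
  countAll (base K N m) N T (offset N m) K ++ [copyAt 0 (loc (base K N m) N T K 0 1)]

variable {K N T m}

theorem loc_lt_width {x i j : ℕ} (hx : x ≤ K) (hi : i ≤ N) (hj : j < T + 2) :
    loc (base K N m) N T x i j < width K N T m := by
  have h1 : x * (N + 1) + i + 1 ≤ (K + 1) * (N + 1) := by
    have := Nat.mul_le_mul_right (N + 1) hx
    rw [Nat.succ_mul]
    omega
  have h2 := Nat.mul_le_mul_right (T + 2) h1
  rw [Nat.succ_mul] at h2
  unfold loc width
  omega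

/-- The positions of a counter gate are distinct because they are ordered: the bit of the copy, the
two cells of the old row, the target. The two positions of a copy gate are ordered as well. -/
theorem valid_threshold (hm : 0 < m) {o : RawCl} (ho : o ∈ threshold K N T m) :
    o.Valid (width K N T m) := by
  have hoff : ∀ x < K, ∀ i < N, offset N m x i < base K N m := fun x hx i hi =>
    offset_add_lt hx hi hm
  have hb : base K N m ≤ width K N T m := Nat.le_add_right _ _
  rcases List.mem_append.1 ho with ho | ho
  · rcases mem_countAll.1 ho with rfl | ⟨x, hx, ⟨i, hi, j, hj, rfl⟩ | rfl⟩
    · refine ⟨fun i j _ => Subsingleton.elim (α := Fin 1) i j, fun _ => ?_⟩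
      exact loc_lt_width (Nat.zero_le _) (Nat.zero_le _) (by omega)
    · have l1 : loc (base K N m) N T x i (j + 1) < loc (base K N m) N T x (i + 1) (j + 1) :=
        loc_lt (by omega) (by omega)
      have l2 : loc (base K N m) N T x i j < loc (base K N m) N T x i (j + 1) := by
        unfold loc; omega
      have l3 : offset N m x i < loc (base K N m) N T x i j := (hoff x hx i hi).trans_le (le_loc _ _ _)
      have l4 : loc (base K N m) N T x (i + 1) (j + 1) < width K N T m :=
        loc_lt_width hx.le hi (by omega)
      constructor
      · change Function.Injective (![loc (base K N m) N T x (i + 1) (j + 1),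
          loc (base K N m) N T x i (j + 1), loc (base K N m) N T x i j, offset N m x i] : Fin 4 → ℕ)
        intro a b
        fin_cases a <;> fin_cases b <;> simp <;> omega
      · change ∀ a, (![loc (base K N m) N T x (i + 1) (j + 1),
          loc (base K N m) N T x i (j + 1), loc (base K N m) N T x i j,
          offset N m x i] : Fin 4 → ℕ) a < width K N T m
        simp only [Fin.forall_fin_succ, Fin.succ_zero_eq_one, Fin.succ_one_eq_two]
        simp
        omega
    · have l1 : loc (base K N m) N T x N (T + 1) < loc (base K N m) N T (x + 1) 0 1 :=
        loc_lt (row_lt (Nat.lt_succ_self _) (by omega)) (by omega)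
      have l2 : loc (base K N m) N T (x + 1) 0 1 < width K N T m :=
        loc_lt_width hx (Nat.zero_le _) (by omega)
      constructor
      · change Function.Injective (Fin.cons (loc (base K N m) N T (x + 1) 0 1)
          (fun _ => loc (base K N m) N T x N (T + 1)) : Fin 2 → ℕ)
        intro a b
        fin_cases a <;> fin_cases b <;> simp <;> omega
      · change ∀ a, (Fin.cons (loc (base K N m) N T (x + 1) 0 1)
          (fun _ => loc (base K N m) N T x N (T + 1)) : Fin 2 → ℕ) a < width K N T m
        simp only [Fin.forall_fin_succ]
        simp
        omega
  · rw [List.mem_singleton] at ho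
    subst ho
    have l1 : base K N m ≤ loc (base K N m) N T K 0 1 := le_loc _ _ _
    have l2 : loc (base K N m) N T K 0 1 < width K N T m :=
      loc_lt_width le_rfl (Nat.zero_le _) (by omega)
    have l3 : 0 < base K N m := by unfold base; omega
    constructor
    · change Function.Injective (Fin.cons 0
        (fun _ => loc (base K N m) N T K 0 1) : Fin 2 → ℕ)
      intro a b
      fin_cases a <;> fin_cases b <;> simp <;> omega
    · change ∀ a, (Fin.cons 0
        (fun _ => loc (base K N m) N T K 0 1) : Fin 2 → ℕ) a < width K N T m
      simp only [Fin.forall_fin_succ]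
      simp
      omega

/-- Position `0` belongs to no copy and to no counter and starts as zero, so the last copy gate
writes the verdict there. -/
theorem exec_threshold (hm : 0 < m) (z : Fin K × Fin N → Fin m → Bool) :
    (∃ h : 0 < width K N T m, ClOp.exec (RawCl.toOps _ (threshold K N T m))
      (Function.extend (copyPos K N T m) (fun x => z x.1 x.2) fun _ => false) ⟨0, h⟩ = true) ↔
    ∀ x : Fin K, T ≤ (Finset.univ.filter fun i : Fin N => z (x, i) ⟨0, hm⟩ = true).card := by
  have hoff : ∀ x < K, ∀ i < N, offset N m x i < base K N m := fun x hx i hi =>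
    offset_add_lt hx hi hm
  have hw : 0 < width K N T m := by unfold width base; omega
  set y : Fin (width K N T m) → Bool :=
    Function.extend (copyPos K N T m) (fun x => z x.1 x.2) fun _ => false with hy
  have hout : ∀ q : Fin (width K N T m), ((q : ℕ) = 0 ∨ base K N m ≤ q) → y q = false := by
    intro q hq
    refine Function.extend_apply' _ _ _ ?_
    rintro ⟨⟨⟨x, i⟩, q'⟩, rfl⟩
    have h1 := offset_add_lt (m := m) x.2 i.2 q'.2
    have h2 : 0 < offset N m x i := by unfold offset; omega
    have h3 : (copyPos K N T m ((x, i), q') : ℕ) = offset N m x i + q' := rfl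
    rw [h3] at hq
    omega
  have hin : ∀ (x : Fin K) (i : Fin N), RawCl.ext y (offset N m x i) = z (x, i) ⟨0, hm⟩ := by
    intro x i
    have h1 : y (copyPos K N T m ((x, i), ⟨0, hm⟩)) = z (x, i) ⟨0, hm⟩ :=
      (copyPos K N T m).injective.extend_apply _ _ _
    rw [← h1]
    exact RawCl.ext_val y (copyPos K N T m ((x, i), ⟨0, hm⟩))
  have hY : ∀ q, base K N m ≤ q → RawCl.ext y q = false := by
    intro q hq
    unfold RawCl.ext
    split_ifs with h
    · exact hout ⟨q, h⟩ (Or.inr hq)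
    · rfl
  have hY0 : RawCl.ext y 0 = false := by
    rw [RawCl.ext, dif_pos hw]
    exact hout _ (Or.inl rfl)
  have key : ClOp.exec (RawCl.toOps _ (threshold K N T m)) y ⟨0, hw⟩ =
      RawCl.exec (countAll (base K N m) N T (offset N m) K) (RawCl.ext y)
        (loc (base K N m) N T K 0 1) := by
    refine (RawCl.ext_val _ ⟨0, hw⟩).symm.trans ?_
    rw [RawCl.ext_exec _ (fun o ho => valid_threshold hm ho), threshold,
      RawCl.exec, List.foldl_append, List.foldl_cons, List.foldl_nil, RawCl.act]
    rw [show ((⟨0, hw⟩ : Fin (width K N T m)) : ℕ) =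
      (copyAt 0 (loc (base K N m) N T K 0 1)).2 0 from rfl, Function.update_self, ← RawCl.exec]
    rw [show (copyAt 0 (loc (base K N m) N T K 0 1)).2 0 = 0 from rfl,
      exec_countAll_of_lt hoff (by unfold base; omega), hY0, Bool.false_xor]
    rfl
  rw [exists_prop_of_true hw, key, exec_countAll hoff _ hY]
  have hcard : ∀ x : Fin K,
      ((Finset.range N).filter fun i => RawCl.ext y (offset N m x i) = true).card =
      (Finset.univ.filter fun i : Fin N => z (x, i) ⟨0, hm⟩ = true).card := by
    intro x
    rw [Finset.card_filter, Finset.card_filter, Finset.sum_range]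
    simp only [hin]
  exact ⟨fun h x => hcard x ▸ h x x.2, fun h x hx => (hcard ⟨x, hx⟩).symm ▸ h ⟨x, hx⟩⟩

variable (T) in
/-- The circuits `Cs`, in parallel, and the test whether for all `x` at least `T` of the circuits
`Cs (x, i)` have the result one. -/
def repetition {G : GateSet} (Cs : Fin K × Fin N → (verifierGates G).Circuit m) :
    (verifierGates G).Circuit (width K N T m) :=
  ((List.finRange K ×ˢ List.finRange N).flatMap fun c =>
    (Cs c).map (liftOp (copyPos K N T m) c)) ++
  (RawCl.toOps _ (threshold K N T m)).map (ClOp.toOp G)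

variable {G : GateSet} (Cs : Fin K × Fin N → (verifierGates G).Circuit m)

open scoped Classical in
-- The copies leave a product state, and the threshold circuit is classical. Acceptance is therefore
-- an event about independent measurement results.
theorem acceptProb_repetition (hm : 0 < m) :
    acceptProb (V := verifierGates G) ⟨_, repetition T Cs⟩ =
      ∑ z : Fin K × Fin N → Fin m → Bool,
        (if ∀ x : Fin K, T ≤ (Finset.univ.filter fun i : Fin N => z (x, i) ⟨0, hm⟩ = true).card
          then (1 : ℝ) else 0) *
        ∏ c, ‖GateSet.run (Cs c) (basisState fun _ => false) (z c)‖ ^ 2 := by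
  have hn : (List.finRange K ×ˢ List.finRange N).Nodup :=
    (List.nodup_finRange K).product (List.nodup_finRange N)
  unfold acceptProb repetition
  simp only
  rw [run_append, ← prodState_zero (copyPos K N T m), run_copies _ _ _ hn,
    ClOp.firstQubitProb_run]
  simp only [if_true,
    show ∀ c : Fin K × Fin N, (c ∈ List.finRange K ×ˢ List.finRange N) = True from fun c => by
      obtain ⟨a, b⟩ := c; simp]
  have := sum_prodState (copyPos K N T m)
    (fun c => GateSet.run (Cs c) (basisState fun _ => false))
    fun y => if ∃ h : 0 < width K N T m, ClOp.exec (RawCl.toOps _ (threshold K N T m)) y ⟨0, h⟩ =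
      true then 1 else 0
  simp only [exec_threshold hm, ite_mul, one_mul, zero_mul] at this ⊢
  rw [← this]

/-- The probability that a copy has the result one. -/
def success (c : Fin K × Fin N) : ℝ :=
  firstQubitProb (GateSet.run (Cs c) (basisState fun _ => false)) true

variable {Cs}

open scoped Classical in
-- Chebyshev's inequality for the `N` trials of a single input `x`; the trials for other inputs do
-- not enter the deviation.
theorem sum_prod_le (hm : 0 < m) (x : Fin K) {δ : ℝ} (hδ : 0 < δ)
    (Q : (Fin K × Fin N → Fin m → Bool) → Prop)
    (hQ : ∀ z, Q z → δ ≤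
      |((Finset.univ.filter fun i : Fin N => z (x, i) ⟨0, hm⟩ = true).card : ℝ) -
        ∑ i, success Cs (x, i)|) :
    ∑ z : Fin K × Fin N → Fin m → Bool, (if Q z then (1 : ℝ) else 0) *
      ∏ c, ‖GateSet.run (Cs c) (basisState fun _ => false) (z c)‖ ^ 2 ≤ N / (4 * δ ^ 2) := by
  have hcard : (Finset.univ.map (Function.Embedding.sectR x (Fin N))).card = N := by simp
  have := chebyshev (C := Fin K × Fin N) (Y := Fin m → Bool)
    (w := fun c y => ‖GateSet.run (Cs c) (basisState fun _ => false) y‖ ^ 2)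
    (fun _ _ => by positivity) (fun c => (normSq_run _ _).trans (normSq_basisState _))
    (fun y => y ⟨0, hm⟩ = true) (Finset.univ.map (Function.Embedding.sectR x (Fin N))) Q hδ ?_
  · rwa [hcard] at this
  · intro z hz
    convert hQ z hz using 2
    rw [Finset.sum_map, Finset.card_filter, Finset.sum_sub_distrib]
    push_cast
    refine congrArg₂ (· - ·) (Finset.sum_congr rfl fun i _ => by congr) ?_
    refine Finset.sum_congr rfl fun i _ => ?_
    unfold success firstQubitProb
    refine Finset.sum_congr rfl fun y _ => ?_
    simp only [exists_prop_of_true hm, Function.Embedding.sectR_apply]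

/-- Rejection requires an input with fewer than `T` successes, hence a deviation of at least `δ`
there. The union bound over the inputs contributes the factor `K`. -/
theorem le_acceptProb_repetition (hm : 0 < m) {a δ : ℝ} (hδ : 0 < δ)
    (ha : ∀ c, a ≤ success Cs c) (hT : T + δ ≤ N * a) :
    1 - K * (N / (4 * δ ^ 2)) ≤ acceptProb (V := verifierGates G) ⟨_, repetition T Cs⟩ := by
  classical
  have h1 : ∑ z : Fin K × Fin N → Fin m → Bool,
      ∏ c, ‖GateSet.run (Cs c) (basisState fun _ => false) (z c)‖ ^ 2 = 1 :=
    sum_weights fun c => (normSq_run (Cs c) _).trans (normSq_basisState _)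
  have h2 := fun x : Fin K => sum_prod_le (Cs := Cs) hm x hδ
    (fun z => (Finset.univ.filter fun i : Fin N => z (x, i) ⟨0, hm⟩ = true).card < T) (by
      intro z hz
      have e : N * a ≤ ∑ i, success Cs (x, i) := by
        have := Finset.sum_le_sum fun i (_ : i ∈ (Finset.univ : Finset (Fin N))) => ha (x, i)
        simpa using this
      have hz' : ((Finset.univ.filter fun i : Fin N => z (x, i) ⟨0, hm⟩ = true).card : ℝ) ≤ T := by
        exact_mod_cast hz.le
      rw [abs_sub_comm]
      refine le_trans ?_ (le_abs_self _)
      linarith)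
  have h3 := Finset.sum_le_sum fun x (_ : x ∈ (Finset.univ : Finset (Fin K))) => h2 x
  rw [Finset.sum_comm] at h3
  simp only [Finset.sum_const, Finset.card_univ, Fintype.card_fin, nsmul_eq_mul] at h3
  rw [acceptProb_repetition Cs hm, sub_le_comm, ← h1, ← Finset.sum_sub_distrib]
  refine le_trans (Finset.sum_le_sum fun z _ => ?_) h3
  rw [← Finset.sum_mul]
  have hw : 0 ≤ ∏ c, ‖GateSet.run (Cs c) (basisState fun _ => false) (z c)‖ ^ 2 :=
    Finset.prod_nonneg fun _ _ => by positivity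
  split_ifs with h
  · rw [h1, one_mul, sub_self]
    exact mul_nonneg (Finset.sum_nonneg fun _ _ => by positivity) hw
  · rw [zero_mul, sub_zero]
    refine le_mul_of_one_le_left hw ?_
    push Not at h
    obtain ⟨x, hx⟩ := h
    have := Finset.single_le_sum (f := fun x : Fin K =>
      if (Finset.univ.filter fun i : Fin N => z (x, i) ⟨0, hm⟩ = true).card < T
        then (1 : ℝ) else 0) (fun _ _ => by positivity) (Finset.mem_univ x)
    rw [if_pos hx] at this
    convert this

/-- A single bad input is enough: acceptance forces at least `T` successes for it, a deviation of at
least `δ`. -/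
theorem acceptProb_repetition_le (hm : 0 < m) {b δ : ℝ} (hδ : 0 < δ) (x : Fin K)
    (hb : ∀ i, success Cs (x, i) ≤ b) (hT : N * b + δ ≤ T) :
    acceptProb (V := verifierGates G) ⟨_, repetition T Cs⟩ ≤ N / (4 * δ ^ 2) := by
  classical
  rw [acceptProb_repetition Cs hm]
  refine le_trans (le_of_eq ?_) (sum_prod_le (Cs := Cs) hm x hδ (fun z => ∀ x : Fin K,
    T ≤ (Finset.univ.filter fun i : Fin N => z (x, i) ⟨0, hm⟩ = true).card) fun z hz => ?_)
  · exact Finset.sum_congr rfl fun z _ => by congr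
  have e : ∑ i, success Cs (x, i) ≤ N * b := by
    have := Finset.sum_le_sum fun i (_ : i ∈ (Finset.univ : Finset (Fin N))) => hb i
    simpa using this
  have hz' : (T : ℝ) ≤ (Finset.univ.filter fun i : Fin N => z (x, i) ⟨0, hm⟩ = true).card := by
    exact_mod_cast hz x
  refine le_trans ?_ (le_abs_self _)
  linarith

end Repetition

end MinQCircuit

end

noncomputable section

namespace MinQCircuit

/-! ### The circuit for one input -/

/-- A gate with the indices of its qubits. -/
abbrev RawOp (G : GateSet) : Type := Σ g : G.ι, Fin (G.arity g) → ℕ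

open scoped Classical in
/-- The gate application on `m` qubits, if the indices are distinct and less than `m`. -/
def RawOp.ops {G : GateSet} (m : ℕ) (o : RawOp G) : List (G.Op m) :=
  if h : Function.Injective o.2 ∧ ∀ i, o.2 i < m then
    [⟨o.1, fun i => ⟨o.2 i, h.2 i⟩, fun _ _ e => h.1 (congrArg Fin.val e)⟩] else []

theorem RawOp.length_ops_le {G : GateSet} (m : ℕ) (o : RawOp G) : (o.ops m).length ≤ 1 := by
  unfold RawOp.ops
  split_ifs <;> simp

theorem RawOp.ops_val {G : GateSet} {m : ℕ} (o : G.Op m) :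
    RawOp.ops m ⟨o.1, fun i => (o.2 i : ℕ)⟩ = [o] := by
  unfold RawOp.ops
  rw [dif_pos ⟨fun _ _ e => o.2.injective (Fin.val_injective e), fun i => (o.2 i).2⟩]
  rfl

/-- A gate application of `G` as a gate application of the verifier. -/
def inlOp {G : GateSet} {m : ℕ} (o : G.Op m) : (verifierGates G).Op m := ⟨.inl o.1, o.2⟩

theorem run_map_inlOp {G : GateSet} {m : ℕ} (C : G.Circuit m) (ψ : QState m) :
    GateSet.run (C.map inlOp) ψ = GateSet.run C ψ := by
  induction C generalizing ψ with
  | nil => rfl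
  | cons o C ih => exact ih _

/-- The gates that write the number `x`. -/
def prepare (n x : ℕ) : List RawCl := ((List.range n).filter fun b => x.testBit b).map notAt

/-- The gates that invert the first bit if `b` is false. -/
def flip (b : Bool) : List RawCl := if b then [] else [notAt 0]

/-- The circuit that prepares the input `x`, applies `C`, and compares the first qubit with `b`. -/
def trial {G : GateSet} {m : ℕ} (n x : ℕ) (b : Bool) (C : G.Circuit m) :
    (verifierGates G).Circuit m :=
  (RawCl.toOps m (prepare n x)).map (ClOp.toOp G) ++ C.map inlOp ++
    (RawCl.toOps m (flip b)).map (ClOp.toOp G)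

theorem valid_notAt {m q : ℕ} (h : q < m) : (notAt q).Valid m :=
  ⟨fun i j _ => Subsingleton.elim (α := Fin 1) i j, fun _ => h⟩

theorem valid_prepare {m n x : ℕ} (h : n ≤ m) {o : RawCl} (ho : o ∈ prepare n x) : o.Valid m := by
  simp only [prepare, List.mem_map, List.mem_filter, List.mem_range] at ho
  obtain ⟨q, ⟨hq, -⟩, rfl⟩ := ho
  exact valid_notAt (by omega)

theorem valid_flip {m : ℕ} (h : 0 < m) {b : Bool} {o : RawCl} (ho : o ∈ flip b) : o.Valid m := by
  unfold flip at ho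
  split_ifs at ho
  · simp at ho
  · rw [List.mem_singleton] at ho
    subst ho
    exact valid_notAt h

theorem exec_prepare (n t x : ℕ) :
    ClOp.exec (RawCl.toOps (n + t) (prepare n x)) (fun _ => false) =
      Fin.append (fun j => x.testBit j) fun _ => false := by
  have e0 : RawCl.ext (fun _ : Fin (n + t) => false) = fun _ => false := by
    funext q; simp [RawCl.ext]
  obtain ⟨h1, h2⟩ := RawCl.exec_spec (prepare n x) (by
      rw [prepare, List.pairwise_map]
      exact (List.pairwise_lt_range.filter _).imp fun h => h) (by
      intro o ho
      simp only [prepare, List.mem_map] at ho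
      obtain ⟨q, -, rfl⟩ := ho
      exact fun i => i.elim0) fun _ => false
  funext q
  refine (RawCl.ext_val _ q).symm.trans ?_
  rw [RawCl.ext_exec _ (fun o ho => valid_prepare (Nat.le_add_right _ _) ho), e0]
  by_cases hq : (q : ℕ) < n ∧ x.testBit q = true
  · have hm : notAt q ∈ prepare n x := by
      simp only [prepare, List.mem_map, List.mem_filter, List.mem_range]
      exact ⟨q, hq, rfl⟩
    refine (h2 _ hm).trans ?_
    obtain ⟨q, hq'⟩ := q
    have : (⟨q, hq'⟩ : Fin (n + t)) = Fin.castAdd t ⟨q, hq.1⟩ := rfl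
    rw [this, Fin.append_left]
    exact hq.2.symm
  · rw [h1]
    · refine Fin.addCases (fun i hi => ?_) (fun i hi => ?_) q hq
      · rw [Fin.append_left]
        simpa using hi
      · rw [Fin.append_right]
    · intro o ho h
      simp only [prepare, List.mem_map, List.mem_filter, List.mem_range] at ho
      obtain ⟨q', hq', rfl⟩ := ho
      have : q' = q := h
      exact hq (this ▸ hq')

/-- Inversions turn the zero state into `|x, 0ᵗ⟩`, and the final inversion in the case `b = false`
turns the outcome `b` into a one. -/
theorem firstQubitProb_trial {G : GateSet} {n t : ℕ} (hn : 0 < n) (x : ℕ) (b : Bool)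
    (C : G.Circuit (n + t)) :
    firstQubitProb (GateSet.run (trial n x b C) (basisState fun _ => false)) true =
      firstQubitProb (GateSet.run C (inputState t fun j => x.testBit j)) b := by
  have hm : 0 < n + t := by omega
  rw [trial, run_append, run_append, ClOp.run_basisState, run_map_inlOp, ClOp.firstQubitProb_run,
    exec_prepare]
  have e : ∀ y : Fin (n + t) → Bool,
      (∃ h : 0 < n + t, ClOp.exec (RawCl.toOps (n + t) (flip b)) y ⟨0, h⟩ = true) ↔
        ∃ h : 0 < n + t, y ⟨0, h⟩ = b := by
    intro y
    rw [exists_prop_of_true hm, exists_prop_of_true hm,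
      ← RawCl.ext_val (ClOp.exec (RawCl.toOps (n + t) (flip b)) y) ⟨0, hm⟩,
      RawCl.ext_exec _ (fun o ho => valid_flip hm ho)]
    cases b
    · have : RawCl.exec (flip false) (RawCl.ext y) 0 = xor (RawCl.ext y 0) true := by
        simp [RawCl.exec, flip, RawCl.act, notAt, Cl.fn]
      change RawCl.exec (flip false) (RawCl.ext y) 0 = true ↔ _
      rw [this, ← RawCl.ext_val y ⟨0, hm⟩]
      simp
    · change RawCl.ext y ((⟨0, hm⟩ : Fin (n + t)) : ℕ) = true ↔ _
      rw [RawCl.ext_val]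
  simp only [e]
  rfl

/-! ### The number of repetitions -/

/-- The number of repetitions, for `K` inputs and thresholds with common denominator `D`. -/
def trials (K : ℕ) (a b : ℕ × ℕ) : ℕ := 32 * K * ((a.2 * b.2) * (a.2 * b.2))

/-- The required number of successes. -/
def quota (K : ℕ) (a b : ℕ × ℕ) : ℕ := 16 * K * (a.2 * b.2) * (a.1 * b.2 + b.1 * a.2)

/-- The midpoint of the approximations keeps a distance of at least `(α - β) / 4` from both
thresholds, and `α - β` is at least `2 / (3 * D)` for the product `D` of the denominators. With `32
* K * D ^ 2` trials this allows a deviation of `32 * K * D / 6`. -/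
theorem exists_deviation {K : ℕ} (hK : 0 < K) {a b : ℕ × ℕ} {α β : ℝ} (h : β < α)
    (ha0 : 0 < a.2) (hb0 : 0 < b.2) (ha : |(a.1 : ℝ) / a.2 - α| ≤ (α - β) / 4)
    (hb : |(b.1 : ℝ) / b.2 - β| ≤ (α - β) / 4) :
    ∃ δ : ℝ, 0 < δ ∧ quota K a b + δ ≤ trials K a b * α ∧ trials K a b * β + δ ≤ quota K a b ∧
      K * (trials K a b / (4 * δ ^ 2)) ≤ 1 / 3 := by
  obtain ⟨a1, a2⟩ := a
  obtain ⟨b1, b2⟩ := b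
  simp only at ha0 hb0 ha hb
  have ha2 : (0 : ℝ) < a2 := by exact_mod_cast ha0
  have hb2 : (0 : ℝ) < b2 := by exact_mod_cast hb0
  have hK' : (1 : ℝ) ≤ K := by exact_mod_cast hK
  set A : ℝ := a1 / a2 with hA
  set B : ℝ := b1 / b2 with hB
  set D : ℝ := a2 * b2 with hD
  have hD0 : 0 < D := mul_pos ha2 hb2
  obtain ⟨ha3, ha4⟩ := abs_le.1 ha
  obtain ⟨hb3, hb4⟩ := abs_le.1 hb
  have eA : (a1 : ℝ) = A * a2 := by rw [hA]; field_simp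
  have eB : (b1 : ℝ) = B * b2 := by rw [hB]; field_simp
  -- `A - B` is at least `(α - β) / 2`, hence positive, and `D * (A - B)` is an integer.
  have h1 : (1 : ℝ) ≤ D * (A - B) := by
    have e : D * (A - B) = a1 * b2 - b1 * a2 := by rw [eA, eB, hD]; ring
    have h0 : 0 < D * (A - B) := mul_pos hD0 (by linarith)
    rw [e] at h0 ⊢
    have h2 : b1 * a2 < a1 * b2 := by
      have : (b1 : ℝ) * a2 < a1 * b2 := by linarith
      exact_mod_cast this
    have h3 : (b1 : ℝ) * a2 + 1 ≤ a1 * b2 := by exact_mod_cast h2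
    linarith
  have h2 : 1 ≤ D * (3 * (α - β) / 2) := h1.trans (mul_le_mul_of_nonneg_left (by linarith) hD0.le)
  have eN : (trials K (a1, a2) (b1, b2) : ℝ) = 32 * K * D ^ 2 := by
    simp only [trials]; push_cast; rw [hD]; ring
  have eT : (quota K (a1, a2) (b1, b2) : ℝ) = 32 * K * D ^ 2 * ((A + B) / 2) := by
    simp only [quota]; push_cast; rw [eA, eB, hD]; ring
  have h3 : 32 * (K : ℝ) * D ^ 2 * ((α - β) / 4) ≥ 32 * K * D / 6 := by
    have : 32 * (K : ℝ) * D ^ 2 * ((α - β) / 4) = 32 * K * D / 6 * (D * (3 * (α - β) / 2)) := by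
      ring
    rw [this]
    exact le_mul_of_one_le_right (by positivity) h2
  have hND : 0 ≤ 32 * (K : ℝ) * D ^ 2 := by positivity
  -- By `h3` this is at most a quarter of the gap times the number of trials. The Chebyshev bound,
  -- multiplied by `K`, becomes `9 / 32`.
  refine ⟨32 * K * D / 6, by positivity, ?_, ?_, ?_⟩
  · rw [eN, eT]
    have : 32 * (K : ℝ) * D ^ 2 * ((α - β) / 4) ≤ 32 * (K : ℝ) * D ^ 2 * (α - (A + B) / 2) :=
      mul_le_mul_of_nonneg_left (by linarith) hND
    linarith
  · rw [eN, eT]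
    have : 32 * (K : ℝ) * D ^ 2 * ((α - β) / 4) ≤ 32 * (K : ℝ) * D ^ 2 * ((A + B) / 2 - β) :=
      mul_le_mul_of_nonneg_left (by linarith) hND
    linarith
  · rw [eN]
    have : (K : ℝ) * (32 * K * D ^ 2 / (4 * (32 * K * D / 6) ^ 2)) = 9 / 32 := by
      field_simp
      norm_num
    rw [this]
    norm_num

/-! ### The verification circuit -/

/-- The circuit that accepts if `C` computes the function with the truth table `F` in a sufficient
number of trials for every input. -/
def verification {G : GateSet} (a b : ℕ × ℕ) (n t : ℕ) (F : ℕ → Bool) (C : G.Circuit (n + t)) :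
    Σ M, (verifierGates G).Circuit M :=
  ⟨width (2 ^ n) (trials (2 ^ n) a b) (quota (2 ^ n) a b) (n + t),
    repetition _ fun c => trial n c.1 (F c.1) C⟩

section Verification

variable {G : GateSet} {n t : ℕ} {f : (Fin n → Bool) → Bool} {F : ℕ → Bool} {C : G.Circuit (n + t)}
  {a b : ℕ × ℕ} {α β : ℝ}

theorem le_acceptProb_verification (hn : 0 < n) (h : β < α)
    (ha0 : 0 < a.2) (hb0 : 0 < b.2) (ha : |(a.1 : ℝ) / a.2 - α| ≤ (α - β) / 4)
    (hb : |(b.1 : ℝ) / b.2 - β| ≤ (α - β) / 4)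
    (hF : ∀ x < 2 ^ n, F x = f fun j => x.testBit j)
    (hC : ∀ x, α ≤ firstQubitProb (GateSet.run C (inputState t x)) (f x)) :
    2 / 3 ≤ acceptProb (verification a b n t F C) := by
  obtain ⟨δ, hδ, h1, -, h3⟩ := exists_deviation (K := 2 ^ n) (by positivity) h ha0 hb0 ha hb
  refine le_trans (by linarith) (le_acceptProb_repetition (by omega) hδ (a := α) ?_ h1)
  intro c
  rw [success, firstQubitProb_trial hn, hF _ c.1.2]
  exact hC _

theorem acceptProb_verification_le (hn : 0 < n) (h : β < α)
    (ha0 : 0 < a.2) (hb0 : 0 < b.2) (ha : |(a.1 : ℝ) / a.2 - α| ≤ (α - β) / 4)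
    (hb : |(b.1 : ℝ) / b.2 - β| ≤ (α - β) / 4)
    (hF : ∀ x < 2 ^ n, F x = f fun j => x.testBit j)
    (hC : ∃ x, firstQubitProb (GateSet.run C (inputState t x)) (f x) ≤ β) :
    acceptProb (verification a b n t F C) ≤ 1 / 3 := by
  obtain ⟨δ, hδ, -, h2, h3⟩ := exists_deviation (K := 2 ^ n) (by positivity) h ha0 hb0 ha hb
  obtain ⟨x, hx⟩ := hC
  have hK : (1 : ℝ) ≤ ((2 ^ n : ℕ) : ℝ) := by exact_mod_cast Nat.one_le_two_pow
  refine le_trans (acceptProb_repetition_le (by omega) hδ (b := β)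
    ⟨Nat.ofBits x, Nat.ofBits_lt_two_pow x⟩ ?_ h2)
    ((le_mul_of_one_le_left (by positivity) hK).trans h3)
  intro i
  have e : (fun j : Fin n => (Nat.ofBits x).testBit j) = x := by
    funext j
    simp [Nat.testBit_ofBits_lt]
  rw [success, firstQubitProb_trial hn, hF _ (Nat.ofBits_lt_two_pow x), e]
  exact hx

end Verification

end MinQCircuit

end

noncomputable section

namespace MinQCircuit

/-! ### Reading an instance -/

/-- The number of leading ones. -/
def leading (l : List Bool) : ℕ := (l.takeWhile id).length

theorem leading_replicate_append (k : ℕ) (l : List Bool) :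
    leading (List.replicate k true ++ false :: l) = k := by
  simp [leading]

theorem drop_replicate_append (k : ℕ) (l : List Bool) :
    (List.replicate k true ++ false :: l).drop (k + 1) = l := by
  simp [List.drop_append]

theorem leading_eq {l : List Bool} {v : ℕ} (h : ∀ i < v, l[i]? = some true)
    (h' : l[v]? = some false) : leading l = v := by
  induction v generalizing l with
  | zero =>
    cases l with
    | nil => rfl
    | cons b l => simp_all [leading]
  | succ v ih =>
    cases l with
    | nil => simp at h'
    | cons b l =>
      have hb : b = true := by simpa using h 0 (Nat.succ_pos v)
      have := ih (l := l) (fun i hi => by simpa using h (i + 1) (by omega)) (by simpa using h')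
      simp_all [leading]

/-- The size parameter of an instance. -/
def sizeParam (u : List Bool) : ℕ := leading u

/-- What follows the size parameter. -/
def afterSize (u : List Bool) : List Bool := u.drop (sizeParam u + 1)

/-- The number of inputs of the Boolean function of an instance. -/
def inputs (u : List Bool) : ℕ := leading (afterSize u)

/-- What follows the number of inputs: the truth table and the ancilla parameter. -/
def table (u : List Bool) : List Bool := (afterSize u).drop (inputs u + 1)

/-- The string has room for a truth table. -/
def WellFormed (u : List Bool) : Prop := 1 ≤ inputs u ∧ 2 ^ inputs u ≤ (table u).length

/-- The ancilla parameter, truncated at the size parameter. -/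
def ancillas (u : List Bool) : ℕ :=
  min (∑ j ∈ Finset.range ((table u).drop (2 ^ inputs u)).length,
    if ((table u).drop (2 ^ inputs u))[j]? = some true then min (2 ^ j) (sizeParam u + 1) else 0)
    (sizeParam u)

theorem sum_bits (l : List Bool) : (∑ j ∈ Finset.range l.length,
    if l[j]? = some true then 2 ^ j else 0) = Nat.ofDigits 2 (l.map fun b => cond b 1 0) := by
  induction l with
  | nil => rfl
  | cons b l ih =>
    rw [List.length_cons, Finset.sum_range_succ', List.map_cons, Nat.ofDigits_cons, ← ih,
      Finset.mul_sum, add_comm]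
    congr 1
    · cases b <;> simp
    · refine Finset.sum_congr rfl fun j _ => ?_
      simp [pow_succ, mul_comm]

theorem sum_bits_eq (t : ℕ) :
    (∑ j ∈ Finset.range t.bits.length, if t.bits[j]? = some true then 2 ^ j else 0) = t := by
  rw [sum_bits, ← Nat.digits_two_eq_bits, Nat.ofDigits_digits]

section Instance

variable {n s t : ℕ} {f : (Fin n → Bool) → Bool}

theorem sizeParam_encodeInstance : sizeParam (encodeInstance f s t) = s :=
  leading_replicate_append _ _

theorem afterSize_encodeInstance : afterSize (encodeInstance f s t) =
    List.replicate n true ++ false :: (truthTable f ++ t.bits) := by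
  rw [afterSize, sizeParam_encodeInstance, encodeInstance, drop_replicate_append]

theorem inputs_encodeInstance : inputs (encodeInstance f s t) = n := by
  rw [inputs, afterSize_encodeInstance, leading_replicate_append]

theorem table_encodeInstance : table (encodeInstance f s t) = truthTable f ++ t.bits := by
  rw [table, afterSize_encodeInstance, inputs_encodeInstance, drop_replicate_append]

theorem length_truthTable : (truthTable f).length = 2 ^ n := by simp [truthTable]

theorem wellFormed_encodeInstance (hn : 1 ≤ n) : WellFormed (encodeInstance f s t) := by
  rw [WellFormed, inputs_encodeInstance, table_encodeInstance, List.length_append,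
    length_truthTable]
  exact ⟨hn, Nat.le_add_right _ _⟩

/-- A bit set in `t` contributes `2 ^ j ≤ t ≤ s`, so the truncation at `s + 1` is invisible here. It
keeps the unary evaluation polynomial on arbitrary strings. -/
theorem ancillas_encodeInstance (ht : t ≤ s) : ancillas (encodeInstance f s t) = t := by
  have e : (truthTable f ++ t.bits).drop (2 ^ n) = t.bits :=
    List.drop_left' length_truthTable
  rw [ancillas, inputs_encodeInstance, table_encodeInstance, sizeParam_encodeInstance, e]
  have key : (∑ j ∈ Finset.range t.bits.length,
      if t.bits[j]? = some true then min (2 ^ j) (s + 1) else 0) = t := by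
    conv_rhs => rw [← sum_bits_eq t]
    refine Finset.sum_congr rfl fun j hj => ?_
    split_ifs with h
    · have h1 := Finset.single_le_sum
        (f := fun j => if t.bits[j]? = some true then 2 ^ j else 0)
        (fun _ _ => Nat.zero_le _) hj
      rw [sum_bits_eq] at h1
      simp only [if_pos h] at h1
      exact min_eq_left (by omega)
    · rfl
  rw [key, min_eq_left ht]

theorem getElem?_table {x : ℕ} (hx : x < 2 ^ n) :
    (table (encodeInstance f s t))[x]? = some (f fun j => x.testBit j) := by
  rw [table_encodeInstance, List.getElem?_append_left (by rwa [length_truthTable])]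
  simp [truthTable, hx]

end Instance

/-! ### Reading a witness -/

/-- The numbers in a witness, which is divided into blocks of length `W`. -/
def field (W : ℕ) (w : List Bool) (j : ℕ) : ℕ := leading (w.drop (j * W))

/-- The witness with given numbers. -/
def fields (W : ℕ) (val : ℕ → ℕ) (L : ℕ) : List Bool :=
  List.ofFn fun q : Fin L => decide ((q : ℕ) % W < val (q / W))

/-- A block consists of `val j` ones and then at least one zero, because `val j < W`; the leading
ones give the number back. -/
theorem field_fields {W L : ℕ} {val : ℕ → ℕ} {j : ℕ} (hv : val j < W) (hj : (j + 1) * W ≤ L) :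
    field W (fields W val L) j = val j := by
  rw [Nat.succ_mul] at hj
  have key : ∀ i < W, ((fields W val L).drop (j * W))[i]? = some (decide (i < val j)) := by
    intro i hi
    have h1 : (j * W + i) % W = i := by
      rw [Nat.mul_add_mod_self_right, Nat.mod_eq_of_lt hi]
    have h2 : (j * W + i) / W = j := by
      rw [mul_comm, Nat.mul_add_div (by omega), Nat.div_eq_of_lt hi, add_zero]
    rw [List.getElem?_drop, fields, List.getElem?_ofFn, dif_pos (show j * W + i < L by omega)]
    simp only [h1, h2]
  refine leading_eq (fun i hi => ?_) ?_
  · rw [key i (by omega)]; simp [hi]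
  · rw [key _ hv]; simp

section Decode

variable (G : GateSet)

/-- A bound for the number of qubits of a gate. -/
def maxArity : ℕ := ∑ g, G.arity g

theorem arity_le_maxArity (g : G.ι) : G.arity g ≤ maxArity G :=
  Finset.single_le_sum (f := G.arity) (fun _ _ => Nat.zero_le _) (Finset.mem_univ g)

/-- The number of gates. -/
def numGates : ℕ := Fintype.card G.ι

/-- The gate with a number. -/
def gate : Fin (numGates G) ≃ G.ι := (Fintype.equivFin G.ι).symm

/-- The block length for instances of length `U`. -/
def blockLength (U : ℕ) : ℕ := U + numGates G + 1

/-- The `r`-th number of the `i`-th gate. -/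
def entry (U : ℕ) (w : List Bool) (i r : ℕ) : ℕ :=
  field (blockLength G U) w (i * (maxArity G + 1) + r)

/-- The `i`-th gate of a witness. -/
def slot (U : ℕ) (w : List Bool) (i : ℕ) : List (RawOp G) :=
  if h : entry G U w i 0 < numGates G then
    [⟨gate G ⟨_, h⟩, fun r => entry G U w i (r + 1)⟩] else []

/-- The circuit described by a witness. -/
def decode (U s m : ℕ) (w : List Bool) : G.Circuit m :=
  (List.range s).flatMap fun i => (slot G U w i).flatMap (RawOp.ops m)

/-- Malformed gates are skipped instead of rejected, so every witness yields a legal circuit and the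
condition on no instances applies to it. -/
theorem length_decode_le (U s m : ℕ) (w : List Bool) : (decode G U s m w).length ≤ s := by
  have : ∀ i, ((slot G U w i).flatMap (RawOp.ops m)).length ≤ 1 := by
    intro i
    unfold slot
    split_ifs
    · simpa using RawOp.length_ops_le m _
    · simp
  induction s with
  | zero => simp [decode]
  | succ s ih =>
    rw [decode, List.range_succ, List.flatMap_append, List.length_append, List.flatMap_singleton]
    exact Nat.add_le_add ih (this s)

/-- The length of the witnesses. -/
def witnessLength : Polynomial ℕ :=
  Polynomial.X * Polynomial.C (maxArity G + 1) *
    (Polynomial.X + Polynomial.C (numGates G + 1))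

theorem eval_witnessLength (U : ℕ) :
    (witnessLength G).eval U = U * (maxArity G + 1) * blockLength G U := by
  simp [witnessLength, blockLength, add_assoc]

theorem flatMap_range_getElem?_toList {B : Type} (l : List B) (s : ℕ) :
    ((List.range s).flatMap fun i => l[i]?.toList) = l.take s := by
  induction s with
  | zero => simp
  | succ s ih => rw [List.range_succ, List.flatMap_append, ih, List.take_add_one]; simp

/-- Gate numbers and qubit positions are smaller than the block length, so each fits into a block,
and `maxArity G + 1` blocks hold any one gate. -/
theorem exists_decode {U s m : ℕ} (hs : s ≤ U) (hm : m ≤ U) (C : G.Circuit m) (hC : C.length ≤ s) :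
    ∃ w : List Bool, w.length = (witnessLength G).eval U ∧ decode G U s m w = C := by
  -- Beyond the end of `C` the gate number is `numGates G`; it names no gate, so the slot decodes to
  -- nothing. Unused position fields are zero.
  let code : ℕ → ℕ → ℕ := fun i r => C[i]?.elim (numGates G) fun o =>
    if r = 0 then ((gate G).symm o.1 : ℕ) else if h : r - 1 < G.arity o.1 then o.2 ⟨r - 1, h⟩ else 0
  let val : ℕ → ℕ := fun j => code (j / (maxArity G + 1)) (j % (maxArity G + 1))
  refine ⟨fields (blockLength G U) val ((witnessLength G).eval U), by simp [fields], ?_⟩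
  have hcode : ∀ i r, code i r < blockLength G U := by
    intro i r
    simp only [code]
    cases C[i]? with
    | none => simp only [Option.elim_none, blockLength]; omega
    | some o =>
      simp only [Option.elim_some, blockLength]
      split_ifs with h1 h2
      · have := ((gate G).symm o.1).2; omega
      · have := (o.2 ⟨r - 1, h2⟩).2; omega
      · omega
  have hentry : ∀ i < s, ∀ r < maxArity G + 1,
      entry G U (fields (blockLength G U) val ((witnessLength G).eval U)) i r = code i r := by
    intro i hi r hr
    have e1 : (i * (maxArity G + 1) + r) / (maxArity G + 1) = i := by
      rw [mul_comm, Nat.mul_add_div (by omega), Nat.div_eq_of_lt hr, add_zero]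
    have e2 : (i * (maxArity G + 1) + r) % (maxArity G + 1) = r := by
      rw [Nat.mul_add_mod_self_right, Nat.mod_eq_of_lt hr]
    have e3 : val (i * (maxArity G + 1) + r) = code i r := by simp only [val, e1, e2]
    rw [entry, field_fields (by rw [e3]; exact hcode i r), e3]
    rw [eval_witnessLength]
    refine Nat.mul_le_mul_right _ ?_
    have := Nat.mul_le_mul_right (maxArity G + 1) (show i + 1 ≤ U by omega)
    rw [Nat.succ_mul] at this
    omega
  have hslot : ∀ i < s, (slot G U (fields (blockLength G U) val ((witnessLength G).eval U)) i).flatMap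
      (RawOp.ops m) = C[i]?.toList := by
    intro i hi
    have h0 := hentry i hi 0 (Nat.succ_pos _)
    cases hCi : C[i]? with
    | none =>
      have : code i 0 = numGates G := by simp only [code, hCi, Option.elim_none]
      rw [slot, dif_neg (by omega)]
      rfl
    | some o =>
      have h1 : code i 0 = (gate G).symm o.1 := by
        simp only [code, hCi, Option.elim_some, if_true]
      have h2 : entry G U (fields (blockLength G U) val ((witnessLength G).eval U)) i 0 <
          numGates G := by
        rw [h0, h1]; exact ((gate G).symm o.1).2
      have h3 : gate G ⟨_, h2⟩ = o.1 := by
        rw [← (gate G).apply_symm_apply o.1]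
        congr 1
        exact Fin.ext (h0.trans h1)
      rw [slot, dif_pos h2, List.flatMap_singleton, Option.toList_some, ← RawOp.ops_val o]
      congr 1
      obtain ⟨g, e⟩ := o
      subst h3
      congr 1
      funext r
      have hr : (r : ℕ) + 1 < maxArity G + 1 := by
        have := arity_le_maxArity G (gate G ⟨_, h2⟩)
        have := r.2
        omega
      rw [hentry i hi _ hr]
      simp [code, hCi]
  rw [decode, List.flatMap_congr fun i hi => hslot i (List.mem_range.1 hi),
    flatMap_range_getElem?_toList, List.take_of_length_le hC]

end Decode

/-! ### The verifier -/

open scoped Classical in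
/-- The verifier, for thresholds close to `a n` and `b n`. -/
def verifier (G : GateSet) (a b : ℕ → ℕ × ℕ) (q : List Bool × List Bool) :
    Σ M, (verifierGates G).Circuit M :=
  if WellFormed q.1 then
    verification (a (inputs q.1)) (b (inputs q.1)) (inputs q.1) (ancillas q.1)
      (fun x => decide ((table q.1)[x]? = some true))
      (decode G q.1.length (sizeParam q.1) (inputs q.1 + ancillas q.1) q.2)
  else ⟨0, []⟩

section Verifier

variable {G : GateSet} {n s t : ℕ} {f : (Fin n → Bool) → Bool} {a b : ℕ → ℕ × ℕ}

theorem verifier_encodeInstance (hn : 1 ≤ n) (ht : t ≤ s) (w : List Bool) :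
    verifier G a b (encodeInstance f s t, w) = verification (a n) (b n) n t
      (fun x => decide ((table (encodeInstance f s t))[x]? = some true))
      (decode G (encodeInstance f s t).length s (n + t) w) := by
  rw [verifier, if_pos (wellFormed_encodeInstance hn)]
  -- The type of the decoded circuit depends on the recovered parameters, so these are generalised
  -- before the equations are substituted.
  have : ∀ n' t' s', n' = n → t' = t → s' = s → verification (a n') (b n') n' t'
      (fun x => decide ((table (encodeInstance f s t))[x]? = some true))
      (decode G (encodeInstance f s t).length s' (n' + t') w) = verification (a n) (b n) n t
      (fun x => decide ((table (encodeInstance f s t))[x]? = some true))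
      (decode G (encodeInstance f s t).length s (n + t) w) := by
    rintro n' t' s' rfl rfl rfl; rfl
  exact this _ _ _ inputs_encodeInstance (ancillas_encodeInstance ht) sizeParam_encodeInstance

theorem decide_table {x : ℕ} (hx : x < 2 ^ n) :
    decide ((table (encodeInstance f s t))[x]? = some true) = f fun j => x.testBit j := by
  rw [getElem?_table hx]
  simp

variable {α β : ℕ → ℝ}

theorem verifier_complete (h : ∀ n, 1 ≤ n → β n < α n)
    (ha : ∀ n, 1 ≤ n → 0 < (a n).2 ∧ |((a n).1 : ℝ) / ((a n).2 : ℝ) - α n| ≤ (α n - β n) / 4)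
    (hb : ∀ n, 1 ≤ n → 0 < (b n).2 ∧ |((b n).1 : ℝ) / ((b n).2 : ℝ) - β n| ≤ (α n - β n) / 4)
    {u : List Bool} (hu : u ∈ (MQCSP G α β h).yes) : ∃ w : List Bool,
    w.length = (witnessLength G).eval u.length ∧ 2 / 3 ≤ acceptProb (verifier G a b (u, w)) := by
  obtain ⟨n, s, t, f, hn, ht, rfl, C, hC, hf⟩ := hu
  have hlen : s + n ≤ (encodeInstance f s t).length := by
    simp only [encodeInstance, List.length_append, List.length_replicate, List.length_cons]
    omega
  obtain ⟨w, hw, hd⟩ := exists_decode G (U := (encodeInstance f s t).length) (s := s) (by omega)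
    (by omega) C hC
  refine ⟨w, hw, ?_⟩
  rw [verifier_encodeInstance hn ht, hd]
  exact le_acceptProb_verification hn (h n hn) (ha n hn).1 (hb n hn).1 (ha n hn).2 (hb n hn).2
    (fun x hx => decide_table hx) hf

theorem verifier_sound (h : ∀ n, 1 ≤ n → β n < α n)
    (ha : ∀ n, 1 ≤ n → 0 < (a n).2 ∧ |((a n).1 : ℝ) / ((a n).2 : ℝ) - α n| ≤ (α n - β n) / 4)
    (hb : ∀ n, 1 ≤ n → 0 < (b n).2 ∧ |((b n).1 : ℝ) / ((b n).2 : ℝ) - β n| ≤ (α n - β n) / 4)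
    {u : List Bool} (hu : u ∈ (MQCSP G α β h).no) (w : List Bool) :
    acceptProb (verifier G a b (u, w)) ≤ 1 / 3 := by
  obtain ⟨n, s, t, f, hn, ht, rfl, hC⟩ := hu
  rw [verifier_encodeInstance hn ht]
  have hx := hC _ (length_decode_le G (encodeInstance f s t).length s (n + t) w)
  exact acceptProb_verification_le (f := f) hn (h n hn) (ha n hn).1 (hb n hn).1 (ha n hn).2 (hb n hn).2
    (fun x hx => decide_table hx) hx

end Verifier

end MinQCircuit

end

noncomputable section

namespace MinQCircuit

/-! ### The description of the verification circuit -/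

/-- The description of a gate application. -/
def describe (V : GateSet) (g : V.ι) (p : Fin (V.arity g) → ℕ) : List (V.ι ⊕ Bool) :=
  Sum.inl g :: (List.ofFn p).flatMap fun i => List.replicate i (Sum.inr true) ++ [Sum.inr false]

/-- Only the values of the positions enter, so descriptions can be shifted and computed with plain
numbers. -/
theorem encodeOp_eq {V : GateSet} {m : ℕ} (o : V.Op m) :
    V.encodeOp o = describe V o.1 fun i => (o.2 i : ℕ) := by
  rw [GateSet.encodeOp, describe]
  congr 1
  change List.flatMap _ ((List.ofFn o.2).flatMap fun a : Fin m => [(a : ℕ)]) = _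
  rw [List.flatMap_assoc, show (fun i => (o.2 i : ℕ)) = Fin.val ∘ o.2 from rfl, ← List.map_ofFn,
    List.flatMap_map]
  exact List.flatMap_congr fun i _ => List.flatMap_singleton _ _

section Descriptions

variable (G : GateSet) (off m : ℕ)

/-- The description of a classical gate, shifted by `off`. -/
def describeCl (o : RawCl) : List ((verifierGates G).ι ⊕ Bool) :=
  describe (verifierGates G) (.inr o.1) fun r => off + o.2 r

open scoped Classical in
/-- The description of a gate of `G`, shifted by `off`, if it is a gate on `m` qubits. -/
def describeOp (o : RawOp G) : List ((verifierGates G).ι ⊕ Bool) :=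
  if Function.Injective o.2 ∧ ∀ i, o.2 i < m then
    describe (verifierGates G) (.inl o.1) fun r => off + o.2 r else []

/-- The description of the circuit for the input `x`, shifted by `off`. -/
def describeTrial (n s U x : ℕ) (b : Bool) (w : List Bool) :
    List ((verifierGates G).ι ⊕ Bool) :=
  (prepare n x).flatMap (describeCl G off) ++
    ((List.range s).flatMap fun j => (slot G U w j).flatMap (describeOp G off m)) ++
    (flip b).flatMap (describeCl G off)

variable {G off m}

theorem flatMap_encodeOp_toOps {M : ℕ} (L : List RawCl) (hL : ∀ o ∈ L, o.Valid M)
    (φ : (verifierGates G).Op M → List ((verifierGates G).ι ⊕ Bool))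
    (hφ : ∀ o, φ o = describe (verifierGates G) o.1 fun i => off + (o.2 i : ℕ)) :
    ((RawCl.toOps M L).map (ClOp.toOp G)).flatMap φ = L.flatMap (describeCl G off) := by
  rw [RawCl.toOps, List.map_flatMap, List.flatMap_assoc]
  refine List.flatMap_congr fun o ho => ?_
  rw [dif_pos (hL o ho), List.map_singleton, List.flatMap_singleton, hφ]
  rfl

theorem flatMap_encodeOp_ops (o : RawOp G)
    (φ : (verifierGates G).Op m → List ((verifierGates G).ι ⊕ Bool))
    (hφ : ∀ o, φ o = describe (verifierGates G) o.1 fun i => off + (o.2 i : ℕ)) :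
    ((o.ops m).map inlOp).flatMap φ = describeOp G off m o := by
  unfold RawOp.ops describeOp
  split_ifs with h
  · rw [List.map_singleton, List.flatMap_singleton, hφ]
    rfl
  · rfl

/-- Placing a trial in its copy shifts all its positions by the offset of the copy and changes
nothing else in its description. -/
theorem flatMap_encodeOp_trial {K N T n : ℕ} (hn : n ≤ m) (hm : 0 < m) (c : Fin K × Fin N) (x : ℕ)
    (b : Bool) (U s : ℕ) (w : List Bool) :
    ((trial n x b (decode G U s m w)).map (liftOp (copyPos K N T m) c)).flatMap
        (verifierGates G).encodeOp =
      describeTrial G (offset N m c.1 c.2) m n s U x b w := by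
  have hφ : ∀ o, (verifierGates G).encodeOp (liftOp (copyPos K N T m) c o) =
      describe (verifierGates G) o.1 fun i => offset N m c.1 c.2 + (o.2 i : ℕ) := fun o =>
    encodeOp_eq _
  rw [List.flatMap_map, trial, List.flatMap_append, List.flatMap_append,
    flatMap_encodeOp_toOps _ (fun o ho => valid_prepare hn ho) _ hφ,
    flatMap_encodeOp_toOps _ (fun o ho => valid_flip hm ho) _ hφ, decode, List.map_flatMap,
    List.flatMap_assoc, describeTrial]
  congr 2
  refine List.flatMap_congr fun i _ => ?_
  rw [List.map_flatMap, List.flatMap_assoc]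
  exact List.flatMap_congr fun o _ => flatMap_encodeOp_ops o _ hφ

theorem flatMap_finRange {B : Type} {k : ℕ} (g : ℕ → List B) :
    ((List.finRange k).flatMap fun i : Fin k => g i) = (List.range k).flatMap g := by
  rw [← List.map_coe_finRange_eq_range, List.flatMap_map]

end Descriptions

/-- The description of the verification circuit. -/
def description (G : GateSet) (K N T n m s U : ℕ) (F : ℕ → Bool) (w : List Bool) :
    List ((verifierGates G).ι ⊕ Bool) :=
  List.replicate (width K N T m) (Sum.inr true) ++ Sum.inr false ::
    (((List.range K).flatMap fun x => (List.range N).flatMap fun i =>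
      describeTrial G (offset N m x i) m n s U x (F x) w) ++
    (threshold K N T m).flatMap (describeCl G 0))

/-- The dependent types of the circuit disappear, leaving nested loops over numbers that the rules
for `PC` can follow. -/
theorem encodeCircuit_verification {G : GateSet} {a b : ℕ × ℕ} {n t : ℕ} (hn : 0 < n) (F : ℕ → Bool)
    (U s : ℕ) (w : List Bool) :
    (verifierGates G).encodeCircuit (verification a b n t F (decode G U s (n + t) w)) =
      description G (2 ^ n) (trials (2 ^ n) a b) (quota (2 ^ n) a b) n (n + t) s U F w := by
  have hm : 0 < n + t := by omega
  rw [GateSet.encodeCircuit, description, verification]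
  simp only
  congr 2
  rw [repetition, List.flatMap_append]
  congr 1
  · rw [List.flatMap_assoc]
    simp only [flatMap_encodeOp_trial (Nat.le_add_right n t) hm]
    change List.flatMap _ (List.product _ _) = _
    rw [List.product, List.flatMap_assoc, ← flatMap_finRange fun x => _]
    refine List.flatMap_congr fun x _ => ?_
    rw [List.flatMap_map, ← flatMap_finRange fun i => _]
  · exact flatMap_encodeOp_toOps _ (fun o ho => valid_threshold hm ho) _ fun o => by
      simp only [zero_add]
      exact encodeOp_eq o

end MinQCircuit

end

noncomputable section

namespace MinQCircuit

open StackProg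

/-! ### Computing the description -/

/-- The alphabet for the computation of the description. -/
abbrev Sym (G : GateSet) : Type := Option ((verifierGates G).ι ⊕ Bool)

/-- A bit as a symbol. -/
def bit (G : GateSet) (b : Bool) : Sym G := some (.inr b)

/-- The bit that a symbol stands for. -/
def unbit {G : GateSet} : Sym G → Bool
  | some (.inr b) => b
  | _ => false

theorem bit_injective {G : GateSet} : Function.Injective (bit G) := fun b b' h => by
  simpa [bit] using h

variable {G : GateSet} {J : Type} {O : J → Oracle (Sym G)} {α : Type} {D : α → Prop}
  {vs : List (α → List (Sym G))}

/-- The binary string `u a` can be computed. -/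
def Bits (O : J → Oracle (Sym G)) (D : α → Prop) (vs : List (α → List (Sym G)))
    (u : α → List Bool) : Prop :=
  PC O D vs fun a => (u a).map (bit G)

/-- The description `l a` can be computed. -/
def Desc (O : J → Oracle (Sym G)) (D : α → Prop) (vs : List (α → List (Sym G)))
    (l : α → List ((verifierGates G).ι ⊕ Bool)) : Prop :=
  PC O D vs fun a => (l a).map some

section Bits

variable {u : α → List Bool} {c d n x K : α → ℕ}

theorem Bits.lift (h : Bits O D vs u) {β : Type} {E : α × β → Prop}
    {ws : List (α × β → List (Sym G))} :
    Bits O (fun z => D z.1 ∧ E z) (ws ++ vs.map fun v z => v z.1) fun z => u z.1 :=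
  PC.lift h

theorem Bits.leading (hu : Bits O D vs u) : PCN O D vs fun a => leading (u a) :=
  (PCN.leading unbit hu).congr fun a _ => by
    rw [List.takeWhile_map, List.length_map]
    rfl

theorem Bits.drop (hc : PCN O D vs c) (hu : Bits O D vs u) :
    Bits O D vs fun a => (u a).drop (c a) :=
  (PC.drop hc hu).congr fun _ _ => List.map_drop.symm

theorem Bits.len (hu : Bits O D vs u) : PCN O D vs fun a => (u a).length :=
  (PC.len hu).congr fun _ _ => List.length_map _

theorem Bits.getElem? (hu : Bits O D vs u) (hc : PCN O D vs c) :
    PT O D vs fun a => (u a)[c a]? = some true :=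
  (PT.head (PC.drop hc hu) (· = some (bit G true))).congr fun a _ => by
    rw [List.head?_drop, List.getElem?_map]
    cases (u a)[c a]? with
    | none => simp
    | some b => simp [bit_injective.eq_iff]

theorem PCN.ite {P : α → Prop} [∀ a, Decidable (P a)] (hP : PT O D vs P) (hc : PCN O D vs c)
    (hd : PCN O D vs d) : PCN O D vs fun a => if P a then c a else d a :=
  (PC.ite hP (PC.restrict hc fun _ h => h.1) (PC.restrict hd fun _ h => h.1)).congr fun a _ => by
    beta_reduce
    split_ifs <;> rfl

theorem PCN.sum {g : α → ℕ → ℕ} (hc : PCN O D vs c)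
    (hg : PCN O (fun z : α × ℕ => D z.1 ∧ z.2 < c z.1)
      ((fun z => List.replicate z.2 default) :: vs.map fun v z => v z.1) fun z => g z.1 z.2) :
    PCN O D vs fun a => ∑ j ∈ Finset.range (c a), g a j :=
  (PC.range (g := fun a j => List.replicate (g a j) default) hc hg).congr fun a _ => by
    beta_reduce
    generalize c a = k
    induction k with
    | zero => rfl
    | succ k ih => rw [List.range_succ, List.flatMap_append, ih, Finset.sum_range_succ,
        List.replicate_add, List.flatMap_singleton]

/-- The bit is the parity of `x / 2 ^ c`, obtained as `q - 2 * (q / 2)`. The bound `K` makes the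
truncated power of two exact. -/
theorem PT.testBit (hK : PCN O D vs K) (hx : PCN O D vs x) (hc : PCN O D vs c)
    (h : ∀ a, D a → 2 ^ c a ≤ K a) : PT O D vs fun a => (x a).testBit (c a) = true := by
  have hp : PCN O D vs fun a => min (2 ^ c a) (K a) := PCN.twoPow hc hK
  have hq := PCN.div hx hp fun a ha => by
    have := h a ha
    have := Nat.two_pow_pos (c a)
    omega
  have h2 := PCN.div hq (PCN.const 2) fun _ _ => by omega
  refine (PT.eq (PCN.sub hq (PCN.add h2 h2)) (PCN.const 1)).congr fun a ha => ?_
  rw [Nat.testBit_eq_decide_div_mod_eq, min_eq_left (h a ha), decide_eq_true_iff]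
  omega

end Bits

section Describe

variable {t x y z off B N T i j K m : α → ℕ}

theorem Desc.append {l l' : α → List ((verifierGates G).ι ⊕ Bool)} (h : Desc O D vs l)
    (h' : Desc O D vs l') : Desc O D vs fun a => l a ++ l' a :=
  (PC.append h h').congr fun _ _ => List.map_append.symm

theorem Desc.range {c : α → ℕ} {l : α → ℕ → List ((verifierGates G).ι ⊕ Bool)}
    (hc : PCN O D vs c)
    (h : Desc O (fun z : α × ℕ => D z.1 ∧ z.2 < c z.1)
      ((fun z => List.replicate z.2 default) :: vs.map fun v z => v z.1) fun z => l z.1 z.2) :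
    Desc O D vs fun a => (List.range (c a)).flatMap (l a) :=
  (PC.range (g := fun a j => (l a j).map some) hc h).congr fun _ _ => List.map_flatMap.symm

theorem Desc.congr {l l' : α → List ((verifierGates G).ι ⊕ Bool)} (h : Desc O D vs l)
    (e : ∀ a, D a → l a = l' a) : Desc O D vs l' :=
  PC.congr h fun a ha => by rw [e a ha]

theorem Desc.nil : Desc O D vs fun _ => [] := PC.nil

theorem Desc.ite {l l' : α → List ((verifierGates G).ι ⊕ Bool)} {P : α → Prop}
    [∀ a, Decidable (P a)] (hP : PT O D vs P) (h : Desc O D vs l) (h' : Desc O D vs l') :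
    Desc O D vs fun a => if P a then l a else l' a :=
  (PC.ite hP (PC.restrict h fun _ h => h.1) (PC.restrict h' fun _ h => h.1)).congr fun a _ => by
    beta_reduce
    split_ifs <;> rfl

/-- The arity of a gate is a constant, so the enumeration of its positions is unrolled in the
program. -/
theorem Desc.describe (g : (verifierGates G).ι) {p : Fin ((verifierGates G).arity g) → α → ℕ}
    (h : ∀ r, PCN O D vs (p r)) :
    Desc O D vs fun a => describe (verifierGates G) g fun r => p r a := by
  refine (PC.append (PC.symbol (some (Sum.inl g))) (PC.flatMap_const (List.finRange _)
    (g := fun r a => List.replicate (p r a) (bit G true) ++ [bit G false]) fun r _ =>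
      PC.append (PC.replicate (h r) _) (PC.symbol _))).congr fun a _ => ?_
  beta_reduce
  rw [MinQCircuit.describe, List.ofFn_eq_map, List.flatMap_map, List.map_cons, List.map_flatMap,
    List.singleton_append]
  simp [bit]

theorem Desc.notAt (hoff : PCN O D vs off) (ht : PCN O D vs t) :
    Desc O D vs fun a => describeCl G (off a) (notAt (t a)) :=
  Desc.describe (.inr .not) (p := fun _ a => off a + t a) fun _ => PCN.add hoff ht

theorem Desc.copyAt (ht : PCN O D vs t) (hx : PCN O D vs x) :
    Desc O D vs fun a => describeCl G 0 (copyAt (t a) (x a)) := by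
  refine Desc.describe (.inr .copy) (p := fun r a => 0 + (MinQCircuit.copyAt (t a) (x a)).2 r) ?_
  have : ∀ r : Fin 2, PCN O D vs fun a => 0 + (Fin.cons (t a) (fun _ => x a) : Fin 2 → ℕ) r := by
    intro r
    fin_cases r
    · exact ht.congr fun a _ => (zero_add _).symm
    · exact hx.congr fun a _ => (zero_add _).symm
  exact this

theorem Desc.stepAt (ht : PCN O D vs t) (hx : PCN O D vs x) (hy : PCN O D vs y)
    (hz : PCN O D vs z) :
    Desc O D vs fun a => describeCl G 0 (stepAt (t a) (x a) (y a) (z a)) := by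
  refine Desc.describe (.inr .step)
    (p := fun r a => 0 + (MinQCircuit.stepAt (t a) (x a) (y a) (z a)).2 r) ?_
  have : ∀ r : Fin 4, PCN O D vs fun a => 0 + (![t a, x a, y a, z a] : Fin 4 → ℕ) r := by
    intro r
    fin_cases r
    · exact ht.congr fun a _ => (zero_add _).symm
    · exact hx.congr fun a _ => (zero_add _).symm
    · exact hy.congr fun a _ => (zero_add _).symm
    · exact hz.congr fun a _ => (zero_add _).symm
  exact this

theorem PCN.loc (hB : PCN O D vs B) (hN : PCN O D vs N) (hT : PCN O D vs T) (hx : PCN O D vs x)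
    (hi : PCN O D vs i) (hj : PCN O D vs j) :
    PCN O D vs fun a => loc (B a) (N a) (T a) (x a) (i a) (j a) :=
  (hB.add (((hx.mul (hN.add (PCN.const 1))).add hi).mul (hT.add (PCN.const 2)))).add hj

theorem PCN.offset (hN : PCN O D vs N) (hm : PCN O D vs m) (hx : PCN O D vs x)
    (hi : PCN O D vs i) : PCN O D vs fun a => offset (N a) (m a) (x a) (i a) :=
  (PCN.const 1).add (((hx.mul hN).add hi).mul hm)

theorem PCN.base (hK : PCN O D vs K) (hN : PCN O D vs N) (hm : PCN O D vs m) :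
    PCN O D vs fun a => base (K a) (N a) (m a) :=
  (PCN.const 1).add ((hK.mul hN).mul hm)

theorem PCN.width (hK : PCN O D vs K) (hN : PCN O D vs N) (hT : PCN O D vs T)
    (hm : PCN O D vs m) : PCN O D vs fun a => width (K a) (N a) (T a) (m a) :=
  (PCN.base hK hN hm).add (((hK.add (PCN.const 1)).mul (hN.add (PCN.const 1))).mul
    (hT.add (PCN.const 2)))

theorem Desc.countBlock (hB : PCN O D vs B) (hN : PCN O D vs N) (hT : PCN O D vs T)
    (hm : PCN O D vs m) (hx : PCN O D vs x) :
    Desc O D vs fun a =>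
      (countBlock (B a) (N a) (T a) (offset (N a) (m a)) (x a)).flatMap (describeCl G 0) := by
  have one : ∀ {β : Type} {D : β → Prop} {vs : List (β → List (Sym G))}, PCN O D vs fun _ => 1 :=
    PCN.const 1
  have zero : ∀ {β : Type} {D : β → Prop} {vs : List (β → List (Sym G))}, PCN O D vs fun _ => 0 :=
    PCN.const 0
  refine (Desc.append (Desc.range (l := fun a i => (List.range (T a + 1)).flatMap fun j =>
    describeCl G 0 (MinQCircuit.stepAt (MinQCircuit.loc (B a) (N a) (T a) (x a) (i + 1) (j + 1))
      (MinQCircuit.loc (B a) (N a) (T a) (x a) i (j + 1)) (MinQCircuit.loc (B a) (N a) (T a) (x a) i j)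
      (MinQCircuit.offset (N a) (m a) (x a) i))) hN
    (Desc.range ((hT.lift (ws := [_])).add one)
      (l := fun (b : α × ℕ) j => describeCl G 0 (MinQCircuit.stepAt
        (MinQCircuit.loc (B b.1) (N b.1) (T b.1) (x b.1) (b.2 + 1) (j + 1))
        (MinQCircuit.loc (B b.1) (N b.1) (T b.1) (x b.1) b.2 (j + 1))
        (MinQCircuit.loc (B b.1) (N b.1) (T b.1) (x b.1) b.2 j)
        (MinQCircuit.offset (N b.1) (m b.1) (x b.1) b.2))) ?_))
    (Desc.copyAt (PCN.loc hB hN hT (hx.add one) zero one) (PCN.loc hB hN hT hx hN (hT.add one)))).congr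
    fun a _ => ?_
  · have hB' := (hB.lift (β := ℕ) (E := fun z => z.2 < N z.1)
      (ws := [fun z => List.replicate z.2 default])).lift (β := ℕ)
        (E := fun z => z.2 < T z.1.1 + 1) (ws := [fun z => List.replicate z.2 default])
    have hN' := (hN.lift (β := ℕ) (E := fun z => z.2 < N z.1)
      (ws := [fun z => List.replicate z.2 default])).lift (β := ℕ)
        (E := fun z => z.2 < T z.1.1 + 1) (ws := [fun z => List.replicate z.2 default])
    have hT' := (hT.lift (β := ℕ) (E := fun z => z.2 < N z.1)
      (ws := [fun z => List.replicate z.2 default])).lift (β := ℕ)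
        (E := fun z => z.2 < T z.1.1 + 1) (ws := [fun z => List.replicate z.2 default])
    have hm' := (hm.lift (β := ℕ) (E := fun z => z.2 < N z.1)
      (ws := [fun z => List.replicate z.2 default])).lift (β := ℕ)
        (E := fun z => z.2 < T z.1.1 + 1) (ws := [fun z => List.replicate z.2 default])
    have hx' := (hx.lift (β := ℕ) (E := fun z => z.2 < N z.1)
      (ws := [fun z => List.replicate z.2 default])).lift (β := ℕ)
        (E := fun z => z.2 < T z.1.1 + 1) (ws := [fun z => List.replicate z.2 default])
    have hi := (PCN.index (O := O) (E := fun z : α × ℕ => D z.1 ∧ z.2 < N z.1)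
      (ws := vs.map fun v z => v z.1)).lift (β := ℕ)
        (E := fun z => z.2 < T z.1.1 + 1) (ws := [fun z => List.replicate z.2 default])
    exact Desc.stepAt (PCN.loc hB' hN' hT' hx' (hi.add one) (PCN.index.add one))
      (PCN.loc hB' hN' hT' hx' hi (PCN.index.add one)) (PCN.loc hB' hN' hT' hx' hi PCN.index)
      (PCN.offset hN' hm' hx' hi)
  · rw [MinQCircuit.countBlock, List.flatMap_append, List.flatMap_singleton, List.flatMap_assoc]
    simp only [List.flatMap_map]

theorem Desc.threshold (hK : PCN O D vs K) (hN : PCN O D vs N) (hT : PCN O D vs T)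
    (hm : PCN O D vs m) :
    Desc O D vs fun a => (threshold (K a) (N a) (T a) (m a)).flatMap (describeCl G 0) := by
  have one : PCN O D vs fun _ => 1 := PCN.const 1
  have zero : PCN O D vs fun _ => 0 := PCN.const 0
  have hB := PCN.base hK hN hm
  refine (Desc.append (Desc.append (Desc.notAt zero (PCN.loc hB hN hT zero zero one))
    (Desc.range hK (l := fun a x => (MinQCircuit.countBlock (MinQCircuit.base (K a) (N a) (m a))
      (N a) (T a) (MinQCircuit.offset (N a) (m a)) x).flatMap (describeCl G 0))
      (Desc.countBlock (hB.lift (ws := [_])) (hN.lift (ws := [_])) (hT.lift (ws := [_]))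
        (hm.lift (ws := [_])) PCN.index)))
    (Desc.copyAt zero (PCN.loc hB hN hT hK zero one))).congr fun a _ => ?_
  rw [MinQCircuit.threshold, List.flatMap_append, List.flatMap_singleton, countAll,
    List.flatMap_cons, List.flatMap_assoc]

end Describe

end MinQCircuit

end

noncomputable section

/-! ### Trials, parsing of instances, and calls for the thresholds. -/

namespace MinQCircuit

open StackProg

variable {G : GateSet} {J : Type} {O : J → Oracle (Sym G)} {α : Type} {D : α → Prop}
  {vs : List (α → List (Sym G))}

section Circuit

variable {u w F : α → List Bool} {U i r x off m n s K N T : α → ℕ}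

theorem PCN.entry (hU : PCN O D vs U) (hw : Bits O D vs w) (hi : PCN O D vs i)
    (hr : PCN O D vs r) : PCN O D vs fun a => entry G (U a) (w a) (i a) (r a) :=
  Bits.leading (Bits.drop (((hi.mul (PCN.const (maxArity G + 1))).add hr).mul
    ((hU.add (PCN.const (numGates G))).add (PCN.const 1))) hw)

/-- For a fixed gate, distinctness and range of the positions are finite conjunctions of
comparisons. -/
theorem Desc.describeOp (hoff : PCN O D vs off) (hm : PCN O D vs m) (g : G.ι)
    {p : Fin (G.arity g) → α → ℕ} (hp : ∀ r, PCN O D vs (p r)) :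
    Desc O D vs fun a => describeOp G (off a) (m a) ⟨g, fun r => p r a⟩ := by
  classical
  refine Desc.ite (PT.and (PT.congr (PT.forall_fin fun r => PT.forall_fin fun r' =>
    (?_ : PT O D vs fun a => p r a = p r' a → r = r')) fun a _ => Iff.rfl)
    (PT.forall_fin fun r => PT.lt (hp r) hm))
    (Desc.describe (.inl g) (p := fun r a => off a + p r a) fun r => hoff.add (hp r)) Desc.nil
  by_cases h : r = r'
  · exact PT.true.congr fun a _ => by simp [h]
  · exact (PT.not (PT.eq (hp r) (hp r'))).congr fun a _ => by simp [h]

theorem flatMap_finRange_ite {B : Type} (k v : ℕ) (g : Fin k → List B) :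
    ((List.finRange k).flatMap fun j : Fin k => if (j : ℕ) = v then g j else []) =
      if h : v < k then g ⟨v, h⟩ else [] := by
  have key : ∀ l : List (Fin k), l.Nodup →
      (l.flatMap fun j : Fin k => if (j : ℕ) = v then g j else []) =
        if h : ∃ h : v < k, ⟨v, h⟩ ∈ l then g ⟨v, h.1⟩ else [] := by
    intro l
    induction l with
    | nil => simp
    | cons j l ih =>
      intro hl
      obtain ⟨h1, h2⟩ := List.nodup_cons.1 hl
      rw [List.flatMap_cons, ih h2]
      by_cases hj : (j : ℕ) = v
      · subst hj
        simp [h1]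
      · have : ∀ h : v < k, (⟨v, h⟩ : Fin k) ≠ j := fun h e => hj (by rw [← e])
        simp [hj, this]
  rw [key _ (List.nodup_finRange k)]
  simp

/-- The gate number is known only at run time, while the arity shapes the program. There is
therefore a separate piece of program for each gate, guarded by a test of the number. -/
theorem Desc.slot (hU : PCN O D vs U) (hw : Bits O D vs w) (hi : PCN O D vs i)
    (hoff : PCN O D vs off) (hm : PCN O D vs m) : Desc O D vs fun a =>
      (slot G (U a) (w a) (i a)).flatMap (MinQCircuit.describeOp G (off a) (m a)) := by
  refine PC.congr (PC.flatMap_const (List.finRange (numGates G)) (g := fun j a =>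
    (if (j : ℕ) = MinQCircuit.entry G (U a) (w a) (i a) 0 then
      MinQCircuit.describeOp G (off a) (m a)
        ⟨gate G j, fun r => MinQCircuit.entry G (U a) (w a) (i a) (r + 1)⟩ else []).map some)
    fun j _ => ?_) fun a _ => ?_
  · exact Desc.ite (PT.eq (PCN.const j) (PCN.entry hU hw hi (PCN.const 0)))
      (Desc.describeOp hoff hm (gate G j)
        (p := fun r a => MinQCircuit.entry G (U a) (w a) (i a) (r + 1))
        fun r => PCN.entry hU hw hi (PCN.const (r + 1))) Desc.nil
  · beta_reduce
    rw [← List.map_flatMap, flatMap_finRange_ite, MinQCircuit.slot]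
    split_ifs with h
    · rw [List.flatMap_singleton]
    · rfl

theorem flatMap_filter {B C : Type} (l : List B) (p : B → Bool) (g : B → List C) :
    (l.filter p).flatMap g = l.flatMap fun b => if p b = true then g b else [] := by
  induction l with
  | nil => rfl
  | cons b l ih =>
    rw [List.flatMap_cons, ← ih]
    by_cases h : p b = true
    · simp [h]
    · simp [h]

theorem Desc.prepare (hn : PCN O D vs n) (hx : PCN O D vs x) (hoff : PCN O D vs off)
    (hK : PCN O D vs K) (h : ∀ a, D a → K a = 2 ^ n a) :
    Desc O D vs fun a => (prepare (n a) (x a)).flatMap (describeCl G (off a)) := by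
  refine Desc.congr (Desc.range (l := fun a b => if (x a).testBit b = true then
    describeCl G (off a) (MinQCircuit.notAt b) else []) hn
    (Desc.ite (PT.testBit (hK.lift (ws := [_])) (hx.lift (ws := [_])) PCN.index ?_)
      (Desc.notAt (hoff.lift (ws := [_])) PCN.index) Desc.nil)) fun a _ => ?_
  · intro z hz
    rw [h _ hz.1]
    exact Nat.pow_le_pow_right (by omega) hz.2.le
  · rw [MinQCircuit.prepare, List.flatMap_map, flatMap_filter]

open scoped Classical in
theorem Desc.trial (hK : PCN O D vs K) (h : ∀ a, D a → K a = 2 ^ n a) (hn : PCN O D vs n)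
    (hm : PCN O D vs m) (hs : PCN O D vs s) (hU : PCN O D vs U) (hF : Bits O D vs F)
    (hw : Bits O D vs w) (hx : PCN O D vs x) (hoff : PCN O D vs off) : Desc O D vs fun a =>
      describeTrial G (off a) (m a) (n a) (s a) (U a) (x a) (decide ((F a)[x a]? = some true))
        (w a) := by
  refine Desc.append (Desc.append (Desc.prepare hn hx hoff hK h) (Desc.range (l := fun a j =>
    (MinQCircuit.slot G (U a) (w a) j).flatMap (MinQCircuit.describeOp G (off a) (m a))) hs
    (Desc.slot (hU.lift (ws := [_])) (hw.lift (ws := [_])) PCN.index (hoff.lift (ws := [_]))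
      (hm.lift (ws := [_]))))) ((Desc.ite (hF.getElem? hx) Desc.nil
        (Desc.notAt hoff (PCN.const 0))).congr fun a _ => ?_)
  by_cases h : (F a)[x a]? = some true <;> simp [h, flip]

open scoped Classical in
theorem Desc.description (hK : PCN O D vs K) (h : ∀ a, D a → K a = 2 ^ n a) (hN : PCN O D vs N)
    (hT : PCN O D vs T) (hn : PCN O D vs n) (hm : PCN O D vs m) (hs : PCN O D vs s)
    (hU : PCN O D vs U) (hF : Bits O D vs F) (hw : Bits O D vs w) : Desc O D vs fun a =>
      description G (K a) (N a) (T a) (n a) (m a) (s a) (U a)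
        (fun x => decide ((F a)[x]? = some true)) (w a) := by
  -- Every parameter is carried into the loop over the inputs and the loop over the repetitions
  -- inside it.
  have lift2 := fun {c : α → ℕ} (hc : PCN O D vs c) => (hc.lift (β := ℕ)
    (E := fun z => z.2 < K z.1) (ws := [fun z => List.replicate z.2 default])).lift (β := ℕ)
    (E := fun z => z.2 < N z.1.1) (ws := [fun z => List.replicate z.2 default])
  have liftB2 := fun {l : α → List Bool} (hl : Bits O D vs l) => (hl.lift (β := ℕ)
    (E := fun z => z.2 < K z.1) (ws := [fun z => List.replicate z.2 default])).lift (β := ℕ)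
    (E := fun z => z.2 < N z.1.1) (ws := [fun z => List.replicate z.2 default])
  have hx := (PCN.index (O := O) (E := fun z : α × ℕ => D z.1 ∧ z.2 < K z.1)
    (ws := vs.map fun v z => v z.1)).lift (β := ℕ)
      (E := fun z => z.2 < N z.1.1) (ws := [fun z => List.replicate z.2 default])
  have hrow : Desc O (fun z : α × ℕ => D z.1 ∧ z.2 < K z.1)
      ((fun z => List.replicate z.2 default) :: vs.map fun v z => v z.1) fun z =>
      (List.range (N z.1)).flatMap fun i =>
        describeTrial G (MinQCircuit.offset (N z.1) (m z.1) z.2 i) (m z.1) (n z.1) (s z.1) (U z.1)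
          z.2 (decide ((F z.1)[z.2]? = some true)) (w z.1) :=
    Desc.range (c := fun z : α × ℕ => N z.1) (hN.lift (ws := [_]))
      (Desc.trial (lift2 hK) (fun z hz => h _ hz.1.1) (lift2 hn) (lift2 hm) (lift2 hs)
        (lift2 hU) (liftB2 hF) (liftB2 hw) hx (PCN.offset (lift2 hN) (lift2 hm) hx PCN.index))
  have hbody := Desc.range (l := fun a x => (List.range (N a)).flatMap fun i =>
      describeTrial G (MinQCircuit.offset (N a) (m a) x i) (m a) (n a) (s a) (U a) x
        (decide ((F a)[x]? = some true)) (w a)) hK hrow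
  refine (PC.append (PC.replicate (PCN.width hK hN hT hm) (bit G true)) (PC.append
    (PC.symbol (bit G false)) (Desc.append hbody (Desc.threshold hK hN hT hm)))).congr
      fun a _ => ?_
  beta_reduce
  simp only [MinQCircuit.description, List.map_append, List.map_replicate, List.map_cons]
  rfl

end Circuit

section Parse

variable {u : α → List Bool}

theorem Bits.sizeParam (hu : Bits O D vs u) : PCN O D vs fun a => sizeParam (u a) := hu.leading

theorem Bits.afterSize (hu : Bits O D vs u) : Bits O D vs fun a => afterSize (u a) :=
  Bits.drop (hu.sizeParam.add (PCN.const 1)) hu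

theorem Bits.inputs (hu : Bits O D vs u) : PCN O D vs fun a => inputs (u a) := hu.afterSize.leading

theorem Bits.table (hu : Bits O D vs u) : Bits O D vs fun a => table (u a) :=
  Bits.drop (hu.inputs.add (PCN.const 1)) hu.afterSize

/-- On arbitrary strings `2 ^ n` may be too large to be written in unary. Truncated at one more than
the length of the table, it gives the same comparison. -/
theorem Bits.wellFormed (hu : Bits O D vs u) : PT O D vs fun a => WellFormed (u a) :=
  (PT.and (PT.le (PCN.const 1) hu.inputs) (PT.le (PCN.twoPow hu.inputs
    (hu.table.len.add (PCN.const 1))) hu.table.len)).congr fun a _ =>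
      and_congr_right fun _ => by omega

/-- In a well-formed string the table has at least `2 ^ n` symbols, so the truncation at its length
is exact. -/
theorem Bits.twoPowInputs (hu : Bits O D vs u) (h : ∀ a, D a → WellFormed (u a)) :
    PCN O D vs fun a => 2 ^ MinQCircuit.inputs (u a) :=
  (PCN.twoPow hu.inputs hu.table.len).congr fun a ha => min_eq_left (h a ha).2

theorem Bits.ancillas (hu : Bits O D vs u) (h : ∀ a, D a → WellFormed (u a)) :
    PCN O D vs fun a => ancillas (u a) := by
  have hl := Bits.drop (hu.twoPowInputs h) hu.table
  exact PCN.inf (PCN.sum (g := fun a j => if ((MinQCircuit.table (u a)).drop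
      (2 ^ MinQCircuit.inputs (u a)))[j]? = some true
    then min (2 ^ j) (MinQCircuit.sizeParam (u a) + 1) else 0) hl.len
    (PCN.ite ((hl.lift (ws := [_])).getElem? PCN.index)
      (PCN.twoPow PCN.index ((hu.sizeParam.lift (ws := [_])).add (PCN.const 1))) (PCN.const 0)))
    hu.sizeParam

end Parse

section Oracles

/-- A machine for a function from binary strings to binary strings, as a subroutine. -/
def oracleOf {β γ : Type} {eb : β → List Bool} {ec : γ → List Bool} {f : β → γ}
    (M : TM2ComputableInPolyTime eb ec f) : Oracle (Sym G) where
  tm := M.tm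
  dec := fun x => M.inputAlphabet.symm (unbit x)
  enc := fun x => bit G (M.outputAlphabet x)

/-- As `unbit` undoes `bit`, the subroutine receives precisely the input for which its behaviour is
guaranteed. -/
theorem Bits.call {β γ : Type} {eb : β → List Bool} {ec : γ → List Bool} {f : β → γ}
    (M : TM2ComputableInPolyTime eb ec f) (j : J) (hj : O j = oracleOf M) {v : α → β}
    (hv : Bits O D vs fun a => eb (v a)) : Bits O D vs fun a => ec (f (v a)) := by
  have key : ∀ b : β, ∃ r : List ((O j).tm.Γ (O j).tm.k₁),
      (∃ k ≤ M.time.eval (eb b).length, StepN (O j).tm.step k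
        (initList (O j).tm (((eb b).map (bit G)).map (O j).dec)) (haltList (O j).tm r)) ∧
      r.map (O j).enc = (ec (f b)).map (bit G) := by
    rw [hj]
    intro b
    refine ⟨(ec (f b)).map M.outputAlphabet.symm,
      ⟨(M.outputsFun b).steps, (M.outputsFun b).steps_le_m, ?_⟩, ?_⟩
    · have := (M.outputsFun b).evals_in_steps
      have e : ((eb b).map (bit G)).map (oracleOf (G := G) M).dec =
          (eb b).map M.inputAlphabet.invFun := by
        rw [List.map_map]; rfl
      rw [e]
      exact this
    · change List.map (fun x => bit G (M.outputAlphabet x))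
        (List.map M.outputAlphabet.symm (ec (f b))) = _
      rw [List.map_map]
      refine List.map_congr_left fun x _ => ?_
      change bit G (M.outputAlphabet (M.outputAlphabet.symm x)) = bit G x
      rw [Equiv.apply_symm_apply]
  choose r hr hr' using key
  refine (PC.call hv j (r := fun a => r (v a)) M.time fun a _ => ?_).congr fun a _ => hr' _
  rw [List.length_map]
  exact hr _

variable {q : α → ℕ × ℕ}

theorem Bits.fst (h : Bits O D vs fun a => encodeUnaryPair (q a)) : PCN O D vs fun a => (q a).1 :=
  h.leading.congr fun _ _ => leading_replicate_append _ _

theorem Bits.snd (h : Bits O D vs fun a => encodeUnaryPair (q a)) : PCN O D vs fun a => (q a).2 :=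
  (Bits.drop (h.fst.add (PCN.const 1)) h).len.congr fun a _ => by
    rw [encodeUnaryPair, drop_replicate_append, List.length_replicate]

end Oracles

/-- The verifier is computable in polynomial time. -/
theorem computable_verifier (G : GateSet) {a b : ℕ → ℕ × ℕ}
    (ha : Nonempty (TM2ComputableInPolyTime (fun n => encodeUnary (2 ^ n)) encodeUnaryPair a))
    (hb : Nonempty (TM2ComputableInPolyTime (fun n => encodeUnary (2 ^ n)) encodeUnaryPair b)) :
    Nonempty (TM2ComputableInPolyTime encodePair (verifierGates G).encodeCircuit
      (verifier G a b)) := by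
  classical
  obtain ⟨Ma⟩ := ha
  obtain ⟨Mb⟩ := hb
  -- The two subroutines are the machines that approximate the thresholds.
  let O : Bool → Oracle (Sym G) := fun j => cond j (oracleOf Ma) (oracleOf Mb)
  let vs : List (List Bool × List Bool → List (Sym G)) :=
    [fun q => (encodePair q).map (Option.map Sum.inr)]
  have hv : PC O (fun _ => True) vs fun q => q.1.map (bit G) ++ none :: q.2.map (bit G) :=
    PC.congr (PC.var List.mem_cons_self) fun q _ => by
      simp only [encodePair, List.map_append, List.map_cons, List.map_map]
      rfl
  have hlen : PCN O (fun _ => True) vs fun q => q.1.length :=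
    (PCN.leading Option.isSome hv).congr fun q _ => by
      rw [List.takeWhile_append_of_pos fun x hx => by
        obtain ⟨b, -, rfl⟩ := List.mem_map.1 hx; rfl]
      simp
  have hu : Bits O (fun _ => True) vs fun q => q.1 :=
    (PC.take hlen hv).congr fun q _ => List.take_left' (List.length_map _)
  have hw : Bits O (fun _ => True) vs fun q => q.2 :=
    (PC.drop (hlen.add (PCN.const 1)) hv).congr fun q _ => by
      rw [← List.drop_drop, List.drop_left' (List.length_map _)]
      rfl
  have main : PC O (fun _ => True) vs fun q =>
      ((verifierGates G).encodeCircuit (verifier G a b q)).map some := by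
    refine (PC.ite hu.wellFormed (f := fun q => (description G (2 ^ inputs q.1)
      (trials (2 ^ inputs q.1) (a (inputs q.1)) (b (inputs q.1)))
      (quota (2 ^ inputs q.1) (a (inputs q.1)) (b (inputs q.1))) (inputs q.1)
      (inputs q.1 + ancillas q.1) (sizeParam q.1) q.1.length
      (fun x => decide ((table q.1)[x]? = some true)) q.2).map some) ?_
      -- Ill-formed strings lead to the empty circuit on zero qubits, whose description is the
      -- separator alone.
      (PC.symbol (bit G false))).congr fun q _ => ?_
    · replace hu : Bits O (fun q => True ∧ WellFormed q.1) vs fun q => q.1 :=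
        PC.restrict hu fun _ h => h.1
      replace hw : Bits O (fun q => True ∧ WellFormed q.1) vs fun q => q.2 :=
        PC.restrict hw fun _ h => h.1
      have hK := hu.twoPowInputs fun q hq => hq.2
      -- The machines for the thresholds expect `2 ^ n` in unary.
      have hK' : Bits O (fun q => True ∧ WellFormed q.1) vs fun q => encodeUnary (2 ^ inputs q.1) :=
        (PC.replicate hK (bit G true)).congr fun q _ => by simp [encodeUnary]
      have hA := Bits.call Ma true rfl hK'
      have hB := Bits.call Mb false rfl hK'
      have hD := hA.snd.mul hB.snd
      exact Desc.description hK (fun _ _ => rfl)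
        (((PCN.const 32).mul hK).mul (hD.mul hD))
        ((((PCN.const 16).mul hK).mul hD).mul ((hA.fst.mul hB.snd).add (hB.fst.mul hA.snd)))
        hu.inputs (hu.inputs.add (hu.ancillas fun q hq => hq.2)) hu.sizeParam hu.len hu.table hw
    · rw [verifier]
      split_ifs with h
      · rw [encodeCircuit_verification h.1]
      · rfl
  refine PC.computable (Option.map Sum.inr) (fun x => x.getD (.inr false)) main fun q => ?_
  rw [List.map_map]
  exact List.map_id _

end MinQCircuit

end

noncomputable section

namespace MinQCircuit

open StackProg

/-! ### The entries of the gates of the verifier -/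

/-- The subroutines of a program without subroutines. -/
def noOracle : Empty → Oracle Bool := fun e => e.elim

theorem polyTimeReal_zero : PolyTimeReal 0 := by
  refine ⟨fun _ => 0, ?_, fun k => by simp⟩
  refine PC.computable (O := noOracle) (f := fun _ => [false]) id id (PC.symbol false) fun k => ?_
  simp [encodeInt]

theorem bits_two_pow (k : ℕ) : (2 ^ k).bits = List.replicate k false ++ [true] := by
  induction k with
  | zero => simp
  | succ k ih =>
    have : 2 ^ (k + 1) = Nat.bit false (2 ^ k) := by rw [Nat.bit_false, pow_succ, mul_comm]
    rw [this, Nat.bits_append_bit _ _ (by simp), ih, List.replicate_succ, List.cons_append]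

/-- The approximation of `1` is `2 ^ k / 2 ^ k`; with the lowest bit first, its numerator is written
as `k` zeros and a one. -/
theorem polyTimeReal_one : PolyTimeReal 1 := by
  refine ⟨fun k => 2 ^ k, ?_, fun k => ?_⟩
  · have hk : PC noOracle (fun _ => True) [fun k => (encodeUnary k).map id] fun k =>
        (encodeUnary k).map id := PC.var List.mem_cons_self
    refine PC.computable (O := noOracle) id id (PC.append (PC.symbol false) (PC.append
      (PC.replicate hk.len false) (PC.symbol true))) fun k => ?_
    have h1 : ¬(2 : ℤ) ^ k < 0 := not_lt.2 (by positivity)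
    have h2 : ((2 : ℤ) ^ k).natAbs = 2 ^ k := by simp [Int.natAbs_pow]
    rw [encodeInt, h2, bits_two_pow]
    simp [encodeUnary, h1]
  · simp

theorem xorMatrix_apply {k : ℕ} (f : (Fin k → Bool) → Bool) (y z : Fin (k + 1) → Bool) :
    (xorMatrix f).1 y z = 0 ∨ (xorMatrix f).1 y z = 1 :=
  (ite_eq_or_eq _ _ _).symm

/-- The additional gates are permutation matrices, so beyond the entries of `G` only `0` and `1`
have to be computed. -/
theorem polyTimeEntries_verifierGates {G : GateSet} (hG : G.PolyTimeEntries) :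
    (verifierGates G).PolyTimeEntries := by
  rintro (g | c) i j
  · exact hG g i j
  · have : ((verifierGates G).mat (.inr c)).1 i j = 0 ∨ ((verifierGates G).mat (.inr c)).1 i j = 1 :=
      xorMatrix_apply c.fn i j
    rcases this with h | h
    · simpa [h] using polyTimeReal_zero
    · simpa [h] using ⟨polyTimeReal_one, polyTimeReal_zero⟩

end MinQCircuit

end

/-- The minimum quantum circuit size problem is in QCMA. -/
theorem mainTheorem1 (G : MinQCircuit.GateSet) (hG : G.PolyTimeEntries)
    (α β : ℕ → ℝ)
    (hlt : ∀ n, 1 ≤ n → β n < α n)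
    (hrange : ∀ n, 1 ≤ n → 1 / 2 < β n ∧ α n < 1)
    (hgap : ∃ p : Polynomial ℕ, ∀ n, 1 ≤ n → 1 ≤ (α n - β n) * ((p.eval (2 ^ n) : ℕ) : ℝ))
    (hα : MinQCircuit.ApproxInPolyTwoPow α (fun n => (α n - β n) / 4))
    (hβ : MinQCircuit.ApproxInPolyTwoPow β (fun n => (α n - β n) / 4)) :
    (MinQCircuit.MQCSP G α β hlt).InQCMA := by
  obtain ⟨a, ha, ha'⟩ := hα
  obtain ⟨b, hb, hb'⟩ := hβ
  exact ⟨MinQCircuit.verifierGates G, MinQCircuit.verifier G a b, MinQCircuit.witnessLength G,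
    MinQCircuit.polyTimeEntries_verifierGates hG, MinQCircuit.computable_verifier G ha hb,
    fun _ hx => MinQCircuit.verifier_complete hlt ha' hb' hx,
    fun _ hx w _ => MinQCircuit.verifier_sound hlt ha' hb' hx w⟩
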